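/- Let $n\ge 4$. **Diagrams.** The standard $n$-box is a rectangle with nodes $1,\dots,n$ on its north face and $1',\dots,n'$ on its south face. An *L-decorated diagram* is an isotopy class of finite families of pairwise disjoint curves (edges) in the box such that every node is the end of exactly one edge and all other edges are closed curves (loops); edges may carry finitely many decorations $\bullet$, such that all decorations can be moved simultaneously along the deformed edges to the left wall of the box without crossing an edge, and such that a diagram without non-propagating edge in the north face carries no decoration. (An edge is propagating if it joins the two faces.) Let $\mathcal P$ be the $\mathbb Z[\delta]$-algebra with basis these diagrams, $d'd$ being obtained by placing $d'$ on top of $d$ and gluing $i'$ of $d'$ to $i$ of $d$. Let $\widehat{\mathcal P}$ be its quotient by the local relations: an undecorated loop equals the factor $\delta$; two decorations on the same edge (or loop) cancel; in the presence of a loop with one decoration every other edge (or loop) loses its decorations. **Algebras.** For $1\le i\le n-1$ let $d_i$ be the undecorated diagram with edges $\{i,i+1\}$, $\{i',(i+1)'\}$ and $\{j,j'\}$ for $j\ne i,i+1$, and let $d_{\bar 1}$ be $d_1$ with one decoration on each of its two non-propagating edges. Let $\mathbb{D}\mathrm{TL}(D_n)$ be the unital $\mathbb Z[\delta]$-subalgebra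 of $\widehat{\mathcal P}$ generated by $d_{\bar 1},d_1,\dots,d_{n-1}$, and let $\mathrm{LFD}(D_n)$ be the quotient of $\mathbb{D}\mathrm{TL}(D_n)$ by the relation that diagrams with a decorated loop are $0$. **Type II diagrams and half-diagrams.** An L-decorated diagram is *$D$-admissible of type II* if it has no loops, every edge has at most one decoration, and the total number of decorations is even. Removing the propagating edges from such a diagram $d$, its upper half is the half-diagram $\overline d$ and its lower half, inverted in a horizontal line, is the half-diagram $\underline d$. The number $\mathbf p(h)$ of propagating edges of a half-diagram $h$ is the number of nodes that are not ends of its edges. **Cell datum.** Let $\Lambda=\{1,3,\dots,n\}$ if $n$ is odd and $\Lambda=\{0^+,0^-,2,4,\dots,n\}$ if $n$ is even, with $|0^\pm|=0$, $|i|=i$ otherwise, and $\lambda<\mu$ if and only if $|\lambda|<|\mu|$. Let $M(\lambda)$ be the set of half-diagrams $h$ arising from $D$-admissible diagrams of type II with $\mathbf p(h)=|\lambda|$, where for $\lambda=0^+$ (respectively $0^-$) the number of decorations of $h$ is required to be even (respectively odd). **Theorem.** Every $D$-admissible diagram of type II lies in $\mathbb{D}\mathrm{TL}(D_n)$. For $\lambda\in\Lambda$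 and $h_1,h_2\in M(\lambda)$ there is exactly one $D$-admissible diagram $h_1\circ h_2$ of type II with upper half-diagram $h_1$ and lower half-diagram $h_2$; let $C(h_1,h_2)=C^\lambda_{h_1,h_2}\in\mathrm{LFD}(D_n)$ be its image. There is a $\mathbb Z[\delta]$-linear map $*$ on $A=\mathrm{LFD}(D_n)$ that sends the image of each $D$-admissible diagram of type II to the image of its top-bottom inversion, and $(\Lambda,M,C,*)$ is a cell datum for $A$ over $\mathbb Z[\delta]$, that is: 1. every $M(\lambda)$ is finite, and $C:\coprod_{\lambda}M(\lambda)\times M(\lambda)\to A$ is injective and its image is a $\mathbb Z[\delta]$-basis of $A$; 2. $*$ is an involutory $\mathbb Z[\delta]$-linear anti-automorphism of $A$ with $(C^\lambda_{S,T})^*=C^\lambda_{T,S}$; 3. for all $a\in A$ and $\lambda\in\Lambda$ there are $r_a(S',S)\in\mathbb Z[\delta]$ ($S,S'\in M(\lambda)$) with $aC^\lambda_{S,T}\equiv\sum_{S'\in M(\lambda)}r_a(S',S)\,C^\lambda_{S',T}$ modulo the span of the $C^\mu_{S'',T''}$ with $\mu<\lambda$, for all $S,T\in M(\lambda)$. 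-/

import Mathlib

/-!
Decorated Temperley--Lieb diagrams of type `D`, the loop-free diagram algebra, and cell data.
-/

namespace LoopFree

/-- A system of decorated arcs on a set `V` of nodes, together with a collection of decorated loops.
`mate v` is the other end of the arc that starts at `v`; `mate v = v` means that no arc ends at `v`.
`deco v` is the number of decorations on the arc ending at `v`.
`loops` has one entry for every loop, namely its number of decorations. -/
@[ext]
structure Arcs (V : Type*) where
  mate : V → V
  deco : V → ℕ
  loops : Multiset ℕ
  mate_mate : ∀ v, mate (mate v) = v
  deco_mate : ∀ v, deco (mate v) = deco v
  deco_free : ∀ v, mate v = v → deco v = 0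

namespace Arcs

variable {V W X : Type*}

/-- `p` and `q` are different nodes, and each is the end of an arc. -/
def Gluable (A : Arcs V) (p q : V) : Prop := p ≠ q ∧ A.mate p ≠ p ∧ A.mate q ≠ q

/-- No arc and no loop carries a decoration. -/
def Undecorated (A : Arcs V) : Prop := (∀ v, A.deco v = 0) ∧ ∀ m ∈ A.loops, m = 0

/-- The disjoint union of two systems. -/
def sum (A : Arcs V) (B : Arcs W) : Arcs (V ⊕ W) where
  mate := Sum.map A.mate B.mate
  deco := Sum.elim A.deco B.deco
  loops := A.loops + B.loops
  mate_mate := by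
    rintro (v | v)
    · simp [A.mate_mate]
    · simp [B.mate_mate]
  deco_mate := by
    rintro (v | v)
    · simp [A.deco_mate]
    · simp [B.deco_mate]
  deco_free := by
    rintro (v | v)
    · simpa using A.deco_free v
    · simpa using B.deco_free v

/-- `B` is the image of `A` under the map `e` of nodes. -/
structure IsPush (e : V → W) (A : Arcs V) (B : Arcs W) : Prop where
  mate : ∀ v, B.mate (e v) = e (A.mate v)
  deco : ∀ v, B.deco (e v) = A.deco v
  free : ∀ w, w ∉ Set.range e → B.mate w = w
  loops : B.loops = A.loops

theorem IsPush.unique {e : V → W} (he : Function.Injective e) {A A' : Arcs V} {B : Arcs W}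
    (h : IsPush e A B) (h' : IsPush e A' B) : A = A' := by
  apply Arcs.ext
  · funext v
    exact he ((h.mate v).symm.trans (h'.mate v))
  · funext v
    exact (h.deco v).symm.trans (h'.deco v)
  · exact h.loops.symm.trans h'.loops

theorem IsPush.eq {e : V → W} {A : Arcs V} {B B' : Arcs W}
    (h : IsPush e A B) (h' : IsPush e A B') : B = B' := by
  have hm : ∀ w, B.mate w = B'.mate w := by
    intro w
    by_cases hw : w ∈ Set.range e
    · obtain ⟨v, rfl⟩ := hw
      rw [h.mate, h'.mate]
    · rw [h.free w hw, h'.free w hw]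
  apply Arcs.ext
  · funext w
    exact hm w
  · funext w
    by_cases hw : w ∈ Set.range e
    · obtain ⟨v, rfl⟩ := hw
      rw [h.deco, h'.deco]
    · rw [B.deco_free w (h.free w hw), B'.deco_free w (h'.free w hw)]
  · exact h.loops.trans h'.loops.symm

theorem IsPush.trans {e : V → W} {f : W → X} {A : Arcs V} {B : Arcs W} {C : Arcs X}
    (h : IsPush e A B) (h' : IsPush f B C) : IsPush (f ∘ e) A C where
  mate v := by simp [h'.mate, h.mate]
  deco v := by simp [h'.deco, h.deco]
  free x hx := by
    by_cases hw : x ∈ Set.range f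
    · obtain ⟨w, rfl⟩ := hw
      rw [h'.mate, h.free]
      rintro ⟨v, rfl⟩
      exact hx ⟨v, rfl⟩
    · exact h'.free x hw
  loops := h'.loops.trans h.loops

theorem IsPush.sum {Y : Type*} {e : V → W} {f : X → Y} {A : Arcs V} {B : Arcs W} {C : Arcs X}
    {D : Arcs Y} (h : IsPush e A B) (h' : IsPush f C D) :
    IsPush (Sum.map e f) (A.sum C) (B.sum D) where
  mate := by
    rintro (v | v)
    · simp [Arcs.sum, h.mate]
    · simp [Arcs.sum, h'.mate]
  deco := by
    rintro (v | v)
    · simp [Arcs.sum, h.deco]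
    · simp [Arcs.sum, h'.deco]
  free := by
    rintro (w | w) hw
    · have : w ∉ Set.range e := by
        rintro ⟨v, rfl⟩
        exact hw ⟨Sum.inl v, rfl⟩
      simp [Arcs.sum, h.free w this]
    · have : w ∉ Set.range f := by
        rintro ⟨v, rfl⟩
        exact hw ⟨Sum.inr v, rfl⟩
      simp [Arcs.sum, h'.free w this]
  loops := by simp [Arcs.sum, h.loops, h'.loops]

theorem IsPush.refl (A : Arcs V) : IsPush id A A where
  mate _ := rfl
  deco _ := rfl
  free w hw := absurd ⟨w, rfl⟩ hw
  loops := rfl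

/-- The nodes being placed on a line at the positions `pos`, the arcs can be drawn in the upper half
plane without crossings. -/
def NonCrossing (pos : V → ℕ) (A : Arcs V) : Prop :=
  ∀ u v, ¬ (pos u < pos v ∧ pos v < pos (A.mate u) ∧ pos (A.mate u) < pos (A.mate v))

/-- Every decorated arc is outermost: there is no other arc above it, so that it bounds the unbounded
region. -/
def Exposed (pos : V → ℕ) (A : Arcs V) : Prop :=
  ∀ v, A.deco v ≠ 0 → ∀ u, ¬ (pos u < pos v ∧ pos v < pos (A.mate u))

theorem NonCrossing.inside {pos : V → ℕ} (hpos : Function.Injective pos) {A : Arcs V}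
    (hA : A.NonCrossing pos) {u w : V} (h1 : pos u < pos w) (h2 : pos w < pos (A.mate u)) :
    pos u < pos (A.mate w) ∧ pos (A.mate w) < pos (A.mate u) := by
  have a1 := hA u w
  have a2 := hA (A.mate w) u
  rw [A.mate_mate] at a2
  have a3 : pos (A.mate w) ≠ pos u := fun h => by
    have := hpos h
    rw [← this, A.mate_mate] at h2
    omega
  have a4 : pos (A.mate w) ≠ pos (A.mate u) := fun h => by
    have := hpos h
    have := congrArg A.mate this
    rw [A.mate_mate, A.mate_mate] at this
    rw [this] at h1
    omega
  omega

theorem NonCrossing.separate {pos : V → ℕ} (hpos : Function.Injective pos) {A : Arcs V} {p q : V}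
    (hadj : ∀ w, A.mate w ≠ w → ¬ (pos p < pos w ∧ pos w < pos q))
    (hpq : pos p < pos q)
    (hA : A.NonCrossing pos) (u : V) (hp : u ≠ p) (hq : u ≠ q) (hp' : A.mate u ≠ p)
    (hq' : A.mate u ≠ q) :
    ((pos u < pos (A.mate p) ∧ pos (A.mate p) < pos (A.mate u)) ↔
      (pos u < pos (A.mate q) ∧ pos (A.mate q) < pos (A.mate u))) := by
  have hm := A.mate_mate
  by_cases hu : pos u < pos (A.mate u)
  · have n1 : pos u ≠ pos p := fun h => hp (hpos h)
    have n2 : pos u ≠ pos q := fun h => hq (hpos h)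
    have n3 : pos (A.mate u) ≠ pos p := fun h => hp' (hpos h)
    have n4 : pos (A.mate u) ≠ pos q := fun h => hq' (hpos h)
    have ne : A.mate u ≠ u := fun h => by rw [h] at hu; omega
    have b1 := hadj u ne
    have b2 := hadj (A.mate u) (by rw [hm]; exact ne.symm)
    have c1 := fun h1 h2 => hA.inside hpos (u := u) (w := p) h1 h2
    have c2 := fun h1 h2 => hA.inside hpos (u := u) (w := q) h1 h2
    have c3 := fun h1 h2 => hA.inside hpos (u := u) (w := A.mate p) h1 h2
    have c4 := fun h1 h2 => hA.inside hpos (u := u) (w := A.mate q) h1 h2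
    rw [hm] at c3 c4
    constructor
    · intro h
      have := c3 h.1 h.2
      exact c2 (by omega) (by omega)
    · intro h
      have := c4 h.1 h.2
      exact c1 (by omega) (by omega)
  · constructor <;> intro h <;> omega

variable [DecidableEq V] [DecidableEq W]

/-- Glue the two nodes `p` and `q`, which disappear. If `p` and `q` are the two ends of one arc,
this arc becomes a loop; otherwise the arc at `p` and the arc at `q` become one arc. Decorations are
kept. (If `p = q`, or if no arc ends at `p` or at `q`, nothing is done.) -/
def glue (A : Arcs V) (p q : V) : Arcs V :=
  if h : p ≠ q ∧ A.mate p ≠ p ∧ A.mate q ≠ q then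
    { mate := fun v => if v = p ∨ v = q then v else if v = A.mate p then A.mate q
        else if v = A.mate q then A.mate p else A.mate v
      deco := fun v => if v = p ∨ v = q then 0
        else if v = A.mate p ∨ v = A.mate q then A.deco p + A.deco q else A.deco v
      loops := if A.mate p = q then A.deco p ::ₘ A.loops else A.loops
      mate_mate := by
        have := A.mate_mate
        intro v
        grind
      deco_mate := by
        have := A.mate_mate
        have := A.deco_mate
        intro v
        grind
      deco_free := by
        have := A.mate_mate
        have := A.deco_mate
        have := A.deco_free
        intro v
        grind }
  else A

theorem glue_mate (A : Arcs V) (p q : V) (h : A.Gluable p q) (v : V) :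
    (A.glue p q).mate v = if v = p ∨ v = q then v else if v = A.mate p then A.mate q
        else if v = A.mate q then A.mate p else A.mate v := by
  unfold Gluable at h
  simp only [glue, dif_pos h]

theorem glue_deco (A : Arcs V) (p q : V) (h : A.Gluable p q) (v : V) :
    (A.glue p q).deco v = if v = p ∨ v = q then 0
        else if v = A.mate p ∨ v = A.mate q then A.deco p + A.deco q else A.deco v := by
  unfold Gluable at h
  simp only [glue, dif_pos h]

theorem glue_loops (A : Arcs V) (p q : V) (h : A.Gluable p q) :
    (A.glue p q).loops = if A.mate p = q then A.deco p ::ₘ A.loops else A.loops := by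
  unfold Gluable at h
  simp only [glue, dif_pos h]

theorem glue_of_not (A : Arcs V) (p q : V) (h : ¬ A.Gluable p q) : A.glue p q = A := by
  unfold Gluable at h
  simp only [glue, dif_neg h]

theorem glue_free (A : Arcs V) (p q v : V) (h : A.Gluable p q) :
    (A.glue p q).mate v = v ↔ (v = p ∨ v = q ∨ A.mate v = v) := by
  rw [glue_mate A p q h]
  have := A.mate_mate
  unfold Gluable at h
  grind

theorem glue_free' (A : Arcs V) (p q v : V) (hp : v ≠ p) (hq : v ≠ q) :
    (A.glue p q).mate v = v ↔ A.mate v = v := by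
  by_cases h : A.Gluable p q
  · rw [glue_free A p q v h]; tauto
  · rw [glue_of_not A p q h]

theorem glue_ok (A : Arcs V) (p q r s : V) (h1 : p ≠ r) (h2 : p ≠ s) (h3 : q ≠ r) (h4 : q ≠ s) :
    (A.glue p q).Gluable r s ↔ A.Gluable r s := by
  simp only [Gluable, ne_eq, glue_free' A p q r h1.symm h3.symm, glue_free' A p q s h2.symm h4.symm]

theorem glue_comm (A : Arcs V) (p q r s : V) (h1 : p ≠ r) (h2 : p ≠ s) (h3 : q ≠ r) (h4 : q ≠ s) :
    (A.glue p q).glue r s = (A.glue r s).glue p q := by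
  have e1 := glue_ok A p q r s h1 h2 h3 h4
  have e2 := glue_ok A r s p q h1.symm h3.symm h2.symm h4.symm
  by_cases h : A.Gluable p q
  · by_cases h' : A.Gluable r s
    · have H := e2.2 h
      have H' := e1.2 h'
      have hm := A.mate_mate
      have hd := A.deco_mate
      have a1 := glue_mate A p q h
      have a2 := glue_mate A r s h'
      have b1 := glue_deco A p q h
      have b2 := glue_deco A r s h'
      have c1 := glue_loops A p q h
      have c2 := glue_loops A r s h'
      unfold Gluable at h h'
      apply Arcs.ext
      · funext v
        rw [glue_mate _ r s H', glue_mate _ p q H, a1 r, a1 s, a1 v, a2 p, a2 q, a2 v]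
        have := hm p
        have := hm q
        have := hm r
        have := hm s
        have := hm v
        clear a1 a2 b1 b2 c1 c2 hd e1 e2 H H' hm
        grind (splits := 30)
      · funext v
        rw [glue_deco _ r s H', glue_deco _ p q H, a1 r, a1 s, a2 p, a2 q, b1 r, b1 s, b1 v,
          b2 p, b2 q, b2 v]
        have := hm p
        have := hm q
        have := hm r
        have := hm s
        have := hm v
        have := hd p
        have := hd q
        have := hd r
        have := hd s
        have := hd v
        clear a1 a2 b1 b2 c1 c2 hd e1 e2 H H' hm
        grind (splits := 30)
      · rw [glue_loops _ r s H', glue_loops _ p q H]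
        have := Multiset.cons_swap (A.deco p) (A.deco r) A.loops
        by_cases i1 : A.mate p = q <;> by_cases i2 : A.mate r = s <;>
          by_cases i3 : (A.glue p q).mate r = s <;> by_cases i4 : (A.glue r s).mate p = q <;>
          simp only [i1, i2, i3, i4, if_true, if_false, c1, c2] <;> grind
    · rw [glue_of_not A r s h', glue_of_not _ r s (by rwa [e1])]
  · rw [glue_of_not A p q h, glue_of_not _ p q (by rwa [e2])]

theorem glue_keep (A : Arcs V) (p q v : V) (h1 : v ≠ p) (h2 : v ≠ q) (h3 : A.mate v ≠ p)
    (h4 : A.mate v ≠ q) : (A.glue p q).mate v = A.mate v := by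
  by_cases h : A.Gluable p q
  · rw [glue_mate A p q h]
    have := A.mate_mate v
    have := A.mate_mate p
    have := A.mate_mate q
    grind
  · rw [glue_of_not A p q h]

theorem glue_undecorated (A : Arcs V) (p q : V) (hA : A.Undecorated) :
    (A.glue p q).Undecorated := by
  by_cases h : A.Gluable p q
  · obtain ⟨h1, h2⟩ := hA
    refine ⟨fun v => ?_, fun m hm => ?_⟩
    · rw [glue_deco A p q h]; simp [h1]
    · rw [glue_loops A p q h] at hm
      split_ifs at hm
      · rcases Multiset.mem_cons.1 hm with rfl | hm
        · exact h1 p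
        · exact h2 m hm
      · exact h2 m hm
  · rwa [glue_of_not A p q h]

/-- Glue all the pairs of a list. -/
def glueList (A : Arcs V) (l : List (V × V)) : Arcs V :=
  l.foldl (fun B e => B.glue e.1 e.2) A

@[simp] theorem glueList_nil (A : Arcs V) : A.glueList [] = A := rfl

@[simp] theorem glueList_cons (A : Arcs V) (e : V × V) (l : List (V × V)) :
    A.glueList (e :: l) = (A.glue e.1 e.2).glueList l := rfl

theorem glueList_glue (A : Arcs V) (p q : V) (l : List (V × V))
    (h : ∀ e ∈ l, p ≠ e.1 ∧ p ≠ e.2 ∧ q ≠ e.1 ∧ q ≠ e.2) :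
    (A.glue p q).glueList l = (A.glueList l).glue p q := by
  induction l generalizing A with
  | nil => rfl
  | cons e l ih =>
    have h' := h e (by simp)
    rw [glueList_cons, glueList_cons, glue_comm A p q e.1 e.2 h'.1 h'.2.1 h'.2.2.1 h'.2.2.2]
    exact ih _ (fun e' he' => h e' (by simp [he']))

theorem glueList_comm (A : Arcs V) (l m : List (V × V))
    (h : ∀ e ∈ l, ∀ f ∈ m, e.1 ≠ f.1 ∧ e.1 ≠ f.2 ∧ e.2 ≠ f.1 ∧ e.2 ≠ f.2) :
    (A.glueList l).glueList m = (A.glueList m).glueList l := by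
  induction l generalizing A with
  | nil => rfl
  | cons e l ih =>
    rw [glueList_cons, glueList_cons, ih _ (fun e' he' => h e' (by simp [he'])),
      glueList_glue A e.1 e.2 m (h e (by simp))]

theorem glueList_undecorated (A : Arcs V) (l : List (V × V)) (hA : A.Undecorated) :
    (A.glueList l).Undecorated := by
  induction l generalizing A with
  | nil => exact hA
  | cons e l ih => exact ih _ (glue_undecorated A _ _ hA)

theorem glueList_keep (A : Arcs V) (l : List (V × V)) (v : V)
    (h : ∀ e ∈ l, v ≠ e.1 ∧ v ≠ e.2 ∧ A.mate v ≠ e.1 ∧ A.mate v ≠ e.2) :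
    (A.glueList l).mate v = A.mate v := by
  induction l generalizing A with
  | nil => rfl
  | cons e l ih =>
    have h' := h e (by simp)
    have k := glue_keep A e.1 e.2 v h'.1 h'.2.1 h'.2.2.1 h'.2.2.2
    rw [glueList_cons, ih, k]
    intro e' he'
    rw [k]
    exact h e' (by simp [he'])

theorem IsPush.glue {e : V → W} (he : Function.Injective e) {A : Arcs V} {B : Arcs W}
    (h : IsPush e A B) (p q : V) : IsPush e (A.glue p q) (B.glue (e p) (e q)) := by
  have hok : B.Gluable (e p) (e q) ↔ A.Gluable p q := by
    simp [Gluable, h.mate, he.eq_iff]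
  by_cases hA : A.Gluable p q
  · have hB := hok.2 hA
    constructor
    · intro v
      rw [glue_mate B _ _ hB, glue_mate A _ _ hA]
      simp only [h.mate, he.eq_iff]
      split_ifs <;> rfl
    · intro v
      rw [glue_deco B _ _ hB, glue_deco A _ _ hA]
      simp only [h.mate, h.deco, he.eq_iff]
    · intro w hw
      rw [glue_free B _ _ _ hB]
      exact Or.inr (Or.inr (h.free w hw))
    · rw [glue_loops B _ _ hB, glue_loops A _ _ hA]
      simp only [h.mate, h.deco, he.eq_iff, h.loops]
  · rw [glue_of_not A _ _ hA, glue_of_not B _ _ (by rwa [hok])]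
    exact h

theorem IsPush.glueList {e : V → W} (he : Function.Injective e) {A : Arcs V} {B : Arcs W}
    (h : IsPush e A B) (l : List (V × V)) :
    IsPush e (A.glueList l) (B.glueList (l.map (Prod.map e e))) := by
  induction l generalizing A B with
  | nil => exact h
  | cons x l ih => exact ih (h.glue he x.1 x.2)

theorem glue_sum (A : Arcs V) (C : Arcs W) (p q : V) :
    (A.glue p q).sum C = (A.sum C).glue (Sum.inl p) (Sum.inl q) := by
  have hok : (A.sum C).Gluable (Sum.inl p) (Sum.inl q) ↔ A.Gluable p q := by
    simp [Gluable, Arcs.sum]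
  by_cases hA : A.Gluable p q
  · have hB := hok.2 hA
    apply Arcs.ext
    · funext v
      rw [glue_mate _ _ _ hB]
      rcases v with v | v
      · simp only [Arcs.sum, Sum.map_inl, glue_mate A _ _ hA, Sum.inl.injEq]
        split_ifs <;> rfl
      · simp [Arcs.sum]
    · funext v
      rw [glue_deco _ _ _ hB]
      rcases v with v | v
      · simp [Arcs.sum, glue_deco A _ _ hA]
      · simp [Arcs.sum]
    · rw [glue_loops _ _ _ hB]
      simp only [Arcs.sum, Sum.map_inl, glue_loops A _ _ hA, Sum.inl.injEq]
      split_ifs <;> simp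
  · rw [glue_of_not A _ _ hA, glue_of_not _ _ _ (by rwa [hok])]

theorem sum_glue (C : Arcs W) (A : Arcs V) (p q : V) :
    C.sum (A.glue p q) = (C.sum A).glue (Sum.inr p) (Sum.inr q) := by
  have hok : (C.sum A).Gluable (Sum.inr p) (Sum.inr q) ↔ A.Gluable p q := by
    simp [Gluable, Arcs.sum]
  by_cases hA : A.Gluable p q
  · have hB := hok.2 hA
    apply Arcs.ext
    · funext v
      rw [glue_mate _ _ _ hB]
      rcases v with v | v
      · simp [Arcs.sum]
      · simp only [Arcs.sum, Sum.map_inr, glue_mate A _ _ hA, Sum.inr.injEq]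
        split_ifs <;> rfl
    · funext v
      rw [glue_deco _ _ _ hB]
      rcases v with v | v
      · simp [Arcs.sum]
      · simp [Arcs.sum, glue_deco A _ _ hA]
    · rw [glue_loops _ _ _ hB]
      simp only [Arcs.sum, Sum.map_inr, glue_loops A _ _ hA, Sum.inr.injEq]
      split_ifs <;> simp
  · rw [glue_of_not A _ _ hA, glue_of_not _ _ _ (by rwa [hok])]

theorem glueList_sum (A : Arcs V) (C : Arcs W) (l : List (V × V)) :
    (A.glueList l).sum C = (A.sum C).glueList (l.map (Prod.map Sum.inl Sum.inl)) := by
  induction l generalizing A with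
  | nil => rfl
  | cons x l ih => rw [glueList_cons, ih, glue_sum]; rfl

theorem sum_glueList (C : Arcs W) (A : Arcs V) (l : List (V × V)) :
    C.sum (A.glueList l) = (C.sum A).glueList (l.map (Prod.map Sum.inr Sum.inr)) := by
  induction l generalizing A with
  | nil => rfl
  | cons x l ih => rw [glueList_cons, ih, sum_glue]; rfl

theorem glue_nonCrossing {pos : V → ℕ} (hpos : Function.Injective pos) {A : Arcs V} {p q : V}
    (hadj : ∀ w, A.mate w ≠ w → ¬ (pos p < pos w ∧ pos w < pos q))
    (hpq : pos p < pos q)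
    (hA : A.NonCrossing pos) : (A.glue p q).NonCrossing pos := by
  by_cases h : A.Gluable p q
  · have hm := A.mate_mate
    have key := hA.separate hpos hadj hpq
    have g := glue_mate A p q h
    have other : ∀ u, u ≠ p → u ≠ q → u ≠ A.mate p → u ≠ A.mate q →
        (A.glue p q).mate u = A.mate u ∧ A.mate u ≠ p ∧ A.mate u ≠ q := by
      intro u h1 h2 h3 h4
      have := hm u
      grind
    intro u v hc
    by_cases u1 : u = p ∨ u = q
    · rw [g u, if_pos u1] at hc
      omega
    by_cases v1 : v = p ∨ v = q
    · rw [g v, if_pos v1] at hc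
      omega
    push Not at u1 v1
    by_cases u2 : u = A.mate p ∨ u = A.mate q
    · by_cases v2 : v = A.mate p ∨ v = A.mate q
      · have gu := g u
        have gv := g v
        have := hm p
        have := hm q
        grind
      · push Not at v2
        obtain ⟨o1, o2, o3⟩ := other v v1.1 v1.2 v2.1 v2.2
        have := key v v1.1 v1.2 o2 o3
        have gu := g u
        grind
    · push Not at u2
      obtain ⟨o1, o2, o3⟩ := other u u1.1 u1.2 u2.1 u2.2
      by_cases v2 : v = A.mate p ∨ v = A.mate q
      · have := key u u1.1 u1.2 o2 o3
        have gv := g v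
        grind
      · push Not at v2
        obtain ⟨p1, -, -⟩ := other v v1.1 v1.2 v2.1 v2.2
        rw [o1, p1] at hc
        exact hA u v hc
  · rwa [glue_of_not A p q h]

theorem glue_exposed {pos : V → ℕ} (hpos : Function.Injective pos) {A : Arcs V} {p q : V}
    (hadj : ∀ w, A.mate w ≠ w → ¬ (pos p < pos w ∧ pos w < pos q))
    (hpq : pos p < pos q)
    (hA : A.NonCrossing pos) (hE : A.Exposed pos) : (A.glue p q).Exposed pos := by
  by_cases h : A.Gluable p q
  · have hm := A.mate_mate
    have hd := A.deco_mate
    have key := hA.separate hpos hadj hpq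
    have g := glue_mate A p q h
    have other : ∀ u, u ≠ p → u ≠ q → u ≠ A.mate p → u ≠ A.mate q →
        (A.glue p q).mate u = A.mate u ∧ A.mate u ≠ p ∧ A.mate u ≠ q := by
      intro u h1 h2 h3 h4
      have := hm u
      grind
    intro v hv u hc
    rw [glue_deco A p q h] at hv
    by_cases v1 : v = p ∨ v = q
    · simp [v1] at hv
    rw [if_neg v1] at hv
    push Not at v1
    by_cases u1 : u = p ∨ u = q
    · rw [g u, if_pos u1] at hc
      omega
    push Not at u1
    by_cases v2 : v = A.mate p ∨ v = A.mate q
    · rw [if_pos v2] at hv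
      by_cases u2 : u = A.mate p ∨ u = A.mate q
      · have gu := g u
        have := hm p
        have := hm q
        grind
      · push Not at u2
        obtain ⟨o1, o2, o3⟩ := other u u1.1 u1.2 u2.1 u2.2
        rw [o1] at hc
        have k := key u u1.1 u1.2 o2 o3
        have e1 := hE (A.mate p)
        have e2 := hE (A.mate q)
        rw [hd] at e1 e2
        have k1 : pos u < pos (A.mate p) ∧ pos (A.mate p) < pos (A.mate u) := by
          rcases v2 with rfl | rfl
          · exact hc
          · exact k.2 hc
        by_cases z : A.deco p = 0
        · exact e2 (by omega) u (k.1 k1)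
        · exact e1 z u k1
    · rw [if_neg v2] at hv
      have E := hE v hv
      push Not at v2
      by_cases u2 : u = A.mate p ∨ u = A.mate q
      · have e1 := E p
        have e2 := E q
        have e3 := E (A.mate p)
        have e4 := E (A.mate q)
        rw [hm] at e3 e4
        have n1 : pos v ≠ pos p := fun h => v1.1 (hpos h)
        have n2 : pos v ≠ pos q := fun h => v1.2 (hpos h)
        have b : A.mate v ≠ v := fun z => hv (A.deco_free v z)
        have b1 := hadj v b
        have gu := g u
        have n3 : pos v ≠ pos (A.mate p) := fun h => v2.1 (hpos h)
        have n4 : pos v ≠ pos (A.mate q) := fun h => v2.2 (hpos h)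
        have := hm p
        have := hm q
        grind
      · push Not at u2
        obtain ⟨o1, -, -⟩ := other u u1.1 u1.2 u2.1 u2.2
        rw [o1] at hc
        exact E u hc
  · rwa [glue_of_not A p q h]
end Arcs

theorem Arcs.glue_symm {V : Type*} [DecidableEq V] (A : Arcs V) (p q : V) :
    A.glue p q = A.glue q p := by
  have hok : A.Gluable q p ↔ A.Gluable p q := by unfold Arcs.Gluable; tauto
  have hm := A.mate_mate
  have hd := A.deco_mate
  by_cases h : A.Gluable p q
  · have h' := hok.2 h
    apply Arcs.ext
    · funext v
      rw [Arcs.glue_mate A p q h, Arcs.glue_mate A q p h']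
      have := hm p
      have := hm q
      grind
    · funext v
      rw [Arcs.glue_deco A p q h, Arcs.glue_deco A q p h']
      grind
    · rw [Arcs.glue_loops A p q h, Arcs.glue_loops A q p h']
      have := hm p
      have := hm q
      have := hd p
      grind
  · rw [Arcs.glue_of_not A p q h, Arcs.glue_of_not A q p (by rwa [hok])]

/-- Gluing an undecorated strand from `p` to `r` onto the node `ρ c` just renames that node. -/
theorem Arcs.glue_strand {U V : Type*} [DecidableEq U] [DecidableEq V] (d : Arcs U) (A : Arcs V)
    (ρ : U → V) (c : U) (p r : V) (hc : d.mate c ≠ c) (hρ : Function.Injective ρ) (hpr : r ≠ p)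
    (h1 : ∀ u, ρ u ≠ p) (h2 : ∀ u, ρ u ≠ r) (hp : A.mate p = r) (hdp : A.deco p = 0)
    (hm : ∀ u, A.mate (ρ u) = ρ (d.mate u)) (hd : ∀ u, A.deco (ρ u) = d.deco u) :
    (∀ u, (A.glue p (ρ c)).mate (Function.update ρ c r u) = Function.update ρ c r (d.mate u)) ∧
    (∀ u, (A.glue p (ρ c)).deco (Function.update ρ c r u) = d.deco u) ∧
    (A.glue p (ρ c)).loops = A.loops := by
  have hok : A.Gluable p (ρ c) := by
    refine ⟨(h1 c).symm, by rw [hp]; exact hpr, ?_⟩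
    rw [hm]
    exact fun h => hc (hρ h)
  have i : ∀ a b, ρ a = ρ b ↔ a = b := fun a b => hρ.eq_iff
  have dm := d.mate_mate
  have dd := d.deco_mate
  refine ⟨fun u => ?_, fun u => ?_, ?_⟩
  · rw [Arcs.glue_mate A p _ hok, hp, hm]
    by_cases hu : u = c
    · subst hu
      simp [hpr, (h2 u).symm, hc]
    · rw [Function.update_of_ne hu]
      by_cases hu' : u = d.mate c
      · subst hu'
        simp [h1, h2, i, hc, dm]
      · have : d.mate u ≠ c := fun h => hu' (by rw [← h, dm])
        simp [h1, h2, i, hu, hu', this, hm]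
  · rw [Arcs.glue_deco A p _ hok, hp, hm, hdp, hd]
    by_cases hu : u = c
    · subst hu
      simp [hpr, (h2 u).symm]
    · rw [Function.update_of_ne hu]
      by_cases hu' : u = d.mate c
      · subst hu'
        simp [h1, i, hc, dd]
      · simp [h1, h2, i, hu, hu', hd]
  · rw [Arcs.glue_loops A p _ hok, hp, if_neg (h2 c).symm]

/-- The nodes of the standard `k`-box: `Sum.inl i` is the node `i + 1` of the north face, `Sum.inr i`
the node `(i + 1)'` of the south face. -/
abbrev Node (k : ℕ) : Type := Fin k ⊕ Fin k

/-- The order of the nodes along the boundary of the box, starting at the top of the left wall and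
running clockwise: `1, ..., k, k', ..., 1'`. The left wall lies between the last node and the first,
so in a drawing in the half plane the region at the left wall is the unbounded one. -/
def pos {k : ℕ} : Node k → ℕ :=
  Sum.elim (fun i => (i : ℕ)) (fun i => 2 * k - 1 - (i : ℕ))

@[simp] theorem pos_inl {k : ℕ} (i : Fin k) : pos (Sum.inl i : Node k) = i := rfl

@[simp] theorem pos_inr {k : ℕ} (i : Fin k) : pos (Sum.inr i : Node k) = 2 * k - 1 - i := rfl

theorem pos_injective {k : ℕ} : Function.Injective (pos : Node k → ℕ) := by
  rintro (i | i) (j | j) h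
  · simp at h; rw [Fin.ext h]
  · simp at h; omega
  · simp at h; omega
  · simp at h; rw [Fin.ext (by omega : (i : ℕ) = j)]

/-- An L-decorated pseudo `k`-diagram up to isotopy: every node is the end of exactly one edge, the
edges do not cross, decorated edges are exposed to the left wall, and a diagram without non-propagating
edges in the north face is undecorated. Loops are recorded only by their numbers of decorations;
decorated loops necessarily lie in the region at the left wall, and where the undecorated ones lie is
irrelevant as soon as each of them is replaced by `δ`. -/
structure LDiagram (k : ℕ) extends Arcs (Node k) where
  no_free : ∀ v, mate v ≠ v
  planar : toArcs.NonCrossing pos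
  exposed : toArcs.Exposed pos
  undecorated : (∀ i j, mate (Sum.inl i) ≠ Sum.inl j) → toArcs.Undecorated

namespace LDiagram

variable {k : ℕ}

theorem ext_arcs {d e : LDiagram k} (h : d.toArcs = e.toArcs) : d = e := by
  cases d; cases e; cases h; rfl

/-- When one diagram is put on top of another, the node `i'` of the upper diagram (the first
component) is glued to the node `i` of the lower one (the second component). -/
def seam (k : ℕ) (i : Fin k) : (Node k ⊕ Node k) × (Node k ⊕ Node k) :=
  (Sum.inl (Sum.inr i), Sum.inr (Sum.inl i))

/-- Put `A` on top of `B` and glue. -/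
def stack (A B : Arcs (Node k)) : Arcs (Node k ⊕ Node k) :=
  (A.sum B).glueList ((List.finRange k).map (seam k))

/-- The nodes of the stacked box: north face of the upper box, south face of the lower box. -/
def outer : Node k → Node k ⊕ Node k := Sum.map Sum.inl Sum.inr

theorem outer_injective : Function.Injective (outer (k := k)) :=
  Sum.map_injective.2 ⟨Sum.inl_injective, Sum.inr_injective⟩

/-- The positions of the nodes of two boxes, the second box to the right of the first. -/
def pos2 : Node k ⊕ Node k → ℕ := Sum.elim pos (fun v => 2 * k + pos v)

theorem pos_lt (v : Node k) : pos v < 2 * k := by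
  rcases v with i | i
  · simp; omega
  · simp; omega

theorem pos2_injective : Function.Injective (pos2 (k := k)) := by
  rintro (v | v) (w | w) h
  · rw [pos_injective h]
  · have := pos_lt v
    simp [pos2] at h; omega
  · have := pos_lt w
    simp [pos2] at h; omega
  · simp [pos2] at h; rw [pos_injective h]

theorem pos2_outer (v w : Node k) : pos2 (outer v) < pos2 (outer w) ↔ pos v < pos w := by
  rcases v with i | i <;> rcases w with j | j <;> simp [pos2, outer] <;> omega

theorem glueList_seams (l : List (Fin k)) (hl : l.Pairwise (· < ·)) (A : Arcs (Node k ⊕ Node k))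
    (h1 : ∀ j, A.mate (seam k j).1 = (seam k j).1 ↔ j ∉ l)
    (h2 : ∀ j, A.mate (seam k j).2 = (seam k j).2 ↔ j ∉ l)
    (hA : A.NonCrossing pos2) (hE : A.Exposed pos2) :
    (A.glueList (l.map (seam k))).NonCrossing pos2 ∧ (A.glueList (l.map (seam k))).Exposed pos2 ∧
    ∀ j, (A.glueList (l.map (seam k))).mate (seam k j).1 = (seam k j).1 ∧
      (A.glueList (l.map (seam k))).mate (seam k j).2 = (seam k j).2 := by
  induction l generalizing A with
  | nil => exact ⟨hA, hE, fun j => ⟨(h1 j).2 (by simp), (h2 j).2 (by simp)⟩⟩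
  | cons i l ih =>
    rw [List.pairwise_cons] at hl
    have hi : i ∉ l := fun h => lt_irrefl _ (hl.1 i h)
    have hok : A.Gluable (seam k i).1 (seam k i).2 := by
      refine ⟨by simp [seam], ?_, ?_⟩
      · rw [Ne, h1]; simp
      · rw [Ne, h2]; simp
    have hlt : pos2 (seam k i).1 < pos2 (seam k i).2 := by
      simp [pos2, seam]; omega
    have hadj : ∀ w, A.mate w ≠ w → ¬ (pos2 (seam k i).1 < pos2 w ∧ pos2 w < pos2 (seam k i).2) := by
      rintro ((j | j) | (j | j)) hw hc
      · simp [pos2, seam] at hc; omega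
      · have : j ∈ i :: l := by
          by_contra h
          exact hw ((h1 j).2 h)
        rcases List.mem_cons.1 this with rfl | h
        · simp [pos2, seam] at hc
        · have := hl.1 j h
          simp [pos2, seam] at hc
          omega
      · have : j ∈ i :: l := by
          by_contra h
          exact hw ((h2 j).2 h)
        rcases List.mem_cons.1 this with rfl | h
        · simp [pos2, seam] at hc
        · have := hl.1 j h
          simp [pos2, seam] at hc
          omega
      · simp [pos2, seam] at hc; omega
    refine ih hl.2 (A.glue (seam k i).1 (seam k i).2) ?_ ?_
      (Arcs.glue_nonCrossing pos2_injective hadj hlt hA)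
      (Arcs.glue_exposed pos2_injective hadj hlt hA hE)
    · intro j
      rw [Arcs.glue_free _ _ _ _ hok, h1]
      by_cases hj : j = i
      · subst hj; simp [hi]
      · simp [seam, hj]
    · intro j
      rw [Arcs.glue_free _ _ _ _ hok, h2]
      by_cases hj : j = i
      · subst hj; simp [hi]
      · simp [seam, hj]

theorem sum_nonCrossing (d e : LDiagram k) : (d.toArcs.sum e.toArcs).NonCrossing pos2 := by
  rintro (u | u) (v | v) h
  · exact d.planar u v h
  · have := pos_lt (d.mate u)
    simp [Arcs.sum, pos2] at h; omega
  · have := pos_lt v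
    simp [Arcs.sum, pos2] at h; omega
  · simp [Arcs.sum, pos2] at h
    exact e.planar u v h

theorem sum_exposed (d e : LDiagram k) : (d.toArcs.sum e.toArcs).Exposed pos2 := by
  rintro (v | v) hv (u | u) h
  · exact d.exposed v hv u h
  · have := pos_lt v
    simp [Arcs.sum, pos2] at h; omega
  · have := pos_lt (d.mate u)
    simp [Arcs.sum, pos2] at h; omega
  · simp [Arcs.sum, pos2] at h
    exact e.exposed v hv u h

theorem stack_spec (d e : LDiagram k) :
    (stack d.toArcs e.toArcs).NonCrossing pos2 ∧ (stack d.toArcs e.toArcs).Exposed pos2 ∧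
    ∀ j, (stack d.toArcs e.toArcs).mate (seam k j).1 = (seam k j).1 ∧
      (stack d.toArcs e.toArcs).mate (seam k j).2 = (seam k j).2 := by
  refine glueList_seams (List.finRange k) (List.pairwise_lt_finRange k) (d.toArcs.sum e.toArcs)
    ?_ ?_ (sum_nonCrossing d e) (sum_exposed d e)
  · intro j
    simp [seam, Arcs.sum, d.no_free]
  · intro j
    simp [seam, Arcs.sum, e.no_free]

theorem stack_outer (d e : LDiagram k) (v : Node k) :
    outer (Sum.elim id id ((stack d.toArcs e.toArcs).mate (outer v))) =
      (stack d.toArcs e.toArcs).mate (outer v) := by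
  have h := (stack_spec d e).2.2
  have hm := (stack d.toArcs e.toArcs).mate_mate (outer v)
  rcases hw : (stack d.toArcs e.toArcs).mate (outer v) with (i | i) | (i | i)
  · rfl
  · exfalso
    rw [hw] at hm
    have := (h i).1
    rw [seam, hm] at this
    rcases v with v | v <;> simp [outer] at this
  · exfalso
    rw [hw] at hm
    have := (h i).2
    rw [seam, hm] at this
    rcases v with v | v <;> simp [outer] at this
  · rfl

theorem glueList_free' {V : Type*} [DecidableEq V] (A : Arcs V) (l : List (V × V)) (v : V)
    (h : ∀ e ∈ l, v ≠ e.1 ∧ v ≠ e.2) : (A.glueList l).mate v = v ↔ A.mate v = v := by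
  induction l generalizing A with
  | nil => rfl
  | cons e l ih =>
    have h' := h e (by simp)
    rw [Arcs.glueList_cons, ih _ (fun e' he' => h e' (by simp [he'])),
      Arcs.glue_free' A _ _ _ h'.1 h'.2]

theorem stack_no_free (d e : LDiagram k) (v : Node k) :
    (stack d.toArcs e.toArcs).mate (outer v) ≠ outer v := by
  rw [Ne, stack, glueList_free']
  · rcases v with v | v
    · simp [outer, Arcs.sum, d.no_free]
    · simp [outer, Arcs.sum, e.no_free]
  · rintro x hx
    obtain ⟨i, -, rfl⟩ := List.mem_map.1 hx
    rcases v with v | v <;> simp [outer, seam]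

/-- Concatenation: `d` on top of `e`. -/
def mulArcs (d e : LDiagram k) : Arcs (Node k) where
  mate v := Sum.elim id id ((stack d.toArcs e.toArcs).mate (outer v))
  deco v := (stack d.toArcs e.toArcs).deco (outer v)
  loops := (stack d.toArcs e.toArcs).loops
  mate_mate v := by
    rw [stack_outer, Arcs.mate_mate]
    rcases v with v | v <;> rfl
  deco_mate v := by rw [stack_outer, Arcs.deco_mate]
  deco_free v hv := by
    refine absurd ?_ (stack_no_free d e v)
    rw [← stack_outer, hv]

theorem mulArcs_isPush (d e : LDiagram k) :
    Arcs.IsPush outer (mulArcs d e) (stack d.toArcs e.toArcs) where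
  mate v := (stack_outer d e v).symm
  deco _ := rfl
  free := by
    have h := (stack_spec d e).2.2
    rintro ((i | i) | (i | i)) hw
    · exact absurd ⟨Sum.inl i, rfl⟩ hw
    · exact (h i).1
    · exact (h i).2
    · exact absurd ⟨Sum.inr i, rfl⟩ hw
  loops := rfl

theorem no_south_of_no_north {A : Arcs (Node k)} (hA : ∀ i j, A.mate (Sum.inl i) ≠ Sum.inl j)
    (i j : Fin k) : A.mate (Sum.inr i) ≠ Sum.inr j := by
  have h : ∀ i, ∃ j, A.mate (Sum.inl i) = Sum.inr j := by
    intro i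
    rcases h : A.mate (Sum.inl i) with j | j
    · exact absurd h (hA i j)
    · exact ⟨j, rfl⟩
  choose f hf using h
  have finj : Function.Injective f := by
    intro a b hab
    have : A.mate (Sum.inl a) = A.mate (Sum.inl b) := by rw [hf, hf, hab]
    have := congrArg A.mate this
    rw [A.mate_mate, A.mate_mate] at this
    exact Sum.inl_injective this
  obtain ⟨a, rfl⟩ := (Finite.injective_iff_surjective.1 finj) i
  rw [← hf, A.mate_mate]
  simp

theorem no_north_of_no_south {A : Arcs (Node k)} (hA : ∀ i j, A.mate (Sum.inr i) ≠ Sum.inr j)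
    (i j : Fin k) : A.mate (Sum.inl i) ≠ Sum.inl j := by
  have h : ∀ i, ∃ j, A.mate (Sum.inr i) = Sum.inl j := by
    intro i
    rcases h : A.mate (Sum.inr i) with j | j
    · exact ⟨j, rfl⟩
    · exact absurd h (hA i j)
  choose f hf using h
  have finj : Function.Injective f := by
    intro a b hab
    have : A.mate (Sum.inr a) = A.mate (Sum.inr b) := by rw [hf, hf, hab]
    have := congrArg A.mate this
    rw [A.mate_mate, A.mate_mate] at this
    exact Sum.inr_injective this
  obtain ⟨a, rfl⟩ := (Finite.injective_iff_surjective.1 finj) i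
  rw [← hf, A.mate_mate]
  simp

theorem mulArcs_undecorated (d e : LDiagram k)
    (h : ∀ i j, (mulArcs d e).mate (Sum.inl i) ≠ Sum.inl j) : (mulArcs d e).Undecorated := by
  have hs := no_south_of_no_north h
  have hd : d.toArcs.Undecorated := by
    refine d.undecorated fun i j hij => h i j ?_
    apply outer_injective
    rw [← (mulArcs_isPush d e).mate, stack, Arcs.glueList_keep]
    · simp [Arcs.sum, outer, hij]
    · rintro x hx
      obtain ⟨i, -, rfl⟩ := List.mem_map.1 hx
      simp [outer, seam, Arcs.sum, hij]
  have he : e.toArcs.Undecorated := by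
    refine e.undecorated (no_north_of_no_south fun i j hij => hs i j ?_)
    apply outer_injective
    rw [← (mulArcs_isPush d e).mate, stack, Arcs.glueList_keep]
    · simp [Arcs.sum, outer, hij]
    · rintro x hx
      obtain ⟨i, -, rfl⟩ := List.mem_map.1 hx
      simp [outer, seam, Arcs.sum, hij]
  have hsum : (d.toArcs.sum e.toArcs).Undecorated := by
    refine ⟨?_, ?_⟩
    · rintro (v | v)
      · exact hd.1 v
      · exact he.1 v
    · intro m hm
      rcases Multiset.mem_add.1 hm with hm | hm
      · exact hd.2 m hm
      · exact he.2 m hm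
  have := Arcs.glueList_undecorated _ ((List.finRange k).map (seam k)) hsum
  exact ⟨fun v => this.1 (outer v), this.2⟩

instance : Mul (LDiagram k) where
  mul d e :=
    { toArcs := mulArcs d e
      no_free := fun v hv => stack_no_free d e v (by rw [(mulArcs_isPush d e).mate, hv])
      planar := fun u v h => (stack_spec d e).1 (outer u) (outer v) (by
        simpa only [(mulArcs_isPush d e).mate, pos2_outer] using h)
      exposed := fun v hv u h => (stack_spec d e).2.1 (outer v) hv (outer u) (by
        simpa only [(mulArcs_isPush d e).mate, pos2_outer] using h)
      undecorated := mulArcs_undecorated d e }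

theorem mul_isPush (d e : LDiagram k) :
    Arcs.IsPush outer (d * e).toArcs (stack d.toArcs e.toArcs) := mulArcs_isPush d e

instance : One (LDiagram k) where
  one :=
    { mate := Sum.swap
      deco := fun _ => 0
      loops := 0
      mate_mate := Sum.swap_swap
      deco_mate := fun _ => rfl
      deco_free := fun _ _ => rfl
      no_free := by rintro (v | v) <;> simp
      planar := by
        rintro (u | u) (v | v) h <;> simp at h <;> omega
      exposed := fun _ h => absurd rfl h
      undecorated := fun _ => ⟨fun _ => rfl, by simp⟩ }

theorem assoc_aux (d e f : LDiagram k) : d * e * f = d * (e * f) := by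
  apply ext_arcs
  let L1 := (List.finRange k).map (seam k)
  have a1 := mul_isPush (d * e) f
  have a2 := ((mul_isPush d e).sum (Arcs.IsPush.refl f.toArcs)).glueList
    (Sum.map_injective.2 ⟨outer_injective, Function.injective_id⟩) L1
  have a3 := a1.trans a2
  rw [stack, Arcs.glueList_sum] at a3
  have b1 := mul_isPush d (e * f)
  have b2 := ((Arcs.IsPush.refl d.toArcs).sum (mul_isPush e f)).glueList
    (Sum.map_injective.2 ⟨Function.injective_id, outer_injective⟩) L1
  have b3 := b1.trans b2
  rw [stack, Arcs.sum_glueList] at b3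
  have c : Arcs.IsPush (Equiv.sumAssoc (Node k) (Node k) (Node k))
      ((d.toArcs.sum e.toArcs).sum f.toArcs) (d.toArcs.sum (e.toArcs.sum f.toArcs)) := by
    refine ⟨?_, ?_, ?_, ?_⟩
    · rintro ((v | v) | v) <;> simp [Arcs.sum]
    · rintro ((v | v) | v) <;> simp [Arcs.sum]
    · intro w hw
      exact absurd ((Equiv.sumAssoc (Node k) (Node k) (Node k)).surjective w) hw
    · simp [Arcs.sum, add_assoc]
  have c1 := (c.glueList (Equiv.injective _) (L1.map (Prod.map Sum.inl Sum.inl))).glueList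
    (Equiv.injective _) (L1.map (Prod.map (Sum.map outer id) (Sum.map outer id)))
  have a4 := a3.trans c1
  rw [Arcs.glueList_comm] at b3
  · have e1 : (L1.map (Prod.map (Sum.inr : _ → Node k ⊕ (Node k ⊕ Node k)) Sum.inr)) =
        (L1.map (Prod.map (Sum.map outer id) (Sum.map outer id))).map
          (Prod.map (Equiv.sumAssoc (Node k) (Node k) (Node k))
            (Equiv.sumAssoc (Node k) (Node k) (Node k))) := by
      simp [L1, seam, outer]
    have e2 : (L1.map (Prod.map (Sum.map id outer) (Sum.map id outer))) =
        (L1.map (Prod.map Sum.inl Sum.inl)).map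
          (Prod.map (Equiv.sumAssoc (Node k) (Node k) (Node k))
            (Equiv.sumAssoc (Node k) (Node k) (Node k))) := by
      simp [L1, seam, outer]
    rw [show (List.map (seam k) (List.finRange k)) = L1 from rfl, e1, e2] at b3
    have e3 : (Equiv.sumAssoc (Node k) (Node k) (Node k)) ∘ (Sum.map outer id) ∘ outer =
        (Sum.map id outer : Node k ⊕ Node k → Node k ⊕ (Node k ⊕ Node k)) ∘ outer := by
      funext v
      rcases v with v | v <;> rfl
    rw [← e3] at b3
    refine Arcs.IsPush.unique ?_ a4 b3
    exact (Equiv.injective _).comp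
      ((Sum.map_injective.2 ⟨outer_injective, Function.injective_id⟩).comp outer_injective)
  · intro x hx y hy
    simp only [L1, List.mem_map, exists_exists_and_eq_and] at hx hy
    obtain ⟨i, -, rfl⟩ := hx
    obtain ⟨j, -, rfl⟩ := hy
    simp [seam, outer]


theorem one_mul_aux (d : LDiagram k) (l : List (Fin k)) (hl : l.Nodup)
    (A : Arcs (Node k ⊕ Node k)) (ρ : Node k → Node k ⊕ Node k)
    (hρ : ∀ v, ρ v = if ∃ i ∈ l, v = Sum.inl i then Sum.inr v else outer v)
    (hm : ∀ u, A.mate (ρ u) = ρ (d.mate u)) (hd : ∀ u, A.deco (ρ u) = d.deco u)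
    (hs : ∀ i ∈ l, A.mate (Sum.inl (Sum.inr i)) = Sum.inl (Sum.inl i) ∧
      A.deco (Sum.inl (Sum.inr i)) = 0)
    (hf : ∀ i ∉ l, A.mate (seam k i).1 = (seam k i).1 ∧ A.mate (seam k i).2 = (seam k i).2)
    (hL : A.loops = d.loops) :
    Arcs.IsPush outer d.toArcs (A.glueList (l.map (seam k))) := by
  induction l generalizing A ρ with
  | nil =>
    have : ρ = outer := by funext v; simp [hρ]
    subst this
    refine ⟨hm, hd, ?_, hL⟩
    rintro ((i | i) | (i | i)) hw
    · exact absurd ⟨Sum.inl i, rfl⟩ hw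
    · exact (hf i (by simp)).1
    · exact (hf i (by simp)).2
    · exact absurd ⟨Sum.inr i, rfl⟩ hw
  | cons i l ih =>
    rw [List.nodup_cons] at hl
    have hq : (seam k i).2 = ρ (Sum.inl i) := by
      rw [hρ, if_pos ⟨i, by simp, rfl⟩]; rfl
    have inj : Function.Injective ρ := by
      refine Function.LeftInverse.injective (g := Sum.elim id id) fun v => ?_
      rw [hρ]
      split_ifs
      · rfl
      · rcases v with v | v <;> rfl
    have n1 : ∀ j u, ρ u ≠ Sum.inl (Sum.inr j) := by
      rintro j (a | a) <;> rw [hρ] <;> split_ifs <;> simp [outer]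
    have n2 : ∀ u, ρ u ≠ Sum.inl (Sum.inl i) := by
      intro u hu
      by_cases h : ∃ j ∈ i :: l, u = Sum.inl j
      · rw [hρ, if_pos h] at hu
        obtain ⟨j, -, rfl⟩ := h
        simp at hu
      · rw [hρ, if_neg h] at hu
        have : u = Sum.inl i := outer_injective (hu.trans rfl)
        exact h ⟨i, by simp, this⟩
    obtain ⟨h1, h2, h3⟩ := Arcs.glue_strand d.toArcs A ρ (Sum.inl i) (seam k i).1
      (Sum.inl (Sum.inl i)) (d.no_free _) inj (by simp [seam]) (n1 i) n2 (hs i (by simp)).1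
      (hs i (by simp)).2 hm hd
    rw [← hq] at h1 h2 h3
    have hok : A.Gluable (seam k i).1 (seam k i).2 := by
      refine ⟨by simp [seam], ?_, ?_⟩
      · rw [seam, (hs i (by simp)).1]; simp
      · rw [hq, hm]
        exact fun h => d.no_free _ (inj h)
    refine ih hl.2 _ (Function.update ρ (Sum.inl i) (Sum.inl (Sum.inl i))) ?_ h1 h2 ?_ ?_
      (h3.trans hL)
    · intro v
      by_cases hv : v = Sum.inl i
      · subst hv
        simp [hl.1, outer]
      · rw [Function.update_of_ne hv, hρ]
        simp [hv]
    · intro j hj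
      have hji : j ≠ i := fun h => hl.1 (h ▸ hj)
      have hj' := hs j (by simp [hj])
      have nz : Sum.inl (Sum.inr j) ≠ A.mate (seam k i).2 := by
        rw [hq, hm]
        exact (n1 j _).symm
      constructor
      · rw [Arcs.glue_keep, hj'.1]
        · simp [seam, hji]
        · simp [seam]
        · rw [hj'.1]; simp [seam]
        · rw [hj'.1]; simp [seam]
      · rw [Arcs.glue_deco _ _ _ hok, if_neg (by simp [seam, hji]), if_neg, hj'.2]
        rintro (h | h)
        · rw [seam, (hs i (by simp)).1] at h
          simp at h
        · exact nz h
    · intro j hj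
      rw [Arcs.glue_free _ _ _ _ hok, Arcs.glue_free _ _ _ _ hok]
      by_cases hji : j = i
      · subst hji; simp
      · have := hf j (by simp [hji, hj])
        simp [this]

theorem mul_one_aux (d : LDiagram k) (l : List (Fin k)) (hl : l.Nodup)
    (A : Arcs (Node k ⊕ Node k)) (ρ : Node k → Node k ⊕ Node k)
    (hρ : ∀ v, ρ v = if ∃ i ∈ l, v = Sum.inr i then Sum.inl v else outer v)
    (hm : ∀ u, A.mate (ρ u) = ρ (d.mate u)) (hd : ∀ u, A.deco (ρ u) = d.deco u)
    (hs : ∀ i ∈ l, A.mate (Sum.inr (Sum.inl i)) = Sum.inr (Sum.inr i) ∧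
      A.deco (Sum.inr (Sum.inl i)) = 0)
    (hf : ∀ i ∉ l, A.mate (seam k i).1 = (seam k i).1 ∧ A.mate (seam k i).2 = (seam k i).2)
    (hL : A.loops = d.loops) :
    Arcs.IsPush outer d.toArcs (A.glueList (l.map (seam k))) := by
  induction l generalizing A ρ with
  | nil =>
    have : ρ = outer := by funext v; simp [hρ]
    subst this
    refine ⟨hm, hd, ?_, hL⟩
    rintro ((i | i) | (i | i)) hw
    · exact absurd ⟨Sum.inl i, rfl⟩ hw
    · exact (hf i (by simp)).1
    · exact (hf i (by simp)).2
    · exact absurd ⟨Sum.inr i, rfl⟩ hw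
  | cons i l ih =>
    rw [List.nodup_cons] at hl
    have hq : (seam k i).1 = ρ (Sum.inr i) := by
      rw [hρ, if_pos ⟨i, by simp, rfl⟩]; rfl
    have inj : Function.Injective ρ := by
      refine Function.LeftInverse.injective (g := Sum.elim id id) fun v => ?_
      rw [hρ]
      split_ifs
      · rfl
      · rcases v with v | v <;> rfl
    have n1 : ∀ j u, ρ u ≠ Sum.inr (Sum.inl j) := by
      rintro j (a | a) <;> rw [hρ] <;> split_ifs <;> simp [outer]
    have n2 : ∀ u, ρ u ≠ Sum.inr (Sum.inr i) := by
      intro u hu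
      by_cases h : ∃ j ∈ i :: l, u = Sum.inr j
      · rw [hρ, if_pos h] at hu
        obtain ⟨j, -, rfl⟩ := h
        simp at hu
      · rw [hρ, if_neg h] at hu
        have : u = Sum.inr i := outer_injective (hu.trans rfl)
        exact h ⟨i, by simp, this⟩
    obtain ⟨h1, h2, h3⟩ := Arcs.glue_strand d.toArcs A ρ (Sum.inr i) (seam k i).2
      (Sum.inr (Sum.inr i)) (d.no_free _) inj (by simp [seam]) (n1 i) n2 (hs i (by simp)).1
      (hs i (by simp)).2 hm hd
    rw [← hq, Arcs.glue_symm] at h1 h2 h3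
    have hok : A.Gluable (seam k i).1 (seam k i).2 := by
      refine ⟨by simp [seam], ?_, ?_⟩
      · rw [hq, hm]
        exact fun h => d.no_free _ (inj h)
      · rw [seam, (hs i (by simp)).1]; simp
    refine ih hl.2 _ (Function.update ρ (Sum.inr i) (Sum.inr (Sum.inr i))) ?_ h1 h2 ?_ ?_
      (h3.trans hL)
    · intro v
      by_cases hv : v = Sum.inr i
      · subst hv
        simp [hl.1, outer]
      · rw [Function.update_of_ne hv, hρ]
        simp [hv]
    · intro j hj
      have hji : j ≠ i := fun h => hl.1 (h ▸ hj)
      have hj' := hs j (by simp [hj])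
      have nz : Sum.inr (Sum.inl j) ≠ A.mate (seam k i).1 := by
        rw [hq, hm]
        exact (n1 j _).symm
      constructor
      · rw [Arcs.glue_keep, hj'.1]
        · simp [seam]
        · simp [seam, hji]
        · rw [hj'.1]; simp [seam]
        · rw [hj'.1]; simp [seam]
      · rw [Arcs.glue_deco _ _ _ hok, if_neg (by simp [seam, hji]), if_neg, hj'.2]
        rintro (h | h)
        · exact nz h
        · rw [seam, (hs i (by simp)).1] at h
          simp at h
    · intro j hj
      rw [Arcs.glue_free _ _ _ _ hok, Arcs.glue_free _ _ _ _ hok]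
      by_cases hji : j = i
      · subst hji; simp
      · have := hf j (by simp [hji, hj])
        simp [this]

instance : Monoid (LDiagram k) where
  mul_assoc := assoc_aux
  one_mul d := by
    apply ext_arcs
    refine Arcs.IsPush.unique outer_injective (mul_isPush 1 d) ?_
    refine one_mul_aux d (List.finRange k) (List.nodup_finRange k) _ Sum.inr ?_ ?_ ?_ ?_ ?_ ?_
    · rintro (i | i) <;> simp [outer]
    · intro u; rfl
    · intro u; rfl
    · intro i _; exact ⟨rfl, rfl⟩
    · intro i hi; simp at hi
    · exact zero_add _
  mul_one d := by
    apply ext_arcs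
    refine Arcs.IsPush.unique outer_injective (mul_isPush d 1) ?_
    refine mul_one_aux d (List.finRange k) (List.nodup_finRange k) _ Sum.inl ?_ ?_ ?_ ?_ ?_ ?_
    · rintro (i | i) <;> simp [outer]
    · intro u; rfl
    · intro u; rfl
    · intro i _; exact ⟨rfl, rfl⟩
    · intro i hi; simp at hi
    · exact add_zero _

/-- Top-bottom inversion. -/
def flip (d : LDiagram k) : LDiagram k where
  mate v := (d.mate v.swap).swap
  deco v := d.deco v.swap
  loops := d.loops
  mate_mate v := by simp [d.mate_mate]
  deco_mate v := by simp [d.deco_mate]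
  deco_free v hv := d.deco_free _ (by rw [← Sum.swap_swap (d.mate _), hv])
  no_free v hv := d.no_free v.swap (by rw [← Sum.swap_swap (d.mate _), hv])
  planar := by
    have hp : ∀ v : Node k, pos v.swap = 2 * k - 1 - pos v := by
      rintro (i | i) <;> simp
      omega
    intro u v h
    have a1 := pos_lt u
    have a2 := pos_lt v
    have a3 := pos_lt (d.mate u.swap)
    have a4 := pos_lt (d.mate v.swap)
    have := d.planar (d.mate v.swap) (d.mate u.swap)
    rw [d.mate_mate, d.mate_mate] at this
    simp only [hp] at h this
    omega
  exposed := by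
    have hp : ∀ v : Node k, pos v.swap = 2 * k - 1 - pos v := by
      rintro (i | i) <;> simp
      omega
    intro v hv u h
    have a1 := pos_lt u
    have a2 := pos_lt v
    have a3 := pos_lt (d.mate u.swap)
    have := d.exposed v.swap hv (d.mate u.swap)
    rw [d.mate_mate] at this
    simp only [hp] at h this
    omega
  undecorated h := by
    have hd : d.toArcs.Undecorated := d.undecorated (no_north_of_no_south fun i j hij => h i j (by
      simp [hij]))
    exact ⟨fun v => hd.1 v.swap, hd.2⟩

/-- The diagram with an edge joining the nodes `i + 1` and `i + 2` of the north face, an edge joining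
the nodes `(i + 1)'` and `(i + 2)'` of the south face, each with `m` decorations, and vertical
undecorated edges elsewhere. -/
def cupCap (i : ℕ) (hi : i + 1 < k) (m : ℕ) (hm : m ≠ 0 → i = 0) : LDiagram k where
  mate := Sum.elim
    (fun j : Fin k => if (j : ℕ) = i then Sum.inl ⟨i + 1, hi⟩ else
      if (j : ℕ) = i + 1 then Sum.inl ⟨i, by omega⟩ else Sum.inr j)
    (fun j : Fin k => if (j : ℕ) = i then Sum.inr ⟨i + 1, hi⟩ else
      if (j : ℕ) = i + 1 then Sum.inr ⟨i, by omega⟩ else Sum.inl j)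
  deco := Sum.elim
    (fun j : Fin k => if (j : ℕ) = i ∨ (j : ℕ) = i + 1 then m else 0)
    (fun j : Fin k => if (j : ℕ) = i ∨ (j : ℕ) = i + 1 then m else 0)
  loops := 0
  mate_mate := by
    rintro (j | j) <;> simp only [Sum.elim_inl, Sum.elim_inr] <;> split_ifs <;>
      simp_all [Fin.ext_iff]
  deco_mate := by
    rintro (j | j) <;> simp only [Sum.elim_inl, Sum.elim_inr] <;> split_ifs <;> simp_all
  deco_free := by
    rintro (j | j) <;> simp only [Sum.elim_inl, Sum.elim_inr] <;> split_ifs <;>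
      simp_all [Fin.ext_iff]
  no_free := by
    rintro (j | j) <;> simp only [Sum.elim_inl, Sum.elim_inr] <;> split_ifs <;>
      simp_all [Fin.ext_iff]
  planar := by
    rintro (u | u) (v | v) h <;> simp only [Sum.elim_inl, Sum.elim_inr] at h <;>
      split_ifs at h <;> simp at h <;> omega
  exposed := by
    rintro (v | v) hv (u | u) h <;> simp only [Sum.elim_inl, Sum.elim_inr] at h hv <;>
      split_ifs at h hv <;> simp at h hv <;> have := hm hv <;> omega
  undecorated h := absurd (by simp) (h ⟨i, by omega⟩ ⟨i + 1, hi⟩)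

/-- `d_{i+1}`, for `i + 1 < n`: the simple diagrams `d_1, ..., d_{n-1}`. -/
def simple (i : ℕ) (hi : i + 1 < k) : LDiagram k := cupCap i hi 0 (by simp)

/-- `d_{1bar}`: as `d_1`, with one decoration on each of the two non-propagating edges. -/
def simpleBar (h : 0 + 1 < k) : LDiagram k := cupCap 0 h 1 (by simp)

end LDiagram

open Polynomial

/-- The algebra with basis the L-decorated pseudo `k`-diagrams over `ℤ[δ]`; the indeterminate of
`ℤ[X]` is `δ`. -/
abbrev PL (k : ℕ) : Type := MonoidAlgebra ℤ[X] (LDiagram k)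

/-- `d` as an element of `PL k`. -/
noncomputable def PL.of {k : ℕ} (d : LDiagram k) : PL k := MonoidAlgebra.of ℤ[X] (LDiagram k) d

/-- The decorations of `d` with `m` more of them on the edge ending at `v`. -/
def LDiagram.decoAdd {k : ℕ} (d : LDiagram k) (v : Node k) (m : ℕ) : Node k → ℕ :=
  fun u => if u = v ∨ u = d.mate v then d.deco u + m else d.deco u

/-- The local relations. -/
inductive LocalRel (k : ℕ) : PL k → PL k → Prop
  /-- An undecorated loop is replaced by the factor `δ`. -/
  | loop (d d' : LDiagram k) : d'.mate = d.mate → d'.deco = d.deco →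
      d'.loops = 0 ::ₘ d.loops → LocalRel k (PL.of d') ((X : ℤ[X]) • PL.of d)
  /-- Two decorations on the same edge cancel. -/
  | cancel (d d' : LDiagram k) (v : Node k) : d'.mate = d.mate → d'.deco = d.decoAdd v 2 →
      d'.loops = d.loops → LocalRel k (PL.of d') (PL.of d)
  /-- Two decorations on the same loop cancel. -/
  | cancelLoop (d d' : LDiagram k) (m : ℕ) (s : Multiset ℕ) : d'.mate = d.mate →
      d'.deco = d.deco → d.loops = m ::ₘ s → d'.loops = (m + 2) ::ₘ s →
      LocalRel k (PL.of d') (PL.of d)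
  /-- In the presence of a decorated loop, an edge loses its decoration. -/
  | absorb (d d' : LDiagram k) (v : Node k) : 1 ∈ d.loops → d'.mate = d.mate →
      d'.deco = d.decoAdd v 1 → d'.loops = d.loops → LocalRel k (PL.of d') (PL.of d)
  /-- In the presence of a decorated loop, another loop loses its decoration. -/
  | absorbLoop (d d' : LDiagram k) (m : ℕ) (s : Multiset ℕ) : d'.mate = d.mate →
      d'.deco = d.deco → d.loops = 1 ::ₘ m ::ₘ s → d'.loops = 1 ::ₘ (m + 1) ::ₘ s →
      LocalRel k (PL.of d') (PL.of d)

/-- The quotient of `PL k` by the local relations. -/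
def PHat (k : ℕ) : Type := RingQuot (LocalRel k)

noncomputable instance (k : ℕ) : Ring (PHat k) := inferInstanceAs (Ring (RingQuot (LocalRel k)))

noncomputable instance (k : ℕ) : Algebra ℤ[X] (PHat k) :=
  inferInstanceAs (Algebra ℤ[X] (RingQuot (LocalRel k)))

/-- The quotient map. -/
noncomputable def PHat.mk {k : ℕ} : PL k →ₐ[ℤ[X]] PHat k := RingQuot.mkAlgHom ℤ[X] (LocalRel k)

/-- The class of the diagram `d`. -/
noncomputable def PHat.of {k : ℕ} (d : LDiagram k) : PHat k := PHat.mk (PL.of d)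

/-- The diagram algebra of type `D_n`: the unital subalgebra generated by the simple diagrams. -/
noncomputable def DTL (n : ℕ) : Subalgebra ℤ[X] (PHat n) :=
  Algebra.adjoin ℤ[X]
    ({x | ∃ (i : ℕ) (hi : i + 1 < n), x = PHat.of (LDiagram.simple i hi)} ∪
      {x | ∃ h : 0 + 1 < n, x = PHat.of (LDiagram.simpleBar h)})

/-- The additional relation: a diagram with a decorated loop is `0`. -/
def DecoratedLoopRel (n : ℕ) (x y : DTL n) : Prop :=
  (∃ d : LDiagram n, 1 ∈ d.loops ∧ (x : PHat n) = PHat.of d) ∧ y = 0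

/-- The loop-free diagram algebra. -/
def LFD (n : ℕ) : Type := RingQuot (DecoratedLoopRel n)

noncomputable instance (n : ℕ) : Ring (LFD n) :=
  inferInstanceAs (Ring (RingQuot (DecoratedLoopRel n)))

noncomputable instance (n : ℕ) : Algebra ℤ[X] (LFD n) :=
  inferInstanceAs (Algebra ℤ[X] (RingQuot (DecoratedLoopRel n)))

/-- The quotient map. -/
noncomputable def LFD.mk {n : ℕ} : DTL n →ₐ[ℤ[X]] LFD n :=
  RingQuot.mkAlgHom ℤ[X] (DecoratedLoopRel n)

/-- The number of decorations on the arcs; the sum over the nodes counts every arc twice. -/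
def Arcs.numDeco {V : Type*} [Fintype V] (A : Arcs V) : ℕ := (∑ v, A.deco v) / 2

/-- `D`-admissible of type II: no loops, at most one decoration on every edge, and an even total
number of decorations. -/
structure LDiagram.IsTypeII {n : ℕ} (d : LDiagram n) : Prop where
  loops : d.loops = 0
  deco_le : ∀ v, d.deco v ≤ 1
  even : Even d.toArcs.numDeco

theorem LDiagram.IsTypeII.flip {n : ℕ} {d : LDiagram n} (h : d.IsTypeII) : d.flip.IsTypeII where
  loops := h.loops
  deco_le v := h.deco_le v.swap
  even := by
    have : d.flip.toArcs.numDeco = d.toArcs.numDeco := by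
      unfold Arcs.numDeco
      congr 1
      exact Equiv.sum_comp (Equiv.sumComm (Fin n) (Fin n)) d.deco
    rw [this]
    exact h.even

/-- The `D`-admissible diagrams of type II. -/
def TypeII (n : ℕ) : Type := {d : LDiagram n // d.IsTypeII}

/-- Top-bottom inversion. -/
def TypeII.flip {n : ℕ} (d : TypeII n) : TypeII n := ⟨d.1.flip, d.2.flip⟩

/-- The upper half-diagram of `d`: the arcs of the north face, the propagating edges being removed.
A half-diagram is a system of arcs on one face in which the nodes without arc are the ends of the
removed propagating edges. -/
def TypeII.upper {n : ℕ} (d : TypeII n) : Arcs (Fin n) where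
  mate i := Sum.elim id (fun _ => i) (d.1.mate (Sum.inl i))
  deco i := Sum.elim (fun _ => d.1.deco (Sum.inl i)) (fun _ => 0) (d.1.mate (Sum.inl i))
  loops := 0
  mate_mate i := by
    rcases h : d.1.mate (Sum.inl i) with j | j
    · have : d.1.mate (Sum.inl j) = Sum.inl i := by rw [← h, d.1.mate_mate]
      simp [this]
    · simp [h]
  deco_mate i := by
    rcases h : d.1.mate (Sum.inl i) with j | j
    · have : d.1.mate (Sum.inl j) = Sum.inl i := by rw [← h, d.1.mate_mate]
      have h2 := d.1.deco_mate (Sum.inl i)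
      rw [h] at h2
      simp [this, h2]
    · simp [h]
  deco_free i := by
    rcases h : d.1.mate (Sum.inl i) with j | j
    · intro hj
      simp only [Sum.elim_inl, id] at hj
      exact absurd (hj ▸ h) (d.1.no_free _)
    · simp

/-- The lower half-diagram: the lower half, inverted in a horizontal line. -/
def TypeII.lower {n : ℕ} (d : TypeII n) : Arcs (Fin n) := d.flip.upper

/-- The number of propagating edges of a half-diagram. -/
def numProp {n : ℕ} (h : Arcs (Fin n)) : ℕ := (Finset.univ.filter fun i => h.mate i = i).card

/-- The symbols `m`, `0⁺`, `0⁻`. -/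
inductive Label : Type
  | num (m : ℕ)
  | zeroPlus
  | zeroMinus

/-- The absolute value `|λ|`. -/
def Label.abs : Label → ℕ
  | num m => m
  | zeroPlus => 0
  | zeroMinus => 0

instance : PartialOrder Label where
  le a b := a = b ∨ a.abs < b.abs
  lt a b := a.abs < b.abs
  le_refl a := Or.inl rfl
  le_trans a b c := by
    rintro (rfl | h) (rfl | h')
    · exact Or.inl rfl
    · exact Or.inr h'
    · exact Or.inr h
    · exact Or.inr (h.trans h')
  le_antisymm a b := by
    rintro (rfl | h) (h' | h')
    · rfl
    · rfl
    · exact h'.symm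
    · exact absurd h' (lt_asymm h)
  lt_iff_le_not_ge a b := by
    constructor
    · intro h
      refine ⟨Or.inr h, ?_⟩
      rintro (rfl | h')
      · exact lt_irrefl _ h
      · exact lt_asymm h h'
    · rintro ⟨rfl | h, h'⟩
      · exact absurd (Or.inl rfl) h'
      · exact h

/-- The labels that occur for `n`. -/
def Label.Valid (n : ℕ) : Label → Prop
  | num m => 0 < m ∧ m ≤ n ∧ m % 2 = n % 2
  | zeroPlus => Even n
  | zeroMinus => Even n

/-- The poset `Λ`: `{1, 3, ..., n}` for `n` odd and `{0⁺, 0⁻, 2, 4, ..., n}` for `n` even, ordered by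
absolute value. -/
abbrev Lam (n : ℕ) : Type := {a : Label // a.Valid n}

/-- The set `M(λ)`: the half-diagrams of the diagrams of type II with `|λ|` propagating edges; for
`0⁺` the number of decorations has to be even, for `0⁻` odd. -/
def M {n : ℕ} (l : Lam n) : Type :=
  {h : Arcs (Fin n) // (∃ d : TypeII n, h = d.upper ∨ h = d.lower) ∧ numProp h = l.1.abs ∧
    (l.1 = Label.zeroPlus → Even h.numDeco) ∧ (l.1 = Label.zeroMinus → Odd h.numDeco)}

/-- `(Λ, M, C, *)` is a cell datum for the `R`-algebra `A`. -/
structure IsCellDatum (R : Type*) [CommRing R] {A : Type*} [Ring A] [Algebra R A]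
    {Λ : Type*} [PartialOrder Λ] {M : Λ → Type*} (C : ∀ l, M l → M l → A) (star : A →ₗ[R] A) :
    Prop where
  finite : ∀ l, Finite (M l)
  injective : Function.Injective fun x : Σ l, M l × M l => C x.1 x.2.1 x.2.2
  linearIndependent : LinearIndependent R
    (Subtype.val : Set.range (fun x : Σ l, M l × M l => C x.1 x.2.1 x.2.2) → A)
  span : Submodule.span R (Set.range fun x : Σ l, M l × M l => C x.1 x.2.1 x.2.2) = ⊤
  star_star : ∀ a, star (star a) = a
  star_mul : ∀ a b, star (a * b) = star b * star a
  star_C : ∀ l S T, star (C l S T) = C l T S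
  mul_C : ∀ (a : A) (l : Λ), ∃ r : M l → M l → R, ∀ S T,
    a * C l S T - ∑ᶠ S', r S' S • C l S' T ∈
      Submodule.span R {x | ∃ m, m < l ∧ ∃ S'' T'', x = C m S'' T''}

end LoopFree

/-! Modulo the local relations a diagram only matters through its underlying arcs, the parity of the
decorations on each edge, and its loops. If all loops carry an even number of decorations, the class
of `d` is a power of `δ` times the class of its reduction `d.reduce` (`PHat.of_eq_of_even`); if some
loop is odd, the class dies in the loop-free algebra (`LFD.mk_eq_zero`). The total number of
decorations is invariant under gluing, so a product of two type II diagrams is a power of `δ` times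
a type II diagram, or zero. Since the identity and the generators are of type II, type II diagrams
span. They are independent because the algebra acts on the free module on all reduced diagrams:
multiply, reduce, and weight every even loop by `δ` and every odd loop by `0`. Under this weighting
all local relations hold, those about decorated loops reading `0 = 0`. Applied to the identity, a
type II diagram returns its own basis vector (`cell_linearIndependent`). That every type II diagram
lies in the generated subalgebra (`of_mem_DTL`) is proved by induction on the horizontal extent of
the edges, a decorated edge being measured by way of the left wall. A diagram other than the
identity has a north arc joining neighbours that is undecorated or joins the nodes 1 and 2. In the
undecorated case a generator `d_{i+1}` splits off: the short arc and a suitable other edge are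
rerouted into two edges of smaller total extent. If the arc `{1, 2}` is decorated, toggling a
decoration on the edges at `1` and at `1'` reduces to the undecorated case and turns `d_1` into
`d_{1bar}`, at no change of cost. For the cell structure, a diagram is cut into halves. Planarity
matches the free nodes in order; only the leftmost propagating edge can be decorated, and evenness
decides whether it is. Hence halves with equally many free nodes determine exactly one diagram
(`exists_typeII`, `IsTypeII.ext_halves`); without propagating edges evenness instead requires the
two halves to have the same parity, whence the labels `0⁺` and `0⁻`. In a product, the loops and the
upper half depend only on the upper half of the second factor (`mul_agree`), while the lower half of
that factor survives unless the number of propagating edges drops (`mul_lowerHalf`). This gives the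
cell axiom, and inversion reverses products (`flip_mul`). -/

namespace LoopFree

open Polynomial

/-! ### Gluing: invariance of the decoration count, parity, and locality. -/

namespace Arcs

variable {V W : Type*}

/-- The number of decorations, counted at both ends of the arcs and twice for the loops. -/
def total [Fintype V] (A : Arcs V) : ℕ := ∑ v, A.deco v + 2 * A.loops.sum

/-- Decorations are never created or lost; they only move from glued arcs to the merged arc or to a
new loop. The weight 2 of the loops in `total` compensates for arcs being counted at both ends. -/
theorem total_glue [Fintype V] [DecidableEq V] (A : Arcs V) (p q : V) :
    (A.glue p q).total = A.total := by
  by_cases h : A.Gluable p q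
  · have hm := A.mate_mate
    have hd := A.deco_mate
    have hg := glue_deco A p q h
    unfold total
    rw [glue_loops A p q h]
    obtain ⟨h1, h2, h3⟩ := h
    by_cases hpq : A.mate p = q
    · have key : ∀ v, (A.glue p q).deco v + (if v = p then A.deco p else 0) +
          (if v = q then A.deco p else 0) = A.deco v := by
        intro v
        rw [hg]
        have := hm p
        have := hd p
        grind
      have := Finset.sum_congr rfl fun v (_ : v ∈ Finset.univ) => key v
      simp only [Finset.sum_add_distrib, Finset.sum_ite_eq', Finset.mem_univ, if_true] at this
      rw [if_pos hpq, Multiset.sum_cons]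
      linarith
    · have key : ∀ v, (A.glue p q).deco v + (if v = p then A.deco p else 0) +
          (if v = q then A.deco q else 0) = A.deco v + (if v = A.mate p then A.deco q else 0) +
          (if v = A.mate q then A.deco p else 0) := by
        intro v
        rw [hg]
        have := hm p
        have := hm q
        have := hd p
        have := hd q
        grind
      have := Finset.sum_congr rfl fun v (_ : v ∈ Finset.univ) => key v
      simp only [Finset.sum_add_distrib, Finset.sum_ite_eq', Finset.mem_univ, if_true] at this
      rw [if_neg hpq]
      omega
  · rw [glue_of_not A p q h]

theorem total_glueList [Fintype V] [DecidableEq V] (A : Arcs V) (l : List (V × V)) :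
    (A.glueList l).total = A.total := by
  induction l generalizing A with
  | nil => rfl
  | cons e l ih => rw [glueList_cons, ih, total_glue]

theorem total_sum [Fintype V] [Fintype W] (A : Arcs V) (B : Arcs W) :
    (A.sum B).total = A.total + B.total := by
  simp only [total, Arcs.sum, Fintype.sum_sum_type, Sum.elim_inl, Sum.elim_inr, Multiset.sum_add]
  ring

theorem IsPush.total [Fintype V] [Fintype W] {e : V → W} (he : Function.Injective e) {A : Arcs V}
    {B : Arcs W} (h : IsPush e A B) : B.total = A.total := by
  classical
  unfold Arcs.total
  rw [h.loops]
  congr 1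
  have h1 : ∑ w, B.deco w = ∑ w ∈ Finset.univ.image e, B.deco w := by
    symm
    apply Finset.sum_subset (Finset.subset_univ _)
    intro w _ hw
    apply B.deco_free
    apply h.free
    rintro ⟨v, rfl⟩
    exact hw (by simp)
  rw [h1, Finset.sum_image fun _ _ _ _ h => he h]
  exact Finset.sum_congr rfl fun v _ => h.deco v

/-- A function that is constant along the arcs and vanishes at the free nodes has an even sum. -/
theorem even_sum [Fintype V] (A : Arcs V) (f : V → ℕ) (h1 : ∀ v, f (A.mate v) = f v)
    (h2 : ∀ v, A.mate v = v → f v = 0) : Even (∑ v, f v) := by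
  classical
  -- Over `ZMod 2` the contributions of the two ends of an arc cancel, and the fixed points of the
  -- involution contribute zero.
  rw [← ZMod.natCast_eq_zero_iff_even, Nat.cast_sum]
  refine Finset.sum_involution (fun v _ => A.mate v) (fun v _ => ?_) (fun v _ h => ?_)
    (fun v _ => Finset.mem_univ _) (fun v _ => A.mate_mate v)
  · rw [h1]
    exact CharTwo.add_self_eq_zero _
  · exact fun hv => h (by rw [h2 v hv, Nat.cast_zero])

theorem two_mul_numDeco [Fintype V] (A : Arcs V) : 2 * A.numDeco = ∑ v, A.deco v :=
  Nat.two_mul_div_two_of_even (A.even_sum A.deco A.deco_mate A.deco_free)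

/-- `A` and `B` agree, the decorations being counted modulo `2`, except for additional loops
`s` of `A`. -/
structure ModTwo (A B : Arcs V) (s : Multiset ℕ) : Prop where
  mate : A.mate = B.mate
  deco : ∀ v, A.deco v % 2 = B.deco v % 2
  loops : A.loops.map (· % 2) = B.loops.map (· % 2) + s

theorem ModTwo.glue [DecidableEq V] {A B : Arcs V} {s : Multiset ℕ} (h : ModTwo A B s) (p q : V) :
    ModTwo (A.glue p q) (B.glue p q) s := by
  have hok : A.Gluable p q ↔ B.Gluable p q := by simp only [Gluable, h.mate]
  by_cases hA : A.Gluable p q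
  · have hB := hok.1 hA
    refine ⟨?_, fun v => ?_, ?_⟩
    · funext v
      rw [glue_mate A p q hA, glue_mate B p q hB, h.mate]
    · rw [glue_deco A p q hA, glue_deco B p q hB, h.mate]
      split_ifs
      · rfl
      · rw [Nat.add_mod, h.deco, h.deco, ← Nat.add_mod]
      · exact h.deco v
    · rw [glue_loops A p q hA, glue_loops B p q hB, h.mate]
      split_ifs
      · rw [Multiset.map_cons, Multiset.map_cons, h.loops, h.deco, Multiset.cons_add]
      · exact h.loops
  · rw [glue_of_not A p q hA, glue_of_not B p q (by rwa [← hok])]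
    exact h

theorem ModTwo.glueList [DecidableEq V] {A B : Arcs V} {s : Multiset ℕ} (h : ModTwo A B s)
    (l : List (V × V)) : ModTwo (A.glueList l) (B.glueList l) s := by
  induction l generalizing A B with
  | nil => exact h
  | cons e l ih => exact ih (h.glue e.1 e.2)

theorem ModTwo.sum {A B : Arcs V} {C D : Arcs W} {s t : Multiset ℕ} (h : ModTwo A B s)
    (h' : ModTwo C D t) : ModTwo (A.sum C) (B.sum D) (s + t) := by
  refine ⟨?_, ?_, ?_⟩
  · simp only [Arcs.sum, h.mate, h'.mate]
  · rintro (v | v)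
    · exact h.deco v
    · exact h'.deco v
  · simp only [Arcs.sum, Multiset.map_add, h.loops, h'.loops]
    abel

/-- `A` and `B` have the same arcs with both ends in `U`, and the same loops. -/
structure AgreeOn (U : Set V) (A B : Arcs V) : Prop where
  mate : ∀ v ∈ U, A.mate v ∈ U ∨ B.mate v ∈ U → A.mate v = B.mate v
  deco : ∀ v ∈ U, A.mate v ∈ U → A.deco v = B.deco v
  loops : A.loops = B.loops

/-- A merged arc has both ends in `U` only if both of the old arcs lie in `U`, and a new loop comes
from an arc inside `U`; so gluing inside `U` never sees what happens outside. -/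
theorem AgreeOn.glue [DecidableEq V] {U : Set V} {A B : Arcs V} (h : AgreeOn U A B) {p q : V}
    (hp : p ∈ U) (hq : q ∈ U) : AgreeOn U (A.glue p q) (B.glue p q) := by
  -- A free node is its own mate, hence its mate is in `U`; this is why the condition on mates is
  -- symmetric in `A` and `B`.
  have hfree : ∀ v ∈ U, A.mate v = v ↔ B.mate v = v := by
    intro v hv
    constructor
    · intro e
      rw [← h.mate v hv (Or.inl (by rwa [e])), e]
    · intro e
      rw [h.mate v hv (Or.inr (by rwa [e])), e]
  have hok : A.Gluable p q ↔ B.Gluable p q := by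
    simp only [Gluable, ne_eq, hfree p hp, hfree q hq]
  by_cases hA : A.Gluable p q
  · have hB := hok.1 hA
    have hmA := A.mate_mate
    have hmB := B.mate_mate
    have mp := h.mate p hp
    have mq := h.mate q hq
    have dp := h.deco p hp
    have dq := h.deco q hq
    refine ⟨fun v hv => ?_, fun v hv => ?_, ?_⟩
    · rw [glue_mate A p q hA, glue_mate B p q hB]
      have mv := h.mate v hv
      have := hmA v
      have := hmA p
      have := hmA q
      have := hmB v
      have := hmB p
      have := hmB q
      grind
    · rw [glue_mate A p q hA, glue_deco A p q hA, glue_deco B p q hB]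
      have mv := h.mate v hv
      have dv := h.deco v hv
      have := hmA v
      have := hmA p
      have := hmA q
      have := hmB v
      have := hmB p
      have := hmB q
      grind
    · rw [glue_loops A p q hA, glue_loops B p q hB, h.loops]
      grind
  · rw [glue_of_not A p q hA, glue_of_not B p q (by rwa [← hok])]
    exact h

theorem AgreeOn.glueList [DecidableEq V] {U : Set V} {A B : Arcs V} (h : AgreeOn U A B)
    (l : List (V × V)) (hl : ∀ e ∈ l, e.1 ∈ U ∧ e.2 ∈ U) :
    AgreeOn U (A.glueList l) (B.glueList l) := by
  induction l generalizing A B with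
  | nil => exact h
  | cons e l ih =>
    exact ih (h.glue (hl e (by simp)).1 (hl e (by simp)).2) fun e' he' => hl e' (by simp [he'])

theorem glue_keep_deco [DecidableEq V] (A : Arcs V) (p q v : V) (h1 : v ≠ p) (h2 : v ≠ q)
    (h3 : A.mate v ≠ p) (h4 : A.mate v ≠ q) : (A.glue p q).deco v = A.deco v := by
  by_cases h : A.Gluable p q
  · rw [glue_deco A p q h, if_neg (by tauto), if_neg]
    rintro (rfl | rfl)
    · exact h3 (A.mate_mate p)
    · exact h4 (A.mate_mate q)
  · rw [glue_of_not A p q h]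

theorem glueList_keep_deco [DecidableEq V] (A : Arcs V) (l : List (V × V)) (v : V)
    (h : ∀ e ∈ l, v ≠ e.1 ∧ v ≠ e.2 ∧ A.mate v ≠ e.1 ∧ A.mate v ≠ e.2) :
    (A.glueList l).deco v = A.deco v := by
  induction l generalizing A with
  | nil => rfl
  | cons e l ih =>
    have h' := h e (by simp)
    have k := glue_keep A e.1 e.2 v h'.1 h'.2.1 h'.2.2.1 h'.2.2.2
    rw [glueList_cons, ih, glue_keep_deco A e.1 e.2 v h'.1 h'.2.1 h'.2.2.1 h'.2.2.2]
    intro e' he'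
    rw [k]
    exact h e' (by simp [he'])

end Arcs

/-! ### Reduction modulo two and the action on reduced diagrams. -/

namespace LDiagram

variable {k : ℕ}

/-- Change the decorations of `d` without decorating an undecorated edge. -/
def redecorate (d : LDiagram k) (f : Node k → ℕ) (s : Multiset ℕ) (h1 : ∀ v, f (d.mate v) = f v)
    (h2 : ∀ v, f v ≠ 0 → d.deco v ≠ 0) (h3 : (∀ m ∈ d.loops, m = 0) → ∀ m ∈ s, m = 0) :
    LDiagram k where
  mate := d.mate
  deco := f
  loops := s
  mate_mate := d.mate_mate
  deco_mate := h1
  deco_free v hv := absurd hv (d.no_free v)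
  no_free := d.no_free
  planar := d.planar
  exposed v hv := d.exposed v (h2 v hv)
  undecorated h := by
    obtain ⟨a, b⟩ := d.undecorated h
    exact ⟨fun v => by_contra fun hv => h2 v hv (a v), h3 b⟩

/-- Remove the loops, and cancel pairs of decorations on the edges. -/
def reduce (d : LDiagram k) : LDiagram k :=
  d.redecorate (fun v => d.deco v % 2) 0 (fun v => by rw [d.deco_mate])
    (fun v h h' => h (by rw [h'])) (by simp)

@[simp] theorem reduce_mate (d : LDiagram k) : d.reduce.mate = d.mate := rfl

@[simp] theorem reduce_deco (d : LDiagram k) (v : Node k) : d.reduce.deco v = d.deco v % 2 := rfl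

@[simp] theorem reduce_loops (d : LDiagram k) : d.reduce.loops = 0 := rfl

theorem ext_data {d e : LDiagram k} (h1 : d.mate = e.mate) (h2 : ∀ v, d.deco v = e.deco v)
    (h3 : d.loops = e.loops) : d = e :=
  ext_arcs (Arcs.ext h1 (funext h2) h3)

theorem modTwo_reduce (d : LDiagram k) :
    Arcs.ModTwo d.toArcs d.reduce.toArcs (d.loops.map (· % 2)) :=
  ⟨rfl, fun v => by simp, by simp⟩

theorem modTwo_refl (d : LDiagram k) : Arcs.ModTwo d.toArcs d.toArcs 0 :=
  ⟨rfl, fun _ => rfl, by simp⟩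

theorem modTwo_mul {d d' e e' : LDiagram k} {s t : Multiset ℕ}
    (h : Arcs.ModTwo d.toArcs d'.toArcs s) (h' : Arcs.ModTwo e.toArcs e'.toArcs t) :
    Arcs.ModTwo (d * e).toArcs (d' * e').toArcs (s + t) := by
  have := (h.sum h').glueList ((List.finRange k).map (seam k))
  refine ⟨?_, fun v => this.deco (outer v), this.loops⟩
  funext v
  change Sum.elim id id ((stack d.toArcs e.toArcs).mate (outer v)) =
    Sum.elim id id ((stack d'.toArcs e'.toArcs).mate (outer v))
  unfold stack
  rw [this.mate]

theorem total_mul (d e : LDiagram k) :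
    (d * e).toArcs.total = d.toArcs.total + e.toArcs.total := by
  rw [← Arcs.total_sum, ← Arcs.total_glueList (d.toArcs.sum e.toArcs)
    ((List.finRange k).map (seam k))]
  exact ((mul_isPush d e).total outer_injective).symm

/-- The scalar contributed by a collection of loops in which decorated loops vanish. -/
noncomputable def loopWeight (s : Multiset ℕ) : ℤ[X] :=
  (s.map fun m => if m % 2 = 0 then (X : ℤ[X]) else 0).prod

theorem loopWeight_add (s t : Multiset ℕ) : loopWeight (s + t) = loopWeight s * loopWeight t := by
  simp [loopWeight]

theorem loopWeight_map_mod (s : Multiset ℕ) : loopWeight (s.map (· % 2)) = loopWeight s := by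
  simp [loopWeight]

/-- The weight sees only parities of loops and is multiplicative, so the additional loops `s` split
off as a factor. -/
theorem loopWeight_congr {d e : LDiagram k} {s : Multiset ℕ}
    (h : Arcs.ModTwo d.toArcs e.toArcs (s.map (· % 2))) :
    loopWeight d.loops = loopWeight e.loops * loopWeight s := by
  rw [← loopWeight_map_mod, h.loops, loopWeight_add, loopWeight_map_mod, loopWeight_map_mod]

theorem reduce_congr {d e : LDiagram k} {s : Multiset ℕ} (h : Arcs.ModTwo d.toArcs e.toArcs s) :
    d.reduce = e.reduce :=
  ext_data h.mate h.deco rfl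

theorem loopWeight_eq_zero {s : Multiset ℕ} {m : ℕ} (h : m ∈ s) (hm : m % 2 = 1) :
    loopWeight s = 0 :=
  Multiset.prod_eq_zero (Multiset.mem_map.2 ⟨m, h, by simp [hm]⟩)

/-- Reducing `e` beforehand discards precisely the loops of `e`, which survive any multiplication
untouched; the loops formed along the seam keep their parity. -/
theorem loopWeight_mul_reduce (d e : LDiagram k) : loopWeight (d * e).loops =
    loopWeight (d * e.reduce).loops * loopWeight e.loops := by
  apply loopWeight_congr
  have := modTwo_mul d.modTwo_refl e.modTwo_reduce
  rwa [zero_add] at this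

theorem loopWeight_reduce_mul (d e : LDiagram k) : loopWeight (d * e).loops =
    loopWeight (d.reduce * e).loops * loopWeight d.loops := by
  apply loopWeight_congr
  have := modTwo_mul d.modTwo_reduce e.modTwo_refl
  rwa [add_zero] at this

theorem reduce_mul_reduce (d e : LDiagram k) : (d * e.reduce).reduce = (d * e).reduce :=
  (reduce_congr (modTwo_mul d.modTwo_refl e.modTwo_reduce)).symm

theorem reduce_reduce_mul (d e : LDiagram k) : (d.reduce * e).reduce = (d * e).reduce :=
  (reduce_congr (modTwo_mul d.modTwo_reduce e.modTwo_refl)).symm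

end LDiagram

/-- A diagram without loops and with at most one decoration on every edge. -/
def LDiagram.IsReduced {k : ℕ} (d : LDiagram k) : Prop := d.loops = 0 ∧ ∀ v, d.deco v ≤ 1

namespace LDiagram

variable {k : ℕ}

theorem reduce_isReduced (d : LDiagram k) : d.reduce.IsReduced :=
  ⟨rfl, fun v => Nat.lt_succ_iff.1 (Nat.mod_lt _ (by norm_num))⟩

theorem IsReduced.reduce_eq {d : LDiagram k} (h : d.IsReduced) : d.reduce = d := by
  refine ext_data rfl (fun v => ?_) h.1.symm
  have := h.2 v
  simp only [reduce_deco]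
  omega

theorem IsTypeII.isReduced {d : LDiagram k} (h : d.IsTypeII) : d.IsReduced := ⟨h.loops, h.deco_le⟩

/-- The normal form of `d` in the free module on the reduced diagrams. -/
noncomputable def normalForm (d : LDiagram k) : {e : LDiagram k // e.IsReduced} →₀ ℤ[X] :=
  Finsupp.single ⟨d.reduce, d.reduce_isReduced⟩ (loopWeight d.loops)

/-- This compatibility of reduction with multiplication is what makes `action` multiplicative. -/
theorem normalForm_mul (d e : LDiagram k) :
    normalForm (d * e) = loopWeight e.loops • normalForm (d * e.reduce) := by
  unfold normalForm
  rw [Finsupp.smul_single]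
  congr 1
  · exact Subtype.ext (reduce_mul_reduce d e).symm
  · rw [loopWeight_mul_reduce, smul_eq_mul, mul_comm]

theorem normalForm_mul' (d e : LDiagram k) :
    normalForm (d * e) = loopWeight d.loops • normalForm (d.reduce * e) := by
  unfold normalForm
  rw [Finsupp.smul_single]
  congr 1
  · exact Subtype.ext (reduce_reduce_mul d e).symm
  · rw [loopWeight_reduce_mul, smul_eq_mul, mul_comm]

theorem IsReduced.normalForm_eq {d : LDiagram k} (h : d.IsReduced) :
    normalForm d = Finsupp.single ⟨d, h⟩ 1 := by
  unfold normalForm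
  congr 1
  · exact Subtype.ext h.reduce_eq
  · simp [h.1, loopWeight]

/-- The action of the diagrams on the free module on the reduced diagrams. -/
noncomputable def action :
    LDiagram k →* Module.End ℤ[X] ({e : LDiagram k // e.IsReduced} →₀ ℤ[X]) where
  toFun d := Finsupp.linearCombination ℤ[X] fun e => normalForm (d * e.1)
  map_one' := by
    ext1 e
    ext1
    simp [e.2.normalForm_eq]
  map_mul' d d' := by
    ext1 e
    ext1
    simp only [LinearMap.comp_apply, Finsupp.lsingle_apply, Finsupp.linearCombination_single,
      one_smul, Module.End.mul_apply]
    -- Acting by `d'` first leaves a reduced diagram with a scalar; `normalForm_mul` produces the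
    -- same scalar from the unreduced product.
    rw [mul_assoc, normalForm_mul]
    conv_rhs => rw [normalForm]
    rw [Finsupp.linearCombination_single]

theorem action_single (d e : LDiagram k) (he : e.IsReduced) (c : ℤ[X]) :
    action d (Finsupp.single ⟨e, he⟩ c) = c • normalForm (d * e) := by
  simp [action]

theorem action_eq (d : LDiagram k) : action d = loopWeight d.loops • action d.reduce := by
  ext1 e
  ext1
  simp only [LinearMap.comp_apply, Finsupp.lsingle_apply, LinearMap.smul_apply]
  obtain ⟨e, he⟩ := e
  rw [action_single, action_single, one_smul, one_smul, normalForm_mul']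

end LDiagram

open LDiagram

/-- The representation of `PL k` on the free module on the reduced diagrams. -/
noncomputable def PL.rep (k : ℕ) :
    PL k →ₐ[ℤ[X]] Module.End ℤ[X] ({e : LDiagram k // e.IsReduced} →₀ ℤ[X]) :=
  MonoidAlgebra.lift ℤ[X] _ (LDiagram k) action

theorem PL.rep_of {k : ℕ} (d : LDiagram k) : PL.rep k (PL.of d) = action d := by
  simp [PL.rep, PL.of]

/-- Cancellation and removal of an undecorated loop respect parities and weights. The absorption
relations hold because both sides contain a loop of weight zero. -/
theorem PL.rep_localRel {k : ℕ} {x y : PL k} (h : LocalRel k x y) : PL.rep k x = PL.rep k y := by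
  -- The factor `c` is `X` when an undecorated loop is removed and `1` for the two cancellation
  -- relations.
  have hd : ∀ d d' : LDiagram k, ∀ c : ℤ[X], d'.mate = d.mate →
      (∀ v, d'.deco v % 2 = d.deco v % 2) → loopWeight d'.loops = c * loopWeight d.loops →
      action d' = c • action d := by
    intro d d' c h1 h2 h3
    rw [action_eq d', action_eq d, h3, mul_smul, show d'.reduce = d.reduce from ext_data h1 h2 rfl]
  have hz : ∀ d d' : LDiagram k, 1 ∈ d.loops → 1 ∈ d'.loops → action d' = action d := by
    intro d d' h1 h2
    rw [action_eq d', action_eq d, loopWeight_eq_zero h1 rfl, loopWeight_eq_zero h2 rfl, zero_smul,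
      zero_smul]
  cases h with
  | loop d d' h1 h2 h3 =>
    rw [map_smul, PL.rep_of, PL.rep_of]
    refine hd d d' X h1 (fun v => by rw [h2]) ?_
    rw [h3]
    simp [loopWeight]
  | cancel d d' v h1 h2 h3 =>
    rw [PL.rep_of, PL.rep_of, ← one_smul ℤ[X] (action d)]
    refine hd d d' 1 h1 (fun u => ?_) (by rw [h3, one_mul])
    rw [h2, decoAdd]
    split_ifs <;> simp
  | cancelLoop d d' m s h1 h2 h3 h4 =>
    rw [PL.rep_of, PL.rep_of, ← one_smul ℤ[X] (action d)]
    refine hd d d' 1 h1 (fun u => by rw [h2]) ?_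
    rw [h3, h4]
    simp [loopWeight]
  | absorb d d' v h0 h1 h2 h3 =>
    rw [PL.rep_of, PL.rep_of]
    exact hz d d' h0 (by rwa [h3])
  | absorbLoop d d' m s h1 h2 h3 h4 =>
    rw [PL.rep_of, PL.rep_of]
    exact hz d d' (by simp [h3]) (by simp [h4])

/-- The representation of `PHat k` on the free module on the reduced diagrams. -/
noncomputable def PHat.rep (k : ℕ) :
    PHat k →ₐ[ℤ[X]] Module.End ℤ[X] ({e : LDiagram k // e.IsReduced} →₀ ℤ[X]) :=
  RingQuot.liftAlgHom ℤ[X] ⟨PL.rep k, fun _ _ h => PL.rep_localRel h⟩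

theorem PHat.rep_of {k : ℕ} (d : LDiagram k) : PHat.rep k (PHat.of d) = action d := by
  unfold PHat.rep PHat.of PHat.mk
  erw [RingQuot.liftAlgHom_mkAlgHom_apply]
  exact PL.rep_of d

/-- The representation of `LFD n` on the free module on the reduced diagrams. -/
noncomputable def LFD.rep (n : ℕ) :
    LFD n →ₐ[ℤ[X]] Module.End ℤ[X] ({e : LDiagram n // e.IsReduced} →₀ ℤ[X]) :=
  RingQuot.liftAlgHom ℤ[X] ⟨(PHat.rep n).comp (DTL n).val, by
    rintro x y ⟨⟨d, h1, h2⟩, rfl⟩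
    have h3 : (DTL n).val x = PHat.of d := h2
    rw [map_zero, AlgHom.comp_apply, h3, PHat.rep_of, action_eq, loopWeight_eq_zero h1 rfl, zero_smul]⟩

theorem LFD.rep_mk {n : ℕ} (d : LDiagram n) (hd : PHat.of d ∈ DTL n) :
    LFD.rep n (LFD.mk ⟨PHat.of d, hd⟩) = action d := by
  unfold LFD.rep LFD.mk
  erw [RingQuot.liftAlgHom_mkAlgHom_apply]
  exact PHat.rep_of d

end LoopFree

namespace LoopFree

open Polynomial LDiagram

/-! ### Normal forms in the diagram algebra and its loop-free quotient. -/

namespace PHat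

variable {k : ℕ}

theorem of_mul (d e : LDiagram k) : PHat.of (d * e) = PHat.of d * PHat.of e := by
  unfold PHat.of PL.of
  rw [map_mul, map_mul]

theorem of_one : PHat.of (1 : LDiagram k) = 1 := by
  unfold PHat.of PL.of
  rw [map_one, map_one]

theorem mk_eq {x y : PL k} (h : LocalRel k x y) : (PHat.mk x : PHat k) = PHat.mk y :=
  RingQuot.mkAlgHom_rel ℤ[X] h

theorem of_reduce_of_loops_eq_zero (d : LDiagram k) (h : d.loops = 0) :
    PHat.of d = PHat.of d.reduce := by
  induction hN : ∑ v, d.deco v using Nat.strong_induction_on generalizing d with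
  | _ N ih =>
    by_cases hd : ∀ v, d.deco v ≤ 1
    · rw [IsReduced.reduce_eq ⟨h, hd⟩]
    · push Not at hd
      obtain ⟨v, hv⟩ := hd
      have hm := d.mate_mate
      have hv' := d.deco_mate v
      -- The relation `cancel` is read from right to left: `d` is `d1` with two further decorations
      -- at `v`, and the total strictly decreases.
      let d1 := d.redecorate (fun u => if u = v ∨ u = d.mate v then d.deco u - 2 else d.deco u) 0
        (fun u => by
          have := d.deco_mate u
          have := hm u
          have := hm v
          grind)
        (fun u hu hu' => hu (by simp [hu'])) (by simp)
      have e1 : PHat.of d = PHat.of d1 := by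
        refine mk_eq (LocalRel.cancel d1 d v rfl ?_ h)
        funext u
        simp only [decoAdd, d1, redecorate]
        grind
      rw [e1, ih (∑ v, d1.deco v) _ d1 rfl rfl]
      · congr 1
        refine ext_data rfl (fun u => ?_) rfl
        simp only [reduce_deco, d1, redecorate]
        grind
      · rw [← hN]
        refine Finset.sum_lt_sum (fun u _ => ?_) ⟨v, Finset.mem_univ v, ?_⟩
        · simp only [d1, redecorate]
          split_ifs <;> omega
        · simp only [d1, redecorate]
          grind

/-- Each step removes an undecorated loop or two decorations of a loop; the sum of the loop
decorations plus the number of loops decreases either way. -/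
theorem of_eq_of_even (d : LDiagram k) (h : ∀ m ∈ d.loops, m % 2 = 0) :
    PHat.of d = loopWeight d.loops • PHat.of d.reduce := by
  induction hN : d.loops.sum + d.loops.card using Nat.strong_induction_on generalizing d with
  | _ N ih =>
    rcases Multiset.empty_or_exists_mem d.loops with h0 | ⟨m, hm⟩
    · rw [of_reduce_of_loops_eq_zero d h0, h0]
      simp [loopWeight]
    · obtain ⟨s, hs⟩ := Multiset.exists_cons_of_mem hm
      have hmod := h m hm
      rcases Nat.eq_zero_or_pos m with rfl | hpos
      · let d1 := d.redecorate d.deco s d.deco_mate (fun _ h => h)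
          (fun hz m hm => hz m (by simp [hs, hm]))
        have e1 : PHat.of d = (X : ℤ[X]) • PHat.of d1 := by
          refine (mk_eq (LocalRel.loop d1 d rfl rfl hs)).trans ?_
          rw [map_smul]
          rfl
        rw [e1, ih _ _ d1 (fun m hm => h m (by rw [hs]; exact Multiset.mem_cons_of_mem hm)) rfl,
          hs, smul_smul]
        · congr 1
          simp [loopWeight, d1, redecorate]
        · rw [← hN, hs]
          simp [d1, redecorate]
      · obtain ⟨l, rfl⟩ : ∃ l, m = l + 2 := ⟨m - 2, by omega⟩
        let d1 := d.redecorate d.deco (l ::ₘ s) d.deco_mate (fun _ h => h)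
          (fun hz => by have := hz _ hm; omega)
        have e1 : PHat.of d = PHat.of d1 := mk_eq (LocalRel.cancelLoop d1 d l s rfl rfl rfl hs)
        rw [e1, ih _ _ d1 _ rfl, hs]
        · congr 1
          simp [loopWeight, d1, redecorate]
        · rw [← hN, hs]
          simp [d1, redecorate]
        · intro m hm
          rcases Multiset.mem_cons.1 hm with rfl | hm
          · omega
          · exact h m (by rw [hs]; exact Multiset.mem_cons_of_mem hm)

/-- The defining relation of `LFD` concerns loops with exactly one decoration; cancelling in pairs
brings any odd loop to that form. -/
theorem exists_of_odd (d : LDiagram k) (m : ℕ) (hm : m ∈ d.loops) (h : m % 2 = 1) :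
    ∃ d', 1 ∈ d'.loops ∧ PHat.of d = PHat.of d' := by
  induction m using Nat.strong_induction_on generalizing d with
  | _ m ih =>
    by_cases h1 : m = 1
    · exact ⟨d, h1 ▸ hm, rfl⟩
    · obtain ⟨l, rfl⟩ : ∃ l, m = l + 2 := ⟨m - 2, by omega⟩
      obtain ⟨s, hs⟩ := Multiset.exists_cons_of_mem hm
      let d1 := d.redecorate d.deco (l ::ₘ s) d.deco_mate (fun _ h => h)
        (fun hz => by have := hz _ hm; omega)
      have e1 : PHat.of d = PHat.of d1 := mk_eq (LocalRel.cancelLoop d1 d l s rfl rfl rfl hs)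
      obtain ⟨d', h2, h3⟩ := ih l (by omega) d1 (Multiset.mem_cons_self l s) (by omega)
      exact ⟨d', h2, e1.trans h3⟩

/-- A factorization in the algebra can therefore be checked on arcs and on parities of decorations
only. -/
theorem of_congr {d e : LDiagram k} (h : Arcs.ModTwo d.toArcs e.toArcs 0)
    (he : ∀ m ∈ e.loops, m % 2 = 0) : PHat.of d = PHat.of e := by
  have hd : ∀ m ∈ d.loops, m % 2 = 0 := by
    intro m hm
    have h1 : m % 2 ∈ d.loops.map (· % 2) := Multiset.mem_map_of_mem _ hm
    rw [h.loops, add_zero] at h1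
    obtain ⟨l, h2, h3⟩ := Multiset.mem_map.1 h1
    rw [← h3, he l h2]
  have hw := loopWeight_congr (s := 0) h
  rw [of_eq_of_even d hd, of_eq_of_even e he, reduce_congr h, hw]
  simp [loopWeight]

end PHat

theorem LFD.mk_eq_zero {n : ℕ} (d : LDiagram n) (hd : PHat.of d ∈ DTL n) {m : ℕ}
    (hm : m ∈ d.loops) (h : m % 2 = 1) : LFD.mk ⟨PHat.of d, hd⟩ = 0 := by
  obtain ⟨d', h1, h2⟩ := PHat.exists_of_odd d m hm h
  have : LFD.mk ⟨PHat.of d, hd⟩ = LFD.mk 0 :=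
    RingQuot.mkAlgHom_rel ℤ[X] (s := DecoratedLoopRel n) ⟨⟨d', h1, h2⟩, rfl⟩
  rw [this, map_zero]

/-! ### Parity of the decorations of a product; top-bottom inversion. -/

namespace LDiagram

variable {n : ℕ}

theorem numDeco_mul (d e : LDiagram n) : (d * e).toArcs.numDeco + (d * e).loops.sum =
    (d.toArcs.numDeco + d.loops.sum) + (e.toArcs.numDeco + e.loops.sum) := by
  have h := total_mul d e
  unfold Arcs.total at h
  simp only [← Arcs.two_mul_numDeco] at h
  omega

theorem numDeco_reduce (d : LDiagram n) : d.reduce.toArcs.numDeco % 2 = d.toArcs.numDeco % 2 := by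
  have h1 := d.toArcs.two_mul_numDeco
  have h2 := d.reduce.toArcs.two_mul_numDeco
  have h3 : ∑ v, d.deco v = ∑ v, d.reduce.deco v + 2 * ∑ v, d.deco v / 2 := by
    rw [Finset.mul_sum, ← Finset.sum_add_distrib]
    refine Finset.sum_congr rfl fun v _ => ?_
    rw [reduce_deco]
    omega
  -- Since `numDeco` is half a sum over nodes, that sum is needed modulo 4: the cancelled pairs are
  -- themselves counted at both ends of their edges.
  obtain ⟨c, hc⟩ := d.toArcs.even_sum (fun v => d.deco v / 2) (fun v => by rw [d.deco_mate])
    (fun v hv => absurd hv (d.no_free v))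
  omega

theorem multiset_even_sum {s : Multiset ℕ} (h : ∀ m ∈ s, m % 2 = 0) :
    s.sum % 2 = 0 :=
  Nat.mod_eq_zero_of_dvd (Multiset.dvd_sum fun m hm => Nat.dvd_of_mod_eq_zero (h m hm))

/-- The factors have an even number of decorations in all, and the even loops take away an even
number. -/
theorem IsTypeII.mul_reduce {d e : LDiagram n} (hd : d.IsTypeII) (he : e.IsTypeII)
    (h : ∀ m ∈ (d * e).loops, m % 2 = 0) : (d * e).reduce.IsTypeII where
  loops := rfl
  deco_le := (d * e).reduce_isReduced.2
  even := by
    have h1 := numDeco_mul d e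
    have h2 := numDeco_reduce (d * e)
    have h3 := multiset_even_sum h
    have h4 := hd.even
    have h5 := he.even
    rw [hd.loops, he.loops] at h1
    simp only [Multiset.sum_zero] at h1
    rw [Nat.even_iff] at h4 h5 ⊢
    omega

theorem one_isTypeII : (1 : LDiagram n).IsTypeII where
  loops := rfl
  deco_le v := Nat.zero_le 1
  even := by
    have h : ∀ v, (1 : LDiagram n).deco v = 0 := fun _ => rfl
    simp [Arcs.numDeco, h]

theorem cupCap_isTypeII (i : ℕ) (hi : i + 1 < n) (m : ℕ) (hm : m ≠ 0 → i = 0) (h : m ≤ 1) :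
    (cupCap i hi m hm).IsTypeII where
  loops := rfl
  deco_le := by
    rintro (j | j) <;> simp only [cupCap, Sum.elim_inl, Sum.elim_inr] <;> split_ifs <;> omega
  even := by
    have h1 := (cupCap i hi m hm).toArcs.two_mul_numDeco
    have h2 : ∑ j : Fin n, (if (j : ℕ) = i ∨ (j : ℕ) = i + 1 then m else 0) = 2 * m := by
      have : ∀ j : Fin n, (if (j : ℕ) = i ∨ (j : ℕ) = i + 1 then m else 0) =
          (if j = ⟨i, by omega⟩ then m else 0) + (if j = ⟨i + 1, hi⟩ then m else 0) := by
        intro j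
        simp only [Fin.ext_iff]
        grind
      simp only [this, Finset.sum_add_distrib, Finset.sum_ite_eq', Finset.mem_univ, if_true]
      omega
    have h3 : ∑ v, (cupCap i hi m hm).deco v = 2 * m + 2 * m := by
      rw [Fintype.sum_sum_type]
      simp only [cupCap, Sum.elim_inl, Sum.elim_inr]
      rw [h2]
    rw [Nat.even_iff]
    omega

/-- Top-bottom inversion of two boxes on top of each other. -/
def flipTwo (k : ℕ) : Node k ⊕ Node k → Node k ⊕ Node k := fun v => (Sum.map Sum.swap Sum.swap v).swap

/-- Turning the stacked box upside down exchanges the two boxes and carries each seam to itself with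
its ends interchanged, which is harmless by `Arcs.glue_symm`. -/
theorem flip_mul (d e : LDiagram n) : (d * e).flip = e.flip * d.flip := by
  apply ext_arcs
  have hinv : Function.Involutive (flipTwo n) := by
    rintro ((v | v) | (v | v)) <;> rfl
  have a : Arcs.IsPush (flipTwo n) (d.toArcs.sum e.toArcs) (e.flip.toArcs.sum d.flip.toArcs) := by
    refine ⟨?_, ?_, fun w hw => absurd (hinv.surjective w) hw, add_comm _ _⟩
    · rintro (v | v) <;> simp [flipTwo, Arcs.sum, LDiagram.flip]
    · rintro (v | v) <;> simp [flipTwo, Arcs.sum, LDiagram.flip]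
  have b : ∀ (l : List (Fin n)) (A B : Arcs (Node n ⊕ Node n)), Arcs.IsPush (flipTwo n) A B →
      Arcs.IsPush (flipTwo n) (A.glueList (l.map (seam n))) (B.glueList (l.map (seam n))) := by
    intro l
    induction l with
    | nil => exact fun A B h => h
    | cons i l ih =>
      intro A B h
      refine ih _ _ ?_
      change Arcs.IsPush (flipTwo n) (A.glue (seam n i).1 (seam n i).2)
        (B.glue (seam n i).1 (seam n i).2)
      rw [Arcs.glue_symm B]
      exact h.glue hinv.injective _ _
  have c : Arcs.IsPush Sum.swap (d * e).flip.toArcs (d * e).toArcs := by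
    refine ⟨fun v => ?_, fun v => rfl, fun w hw => absurd ⟨w.swap, Sum.swap_swap w⟩ hw, rfl⟩
    simp [LDiagram.flip]
  have c' := c.trans ((mul_isPush d e).trans (b (List.finRange n) _ _ a))
  have e1 : (flipTwo n ∘ outer) ∘ Sum.swap = outer := by
    funext v
    rcases v with v | v <;> rfl
  rw [e1] at c'
  exact Arcs.IsPush.unique outer_injective c' (mul_isPush e.flip d.flip)

theorem flip_reduce (d : LDiagram n) : d.flip.reduce = d.reduce.flip := rfl

theorem flip_flip (d : LDiagram n) : d.flip.flip = d := by
  refine ext_data ?_ (fun v => ?_) rfl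
  · funext v
    simp [LDiagram.flip]
  · simp [LDiagram.flip]

end LDiagram

end LoopFree

namespace LoopFree

open Polynomial LDiagram

/-! ### Left multiplication by a simple diagram. -/

namespace Arcs

/-- Gluing the two ends of the arc from `x` to `y` to the ends `p` and `q` of two other arcs joins
these two arcs. -/
theorem glue_cap {V : Type*} [DecidableEq V] (A : Arcs V) {x y p q : V} (hxy : A.mate x = y)
    (hne : x ≠ y) (hpx : p ≠ x) (hpy : p ≠ y) (hqx : q ≠ x) (hqy : q ≠ y) (hpq : p ≠ q)
    (hp : A.mate p ≠ p) (hq : A.mate q ≠ q) (hpq' : A.mate p ≠ q) :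
    (∀ v, ((A.glue x p).glue y q).mate v = if v = x ∨ v = y ∨ v = p ∨ v = q then v
      else if v = A.mate p then A.mate q else if v = A.mate q then A.mate p else A.mate v) ∧
    (∀ v, ((A.glue x p).glue y q).deco v = if v = x ∨ v = y ∨ v = p ∨ v = q then 0
      else if v = A.mate p ∨ v = A.mate q then A.deco x + A.deco p + A.deco q else A.deco v) ∧
    ((A.glue x p).glue y q).loops = A.loops := by
  have hm := A.mate_mate
  have mx := hm x
  have mp := hm p
  have mq := hm q
  have h1 : A.Gluable x p := ⟨hpx.symm, by rw [hxy]; exact hne.symm, hp⟩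
  have g1 := glue_mate A x p h1
  have k1 := glue_deco A x p h1
  have l1 := glue_loops A x p h1
  -- After the first gluing the cap is part of a longer arc from `y` to the far end of the arc at
  -- `p`; the second gluing extends it beyond `q`.
  have hy : (A.glue x p).mate y = A.mate p := by
    rw [g1]
    grind
  have hq' : (A.glue x p).mate q = A.mate q := by
    rw [g1]
    grind
  have h2 : (A.glue x p).Gluable y q := ⟨hqy.symm, by rw [hy]; grind, by rwa [hq']⟩
  refine ⟨fun v => ?_, fun v => ?_, ?_⟩
  · rw [glue_mate _ y q h2, hy, hq', g1]
    have := hm v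
    grind
  · rw [glue_deco _ y q h2, hy, hq', k1, k1, k1]
    have := hm v
    grind
  · rw [glue_loops _ y q h2, hy, l1]
    grind

end Arcs

namespace LDiagram

variable {n : ℕ}

/-- The seams have disjoint ends, so their gluings commute. This allows the two seams at the cap to
be treated before the vertical strands. -/
theorem glueList_seam_perm (A : Arcs (Node n ⊕ Node n)) {l m : List (Fin n)} (h : l.Perm m)
    (hl : l.Nodup) : A.glueList (l.map (seam n)) = A.glueList (m.map (seam n)) := by
  induction h generalizing A with
  | nil => rfl
  | cons i h ih => exact ih _ (List.nodup_cons.1 hl).2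
  | swap i j l =>
    have hij : i ≠ j := by
      rintro rfl
      simp at hl
    simp only [List.map_cons, Arcs.glueList_cons]
    rw [Arcs.glue_comm] <;> simp [seam, hij.symm]
  | trans h1 h2 ih1 ih2 => exact (ih1 A hl).trans (ih2 A (h1.nodup_iff.1 hl))

/-- Gluing undecorated vertical strands onto the nodes in `l` just renames these nodes. -/
theorem glueList_strands (E : Arcs (Node n)) (hE : ∀ v, E.mate v ≠ v) (l : List (Fin n))
    (hl : l.Nodup) (A : Arcs (Node n ⊕ Node n)) (ρ : Node n → Node n ⊕ Node n)
    (hρ : ∀ v, ρ v = if ∃ i ∈ l, v = Sum.inl i then Sum.inr v else outer v)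
    (hm : ∀ u, A.mate (ρ u) = ρ (E.mate u)) (hd : ∀ u, A.deco (ρ u) = E.deco u)
    (hs : ∀ i ∈ l, A.mate (Sum.inl (Sum.inr i)) = Sum.inl (Sum.inl i) ∧
      A.deco (Sum.inl (Sum.inr i)) = 0)
    (hf : ∀ i ∉ l, A.mate (seam n i).1 = (seam n i).1 ∧ A.mate (seam n i).2 = (seam n i).2)
    (hL : A.loops = E.loops) :
    Arcs.IsPush outer E (A.glueList (l.map (seam n))) := by
  induction l generalizing A ρ with
  | nil =>
    have : ρ = outer := by funext v; simp [hρ]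
    subst this
    refine ⟨hm, hd, ?_, hL⟩
    rintro ((i | i) | (i | i)) hw
    · exact absurd ⟨Sum.inl i, rfl⟩ hw
    · exact (hf i (by simp)).1
    · exact (hf i (by simp)).2
    · exact absurd ⟨Sum.inr i, rfl⟩ hw
  | cons i l ih =>
    rw [List.nodup_cons] at hl
    have hq : (seam n i).2 = ρ (Sum.inl i) := by
      rw [hρ, if_pos ⟨i, by simp, rfl⟩]; rfl
    have inj : Function.Injective ρ := by
      refine Function.LeftInverse.injective (g := Sum.elim id id) fun v => ?_
      rw [hρ]
      split_ifs
      · rfl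
      · rcases v with v | v <;> rfl
    have n1 : ∀ j u, ρ u ≠ Sum.inl (Sum.inr j) := by
      rintro j (a | a) <;> rw [hρ] <;> split_ifs <;> simp [outer]
    have n2 : ∀ u, ρ u ≠ Sum.inl (Sum.inl i) := by
      intro u hu
      by_cases h : ∃ j ∈ i :: l, u = Sum.inl j
      · rw [hρ, if_pos h] at hu
        simp at hu
      · rw [hρ, if_neg h] at hu
        exact h ⟨i, by simp, outer_injective (hu.trans rfl)⟩
    have hsi := hs i (by simp)
    obtain ⟨h1, h2, h3⟩ := Arcs.glue_strand E A ρ (Sum.inl i) (seam n i).1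
      (Sum.inl (Sum.inl i)) (hE _) inj (by simp [seam]) (n1 i) n2 hsi.1 hsi.2 hm hd
    rw [← hq] at h1 h2 h3
    have hok : A.Gluable (seam n i).1 (seam n i).2 := by
      refine ⟨by simp [seam], ?_, ?_⟩
      · rw [seam, hsi.1]; simp
      · rw [hq, hm]
        exact fun h => hE _ (inj h)
    refine ih hl.2 _ (Function.update ρ (Sum.inl i) (Sum.inl (Sum.inl i))) ?_ h1 h2 ?_ ?_
      (h3.trans hL)
    · intro v
      by_cases hv : v = Sum.inl i
      · subst hv
        simp [hl.1, outer]
      · rw [Function.update_of_ne hv, hρ]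
        simp [hv]
    · intro j hj
      have hji : j ≠ i := fun h => hl.1 (h ▸ hj)
      have hj' := hs j (by simp [hj])
      constructor
      · rw [Arcs.glue_keep, hj'.1] <;> simp [seam, hji, hj'.1]
      · rw [Arcs.glue_keep_deco, hj'.2] <;> simp [seam, hji, hj'.1]
    · intro j hj
      rw [Arcs.glue_free _ _ _ _ hok, Arcs.glue_free _ _ _ _ hok]
      by_cases hji : j = i
      · subst hji; simp
      · have := hf j (by simp [hji, hj])
        simp [this]

/-- Cut off the arcs at `p` and `q`, join their other ends to each other, and join `p` to `q` by an
arc with `m` decorations. -/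
def capJoin (E : Arcs (Node n)) (p q : Node n) (m : ℕ) (hp : E.mate p ≠ p) (hq : E.mate q ≠ q)
    (hpq : p ≠ q) (hne : E.mate p ≠ q) : Arcs (Node n) where
  mate v := if v = p then q else if v = q then p else if v = E.mate p then E.mate q else
    if v = E.mate q then E.mate p else E.mate v
  deco v := if v = p ∨ v = q then m else if v = E.mate p ∨ v = E.mate q then
    m + E.deco p + E.deco q else E.deco v
  loops := E.loops
  mate_mate v := by
    have := E.mate_mate v
    have := E.mate_mate p
    have := E.mate_mate q
    grind
  deco_mate v := by
    have := E.mate_mate v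
    have := E.mate_mate p
    have := E.mate_mate q
    have := E.deco_mate v
    grind
  deco_free v := by
    have := E.mate_mate v
    have := E.mate_mate p
    have := E.mate_mate q
    have := E.deco_free v
    grind

/-- Putting a diagram with an arc between `i0` and `i1` in each face, and undecorated vertical strands
elsewhere, on top of `d`. -/
theorem mul_eq_capJoin (g d : LDiagram n) {i0 i1 : Fin n} {m : ℕ} (h01 : i0 ≠ i1)
    (g1 : g.mate (Sum.inl i0) = Sum.inl i1) (g3 : g.mate (Sum.inr i0) = Sum.inr i1)
    (g5 : ∀ j, j ≠ i0 → j ≠ i1 → g.mate (Sum.inr j) = Sum.inl j)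
    (k1 : g.deco (Sum.inl i0) = m) (k3 : g.deco (Sum.inr i0) = m)
    (k5 : ∀ j, j ≠ i0 → j ≠ i1 → g.deco (Sum.inr j) = 0) (gl : g.loops = 0)
    (hne : d.mate (Sum.inl i0) ≠ Sum.inl i1) :
    (g * d).toArcs = capJoin d.toArcs (Sum.inl i0) (Sum.inl i1) m
      (d.no_free _) (d.no_free _) (by simpa using h01) hne := by
  have dm := d.mate_mate
  have g2 : g.mate (Sum.inl i1) = Sum.inl i0 := by rw [← g1, g.mate_mate]
  have k2 : g.deco (Sum.inl i1) = m := by rw [← g1, g.deco_mate, k1]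
  obtain ⟨c1, c2, c3⟩ := Arcs.glue_cap (g.toArcs.sum d.toArcs) (x := (seam n i0).1)
    (y := (seam n i1).1) (p := (seam n i0).2) (q := (seam n i1).2) (by simp [seam, Arcs.sum, g3])
    (by simpa [seam] using h01) (by simp [seam]) (by simp [seam]) (by simp [seam]) (by simp [seam])
    (by simpa [seam] using h01) (by simp [seam, Arcs.sum, d.no_free])
    (by simp [seam, Arcs.sum, d.no_free]) (by simpa [seam, Arcs.sum] using hne)
  have hperm : (List.finRange n).Perm (i0 :: i1 :: ((List.finRange n).erase i0).erase i1) := by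
    refine (List.perm_cons_erase (List.mem_finRange i0)).trans (List.Perm.cons _ ?_)
    exact List.perm_cons_erase
      ((List.mem_erase_of_ne h01.symm).2 (List.mem_finRange i1))
  have hnd : (((List.finRange n).erase i0).erase i1).Nodup :=
    ((List.nodup_finRange n).erase _).erase _
  have hmem : ∀ j, j ∈ ((List.finRange n).erase i0).erase i1 ↔ j ≠ i0 ∧ j ≠ i1 := by
    intro j
    rw [((List.nodup_finRange n).erase _).mem_erase_iff, (List.nodup_finRange n).mem_erase_iff]
    simp
    tauto
  refine Arcs.IsPush.unique outer_injective (mul_isPush g d) ?_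
  unfold stack
  rw [glueList_seam_perm _ hperm (List.nodup_finRange n)]
  simp only [List.map_cons, Arcs.glueList_cons]
  -- After the two seams at the cap are glued, the nodes `i0` and `i1` of the product are already on
  -- the upper face of the upper box; all others are still nodes of the lower box, awaiting the
  -- strands.
  refine glueList_strands _ ?_ _ hnd _
    (fun v => if v = Sum.inl i0 ∨ v = Sum.inl i1 then Sum.inl v else Sum.inr v) ?_ ?_ ?_ ?_ ?_ ?_
  · intro v
    have := d.no_free v
    have := dm v
    have := dm (Sum.inl i0)
    have := dm (Sum.inl i1)
    simp only [capJoin]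
    grind
  · rintro (j | j)
    · by_cases hj : j = i0 ∨ j = i1
      · have : ¬ ∃ i ∈ ((List.finRange n).erase i0).erase i1, (Sum.inl j : Node n) = Sum.inl i := by
          rintro ⟨i, h1, h2⟩
          rw [hmem, ← Sum.inl_injective h2] at h1
          tauto
        rw [if_neg this, if_pos (by simpa using hj)]
        rfl
      · rw [if_neg (by simpa using hj), if_pos ⟨j, (hmem j).2 (by tauto), rfl⟩]
    · simp [outer]
  · intro u
    have := dm u
    have := dm (Sum.inl i0)
    have := dm (Sum.inl i1)
    have := d.no_free (Sum.inl i0)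
    have := d.no_free (Sum.inl i1)
    rw [c1]
    simp only [capJoin, seam, Arcs.sum]
    by_cases hu0 : u = Sum.inl i0
    · subst hu0
      simp [g1]
    by_cases hu1 : u = Sum.inl i1
    · subst hu1
      simp [g2, h01.symm]
    simp only [hu0, hu1, or_self, if_false, reduceCtorEq, Sum.inr.injEq, Sum.map_inr]
    grind
  · intro u
    rw [c2]
    simp only [capJoin, seam, Arcs.sum]
    by_cases hu0 : u = Sum.inl i0
    · subst hu0
      simp [k1]
    by_cases hu1 : u = Sum.inl i1
    · subst hu1
      simp [k2]
    simp only [hu0, hu1, or_self, if_false, reduceCtorEq, Sum.inr.injEq, Sum.map_inr,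
      Sum.elim_inl, Sum.elim_inr, k3]
  · intro j hj
    rw [hmem] at hj
    rw [c1, c2]
    simp [seam, Arcs.sum, hj.1, hj.2, g5 j hj.1 hj.2, k5 j hj.1 hj.2]
  · intro j hj
    rw [hmem] at hj
    have : j = i0 ∨ j = i1 := by tauto
    rw [c1, c1]
    rcases this with rfl | rfl <;> simp
  · rw [c3]
    simp [capJoin, Arcs.sum, gl]

theorem cupCap_mul (i : ℕ) (hi : i + 1 < n) (m : ℕ) (hm : m ≠ 0 → i = 0) (d : LDiagram n)
    (hne : d.mate (Sum.inl ⟨i, by omega⟩) ≠ Sum.inl ⟨i + 1, hi⟩) :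
    (cupCap i hi m hm * d).toArcs = capJoin d.toArcs (Sum.inl ⟨i, by omega⟩) (Sum.inl ⟨i + 1, hi⟩) m
      (d.no_free _) (d.no_free _) (by simp) hne := by
  refine mul_eq_capJoin _ d (by simp) (by simp [cupCap]) (by simp [cupCap]) ?_ (by simp [cupCap])
    (by simp [cupCap]) ?_ rfl hne
  all_goals
    intro j h1 h2
    have : (j : ℕ) ≠ i := fun h => h1 (Fin.ext h)
    have : (j : ℕ) ≠ i + 1 := fun h => h2 (Fin.ext h)
    simp [cupCap, *]

end LDiagram

end LoopFree

namespace LoopFree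

open Polynomial LDiagram

/-! ### Rerouting a short arc. -/

namespace LDiagram

variable {n : ℕ}

/-- Rerouting affects only the four nodes `p`, `q`, `a`, `b`; this compares the decoration counts
and the costs without subtraction. -/
theorem sum_add_of_eq_off_four {V : Type*} [Fintype V] [DecidableEq V] {f g : V → ℕ} {p q a b : V}
    (hpq : p ≠ q) (hpa : p ≠ a) (hpb : p ≠ b) (hqa : q ≠ a) (hqb : q ≠ b) (hab : a ≠ b)
    (h : ∀ v, v ≠ p → v ≠ q → v ≠ a → v ≠ b → f v = g v) :
    ∑ v, f v + (g p + g q + g a + g b) = ∑ v, g v + (f p + f q + f a + f b) := by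
  have key : ∀ v, f v + (if v = p then g p else 0) + (if v = q then g q else 0) +
      (if v = a then g a else 0) + (if v = b then g b else 0) =
      g v + (if v = p then f p else 0) + (if v = q then f q else 0) +
      (if v = a then f a else 0) + (if v = b then f b else 0) := by
    intro v
    have := h v
    grind
  have := Finset.sum_congr rfl fun v (_ : v ∈ Finset.univ) => key v
  simp only [Finset.sum_add_distrib, Finset.sum_ite_eq', Finset.mem_univ, if_true] at this
  linarith

/-- Planarity makes the bijection given by the propagating edges increasing, and the only increasing
bijection of a finite chain is the identity. The decorations vanish by the last axiom of diagrams.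
-/
theorem eq_one_of_no_north {d : LDiagram n} (h : ∀ i j, d.mate (Sum.inl i) ≠ Sum.inl j)
    (hl : d.loops = 0) : d = 1 := by
  have h1 : ∀ i, ∃ j, d.mate (Sum.inl i) = Sum.inr j := by
    intro i
    rcases h' : d.mate (Sum.inl i) with j | j
    · exact absurd h' (h i j)
    · exact ⟨j, rfl⟩
  choose f hf using h1
  have finj : ∀ i j, f i = f j → i = j := by
    intro i j hij
    have : d.mate (Sum.inl i) = d.mate (Sum.inl j) := by rw [hf, hf, hij]
    have := congrArg d.mate this
    rw [d.mate_mate, d.mate_mate] at this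
    exact Sum.inl_injective this
  have fmono : StrictMono f := by
    intro i j hij
    have h2 := d.planar (Sum.inl i) (Sum.inl j)
    rw [hf, hf] at h2
    simp only [pos_inl, pos_inr] at h2
    have h3 : (f i : ℕ) ≠ f j := fun h => (ne_of_lt hij) (finj i j (Fin.ext h))
    have : (i : ℕ) < j := hij
    change (f i : ℕ) < f j
    omega
  have fid : ∀ i, f i = i := by
    have hs : Function.Surjective f := Finite.injective_iff_surjective.1 fmono.injective
    let e : Fin n ≃o Fin n := StrictMono.orderIsoOfSurjective f fmono hs
    intro i
    have : e = OrderIso.refl _ := Subsingleton.elim _ _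
    exact congrArg (fun g : Fin n ≃o Fin n => g i) this
  refine ext_data ?_ (fun v => ?_) hl
  · funext v
    change d.mate v = v.swap
    rcases v with i | i
    · rw [hf, fid]
      rfl
    · have := hf i
      rw [fid] at this
      have h2 := d.mate_mate (Sum.inl i)
      rw [this] at h2
      exact h2
  · exact (d.undecorated h).1 v

/-- The data for rerouting the arc `{p, q}` joining neighbours and the arc `{a, b}` into arcs `{p, a}`
and `{q, b}`. -/
structure CanReroute (d : LDiagram n) (p q a b : Node n) : Prop where
  mate_p : d.mate p = q
  mate_a : d.mate a = b
  deco_p : d.deco p = 0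
  succ : pos q = pos p + 1
  ne_p : a ≠ p
  ne_q : a ≠ q
  order : (pos a < pos p ∧ pos q < pos b) ∨ (pos q < pos b ∧ pos b < pos a)
  visible : ∀ u, u ≠ p → u ≠ q → u ≠ a → u ≠ b →
    ((pos u < pos p ∧ pos p < pos (d.mate u)) ↔ (pos u < pos a ∧ pos a < pos (d.mate u)))
  visible' : ∀ u, u ≠ p → u ≠ q → u ≠ a → u ≠ b →
    ((pos u < pos p ∧ pos p < pos (d.mate u)) ↔ (pos u < pos b ∧ pos b < pos (d.mate u)))
  clear : ∀ v, d.deco v ≠ 0 → v ≠ a → v ≠ b → ¬ (pos q < pos v ∧ pos v < pos a)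

/-- The other end of the edge at `v` after rerouting. -/
def rerouteMate (d : LDiagram n) (p q a b v : Node n) : Node n :=
  if v = p then a else if v = a then p else if v = q then b else if v = b then q else d.mate v

/-- The decorations after rerouting. -/
def rerouteDeco (d : LDiagram n) (p q a b v : Node n) : ℕ :=
  if v = p ∨ v = a then d.deco a else if v = q ∨ v = b then 0 else d.deco v

namespace CanReroute

variable {d : LDiagram n} {p q a b : Node n}

theorem mate_q (h : CanReroute d p q a b) : d.mate q = p := by rw [← h.mate_p, d.mate_mate]

theorem mate_b (h : CanReroute d p q a b) : d.mate b = a := by rw [← h.mate_a, d.mate_mate]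

theorem distinct (h : CanReroute d p q a b) : p ≠ q ∧ p ≠ a ∧ p ≠ b ∧ q ≠ a ∧ q ≠ b ∧ a ≠ b := by
  have h1 := h.mate_p
  have h2 := h.mate_a
  have h3 := h.mate_q
  have h4 := h.mate_b
  have h5 := h.ne_p
  have h6 := h.ne_q
  have h7 := d.no_free p
  have h8 := d.no_free a
  grind

/-- All information about an edge is put into inequalities between positions, so that planarity and
exposure of the rerouted diagram become linear arithmetic. -/
theorem cases (h : CanReroute d p q a b) (u : Node n) :
    (pos u = pos p ∧ pos (rerouteMate d p q a b u) = pos a ∧ rerouteDeco d p q a b u = d.deco a) ∨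
    (pos u = pos a ∧ pos (rerouteMate d p q a b u) = pos p ∧ rerouteDeco d p q a b u = d.deco a) ∨
    (pos u = pos q ∧ pos (rerouteMate d p q a b u) = pos b ∧ rerouteDeco d p q a b u = 0) ∨
    (pos u = pos b ∧ pos (rerouteMate d p q a b u) = pos q ∧ rerouteDeco d p q a b u = 0) ∨
    ((u ≠ p ∧ u ≠ q ∧ u ≠ a ∧ u ≠ b) ∧ rerouteMate d p q a b u = d.mate u ∧
      rerouteDeco d p q a b u = d.deco u ∧ pos u ≠ pos p ∧ pos u ≠ pos q ∧ pos u ≠ pos a ∧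
      pos u ≠ pos b ∧ pos (d.mate u) ≠ pos p ∧ pos (d.mate u) ≠ pos q ∧ pos (d.mate u) ≠ pos a ∧
      pos (d.mate u) ≠ pos b ∧ pos (rerouteMate d p q a b u) = pos (d.mate u) ∧
      ((pos u < pos p ∧ pos p < pos (d.mate u)) ↔ (pos u < pos a ∧ pos a < pos (d.mate u))) ∧
      ((pos u < pos p ∧ pos p < pos (d.mate u)) ↔ (pos u < pos b ∧ pos b < pos (d.mate u)))) := by
  obtain ⟨h1, h2, h3, h4, h5, h6⟩ := h.distinct
  have m1 := h.mate_p
  have m2 := h.mate_q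
  have m3 := h.mate_a
  have m4 := h.mate_b
  have m5 := d.mate_mate u
  unfold rerouteMate rerouteDeco
  by_cases e1 : u = p
  · subst e1
    simp
  by_cases e2 : u = a
  · subst e2
    simp [e1]
  by_cases e3 : u = q
  · subst e3
    simp [e1, e2]
  by_cases e4 : u = b
  · subst e4
    simp [e1, e2, e3]
  have v1 := h.visible u e1 e3 e2 e4
  have v2 := h.visible' u e1 e3 e2 e4
  have i : ∀ {v w : Node n}, v ≠ w → pos v ≠ pos w := fun h => pos_injective.ne h
  have : d.mate u ≠ p := fun e => e3 (by rw [← m5, e, m1])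
  have : d.mate u ≠ q := fun e => e1 (by rw [← m5, e, m2])
  have : d.mate u ≠ a := fun e => e4 (by rw [← m5, e, m3])
  have : d.mate u ≠ b := fun e => e2 (by rw [← m5, e, m4])
  simp only [e1, e2, e3, e4, if_false, or_self, ne_eq, not_false_eq_true, and_self, true_and]
  refine Or.inr (Or.inr (Or.inr (Or.inr ?_)))
  exact ⟨i e1, i e3, i e2, i e4, i ‹_›, i ‹_›, i ‹_›, i ‹_›, v1, v2⟩

theorem rerouteMate_mate (h : CanReroute d p q a b) (v : Node n) :
    rerouteMate d p q a b (rerouteMate d p q a b v) = v := by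
  obtain ⟨h1, h2, h3, h4, h5, h6⟩ := h.distinct
  have m1 := h.mate_p
  have m2 := h.mate_q
  have m3 := h.mate_a
  have m4 := h.mate_b
  have m5 := d.mate_mate v
  unfold rerouteMate
  grind

theorem rerouteDeco_mate (h : CanReroute d p q a b) (v : Node n) :
    rerouteDeco d p q a b (rerouteMate d p q a b v) = rerouteDeco d p q a b v := by
  obtain ⟨h1, h2, h3, h4, h5, h6⟩ := h.distinct
  have m1 := h.mate_p
  have m2 := h.mate_q
  have m3 := h.mate_a
  have m4 := h.mate_b
  have m5 := d.mate_mate v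
  have m6 := d.deco_mate v
  unfold rerouteMate rerouteDeco
  grind

theorem rerouteMate_ne (h : CanReroute d p q a b) (v : Node n) : rerouteMate d p q a b v ≠ v := by
  obtain ⟨h1, h2, h3, h4, h5, h6⟩ := h.distinct
  have m5 := d.no_free v
  unfold rerouteMate
  grind

theorem planar (h : CanReroute d p q a b) (u v : Node n) :
    ¬ (pos u < pos v ∧ pos v < pos (rerouteMate d p q a b u) ∧
      pos (rerouteMate d p q a b u) < pos (rerouteMate d p q a b v)) := by
  have o := h.order
  have s := h.succ
  -- Only the case of two unaffected edges needs the planarity of `d`; for the others `visible` and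
  -- `visible'` say that an old edge passes over all four nodes or over none.
  rcases h.cases u with hu | hu | hu | hu | hu <;> rcases h.cases v with hv | hv | hv | hv | hv
  all_goals try omega
  rw [hu.2.1, hv.2.1]
  exact d.planar u v

/-- If `{q, b}` comes to lie under `{p, a}`, it is the undecorated one of the two; other decorated
edges are kept from under `{p, a}` by `clear`. -/
theorem exposed (h : CanReroute d p q a b) (v : Node n) (hv : rerouteDeco d p q a b v ≠ 0)
    (u : Node n) :
    ¬ (pos u < pos v ∧ pos v < pos (rerouteMate d p q a b u)) := by
  have o := h.order
  have s := h.succ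
  have ea : d.deco a ≠ 0 → ∀ u, ¬ (pos u < pos a ∧ pos a < pos (d.mate u)) := d.exposed a
  have ma := h.mate_a
  have mb := h.mate_b
  rcases h.cases v with hv' | hv' | hv' | hv' | hv'
  · rw [hv'.2.2] at hv
    rcases h.cases u with hu | hu | hu | hu | hu
    all_goals try omega
    have := ea hv u
    rw [hu.2.1]
    omega
  · rw [hv'.2.2] at hv
    rcases h.cases u with hu | hu | hu | hu | hu
    all_goals try omega
    have := ea hv u
    rw [hu.2.1]
    omega
  · exact absurd hv'.2.2 hv
  · exact absurd hv'.2.2 hv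
  · rw [hv'.2.2.1] at hv
    have e := d.exposed v hv
    have ea' := e a
    have eb' := e b
    rw [ma] at ea'
    rw [mb] at eb'
    have c := h.clear v hv hv'.1.2.2.1 hv'.1.2.2.2
    rcases h.cases u with hu | hu | hu | hu | hu
    all_goals try omega
    rw [hu.2.1]
    exact e u

theorem sum_deco (h : CanReroute d p q a b) : ∑ v, rerouteDeco d p q a b v = ∑ v, d.deco v := by
  obtain ⟨h1, h2, h3, h4, h5, h6⟩ := h.distinct
  have := sum_add_of_eq_off_four (f := rerouteDeco d p q a b) (g := d.deco) h1 h2 h3 h4 h5 h6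
    (fun v e1 e2 e3 e4 => by simp [rerouteDeco, e1, e2, e3, e4])
  have k1 : d.deco q = 0 := by rw [← h.mate_p, d.deco_mate, h.deco_p]
  have k2 : d.deco b = d.deco a := by rw [← h.mate_a, d.deco_mate]
  have k3 : rerouteDeco d p q a b p = d.deco a := by simp [rerouteDeco]
  have k4 : rerouteDeco d p q a b a = d.deco a := by simp [rerouteDeco]
  have k5 : rerouteDeco d p q a b q = 0 := by simp [rerouteDeco, h1.symm, h4]
  have k6 : rerouteDeco d p q a b b = 0 := by simp [rerouteDeco, h3.symm, h6.symm]
  have k7 := h.deco_p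
  omega

end CanReroute

/-- If all edges are propagating, at most one of them is exposed; so an even number of decorations
is zero. -/
theorem undecorated_of_no_north {A : Arcs (Node n)} (hf : ∀ v, A.mate v ≠ v)
    (he : A.Exposed pos)
    (h1 : ∀ v, A.deco v ≤ 1) (h2 : Even A.numDeco) (hN : ∀ i j, A.mate (Sum.inl i) ≠ Sum.inl j)
    (v : Node n) : A.deco v = 0 := by
  have hS := no_south_of_no_north hN
  by_contra hv
  have hu : ∀ u, u ≠ v → u ≠ A.mate v → A.deco u = 0 := by
    -- A propagating edge further left separates every later north node from the left wall.
    have key : ∀ i j, A.deco (Sum.inl i) ≠ 0 → A.deco (Sum.inl j) ≠ 0 → ¬ i < j := by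
      intro i j h3 h4 hij
      have e := he (Sum.inl j) h4 (Sum.inl i)
      rcases hi : A.mate (Sum.inl i) with k | k
      · exact hN i k hi
      · rw [hi] at e
        simp only [pos_inl, pos_inr] at e
        have : (i : ℕ) < j := hij
        omega
    have key' : ∀ u : Node n, ∃ i, Sum.inl i = u ∨ Sum.inl i = A.mate u := by
      rintro (i | i)
      · exact ⟨i, Or.inl rfl⟩
      · rcases hi : A.mate (Sum.inr i) with k | k
        · exact ⟨k, Or.inr rfl⟩
        · exact absurd hi (hS i k)
    intro u h3 h4
    by_contra h5
    obtain ⟨i, hi⟩ := key' u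
    obtain ⟨j, hj⟩ := key' v
    have k1 : A.deco (Sum.inl i) ≠ 0 := by
      rcases hi with hi | hi <;> rw [hi]
      · exact h5
      · rwa [A.deco_mate]
    have k2 : A.deco (Sum.inl j) ≠ 0 := by
      rcases hj with hj | hj <;> rw [hj]
      · exact hv
      · rwa [A.deco_mate]
    have k3 : i = j := le_antisymm (not_lt.1 (key j i k2 k1)) (not_lt.1 (key i j k1 k2))
    subst k3
    have m1 := A.mate_mate u
    have m2 := A.mate_mate v
    grind
  -- A single decoration, seen at the two ends of its edge, contradicts evenness.
  have h3 : ∑ u, A.deco u = 2 := by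
    have : ∀ u, A.deco u = (if u = v then 1 else 0) + (if u = A.mate v then 1 else 0) := by
      intro u
      have a1 := hu u
      have a2 := h1 v
      have a3 := A.deco_mate v
      have a4 := hf v
      by_cases e1 : u = v
      · subst e1
        rw [if_pos rfl, if_neg (Ne.symm a4)]
        omega
      · by_cases e2 : u = A.mate v
        · rw [if_neg e1, if_pos e2, e2]
          omega
        · rw [if_neg e1, if_neg e2]
          exact a1 e1 e2
    simp only [this, Finset.sum_add_distrib, Finset.sum_ite_eq', Finset.mem_univ, if_true]
  have h4 := A.two_mul_numDeco
  rw [h3] at h4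
  rw [Nat.even_iff] at h2
  omega

/-- Reroute the arcs `{p, q}` and `{a, b}` into `{p, a}` and `{q, b}`. -/
def reroute (d : LDiagram n) (hd : d.IsTypeII) (p q a b : Node n) (h : CanReroute d p q a b) :
    LDiagram n where
  mate := rerouteMate d p q a b
  deco := rerouteDeco d p q a b
  loops := 0
  mate_mate := h.rerouteMate_mate
  deco_mate := h.rerouteDeco_mate
  deco_free v hv := absurd hv (h.rerouteMate_ne v)
  no_free := h.rerouteMate_ne
  planar := h.planar
  exposed := h.exposed
  undecorated hN := by
    refine ⟨undecorated_of_no_north h.rerouteMate_ne h.exposed (fun v => ?_) ?_ hN, by simp⟩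
    · have := hd.deco_le v
      have := hd.deco_le a
      simp only [rerouteDeco]
      split_ifs <;> omega
    · have e := hd.even
      unfold Arcs.numDeco at e ⊢
      rwa [h.sum_deco]

theorem reroute_isTypeII {d : LDiagram n} (hd : d.IsTypeII) {p q a b : Node n}
    (h : CanReroute d p q a b) : (d.reroute hd p q a b h).IsTypeII where
  loops := rfl
  deco_le v := by
    have := hd.deco_le v
    have := hd.deco_le a
    simp only [reroute, rerouteDeco]
    split_ifs <;> omega
  even := by
    have e := hd.even
    unfold Arcs.numDeco at e ⊢
    have := h.sum_deco
    change Even ((∑ v, rerouteDeco d p q a b v) / 2)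
    rwa [this]

end LDiagram

end LoopFree

namespace LoopFree

open Polynomial LDiagram

/-! ### Horizontal extent and the choice of the edge to reroute. -/

namespace LDiagram

variable {n : ℕ}

/-- The column of a node. -/
def col : Node n → ℕ := Sum.elim (fun i => (i : ℕ)) (fun i => (i : ℕ))

/-- Along the boundary, the nodes to the right of a vertical line form an interval. -/
theorem le_col_iff {i : ℕ} (hi : i + 1 < n) (v : Node n) :
    i + 1 ≤ col v ↔ i + 1 ≤ pos v ∧ pos v ≤ 2 * n - 2 - i := by
  rcases v with j | j
  · simp only [col, pos_inl, Sum.elim_inl]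
    omega
  · simp only [col, pos_inr, Sum.elim_inr]
    omega

/-- An edge other than `{i, i + 1}` crosses the vertical line between these two columns. -/
theorem exists_crossing (d : LDiagram n) {i : ℕ} {p q : Node n}
    (hp : col p = i) (hq : col q = i + 1) (hpq : d.mate p = q) :
    ∃ v, v ≠ q ∧ i + 1 ≤ col v ∧ col (d.mate v) ≤ i := by
  by_contra hcon
  push Not at hcon
  have hqp : d.mate q = p := by rw [← hpq, d.mate_mate]
  -- Without a crossing edge, the nodes other than `q` to the right of the line would be paired
  -- among themselves. But the two faces contribute equally many nodes there, and `q` is left out.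
  obtain ⟨c, hc⟩ := d.toArcs.even_sum (fun v => if v ≠ q ∧ i + 1 ≤ col v then 1 else 0)
    (fun v => by
      have h1 := hcon v
      have h2 := hcon (d.mate v)
      have h3 := d.mate_mate v
      have h4 : d.mate v = q → v = p := fun h => by rw [← h3, h, hqp]
      have h5 : v = q → d.mate v = p := fun h => by rw [h, hqp]
      have h6 : v = p → ¬ i + 1 ≤ col v := fun h => by rw [h]; omega
      have h7 : d.mate v = p → ¬ i + 1 ≤ col (d.mate v) := fun h => by rw [h]; omega
      rw [h3] at h2
      grind)
    (fun v hv => absurd hv (d.no_free v))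
  have h1 : ∀ v : Node n, (if v ≠ q ∧ i + 1 ≤ col v then 1 else 0) + (if v = q then 1 else 0) =
      if i + 1 ≤ col v then 1 else 0 := by
    intro v
    grind
  have h2 := Finset.sum_congr rfl fun v (_ : v ∈ Finset.univ) => h1 v
  rw [Finset.sum_add_distrib, hc, Finset.sum_ite_eq', if_pos (Finset.mem_univ q),
    Fintype.sum_sum_type] at h2
  simp only [col, Sum.elim_inl, Sum.elim_inr] at h2
  have h3 : ∀ s : ℕ, c + c + 1 ≠ s + s := by omega
  exact h3 _ h2

/-- A decorated edge is thought of as touching the left wall, so an edge with a node on the right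
crosses the line if it is decorated or ends on the left. The first such node met after `q` along the
boundary is `b`; up to there all edges are undecorated and stay on the right, so nothing obstructs
the rerouting. -/
theorem exists_canReroute (d : LDiagram n) {i : ℕ} (hi : i + 1 < n) {p q : Node n}
    (hp : p = Sum.inl ⟨i, by omega⟩) (hq : q = Sum.inl ⟨i + 1, hi⟩) (hpq : d.mate p = q)
    (h0 : d.deco p = 0) : ∃ a b, CanReroute d p q a b ∧ i + 1 ≤ col b ∧
      (d.deco a ≠ 0 ∨ col a ≤ i) := by
  have cp : col p = i := by rw [hp]; rfl
  have cq : col q = i + 1 := by rw [hq]; rfl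
  have pp : pos p = i := by rw [hp]; rfl
  have pq : pos q = i + 1 := by rw [hq]; rfl
  have hqp : d.mate q = p := by rw [← hpq, d.mate_mate]
  have inj : ∀ {v w : Node n}, pos v = pos w → v = w := fun h => pos_injective h
  let s : Finset (Node n) := Finset.univ.filter fun v =>
    v ≠ q ∧ i + 1 ≤ col v ∧ (col (d.mate v) ≤ i ∨ d.deco v ≠ 0)
  have hs : s.Nonempty := by
    obtain ⟨v, h1, h2, h3⟩ := d.exists_crossing cp cq hpq
    exact ⟨v, Finset.mem_filter.2 ⟨Finset.mem_univ v, h1, h2, Or.inl h3⟩⟩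
  obtain ⟨b, hb, hmin⟩ := s.exists_min_image pos hs
  simp only [s, Finset.mem_filter, Finset.mem_univ, true_and] at hb hmin
  obtain ⟨b1, b2, b3⟩ := hb
  have b4 := (le_col_iff hi b).1 b2
  have bq : pos b ≠ i + 1 := fun h => b1 (inj (h.trans pq.symm))
  have min' : ∀ v, i + 1 < pos v → pos v < pos b → i + 1 ≤ col (d.mate v) ∧ d.deco v = 0 := by
    intro v h1 h2
    have c1 : i + 1 ≤ col v := (le_col_iff hi v).2 ⟨by omega, by omega⟩
    have c2 : v ≠ q := fun h => by rw [h] at h1; omega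
    have := hmin v
    by_contra h3
    have := this ⟨c2, c1, by omega⟩
    omega
  obtain ⟨a, ha⟩ : ∃ a, a = d.mate b := ⟨_, rfl⟩
  have hab : d.mate a = b := by rw [ha, d.mate_mate]
  have hda : d.deco a = d.deco b := by rw [ha, d.deco_mate]
  rw [← ha, ← hda] at b3
  have a1 : a ≠ q := fun h => by
    rw [h, hqp] at hab
    rw [← hab, cp] at b2
    omega
  have a2 : a ≠ p := fun h => by
    rw [h, hpq] at hab
    exact b1 hab.symm
  have ab : pos a ≠ pos b := fun h => d.no_free a (by rw [hab, inj h])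
  have pa1 : pos a ≠ i := fun h => a2 (inj (h.trans pp.symm))
  have pa2 : pos a ≠ i + 1 := fun h => a1 (inj (h.trans pq.symm))
  -- Otherwise `a` lies between `q` and `b`; by minimality of `b` the edge `{a, b}` is undecorated,
  -- and both ends are on the right, against the choice of `b`.
  have order : (pos a < i ∧ i + 1 < pos b) ∨ (i + 1 < pos b ∧ pos b < pos a) := by
    by_contra h
    have h1 := min' a (by omega) (by omega)
    have h2 := (le_col_iff hi a).2 ⟨by omega, by omega⟩
    omega
  have e_b : d.deco a ≠ 0 → ∀ u, ¬ (pos u < pos b ∧ pos b < pos (d.mate u)) := by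
    rw [hda]
    exact d.exposed b
  have vis : ∀ u, u ≠ p → u ≠ q → u ≠ a → u ≠ b →
      ((pos u < i ∧ i < pos (d.mate u)) ↔ (pos u < pos a ∧ pos a < pos (d.mate u))) ∧
      ((pos u < i ∧ i < pos (d.mate u)) ↔ (pos u < pos b ∧ pos b < pos (d.mate u))) := by
    intro u u1 u2 u3 u4
    have mu := d.mate_mate u
    have k1 : pos u ≠ i := fun h => u1 (inj (h.trans pp.symm))
    have k2 : pos u ≠ i + 1 := fun h => u2 (inj (h.trans pq.symm))
    have k3 : pos u ≠ pos a := fun h => u3 (inj h)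
    have k4 : pos u ≠ pos b := fun h => u4 (inj h)
    have k5 : pos (d.mate u) ≠ i := fun h => u2 (by rw [← mu, inj (h.trans pp.symm), hpq])
    have k6 : pos (d.mate u) ≠ i + 1 := fun h => u1 (by rw [← mu, inj (h.trans pq.symm), hqp])
    have k7 : pos (d.mate u) ≠ pos a := fun h => u4 (by rw [← mu, inj h, hab])
    have k8 : pos (d.mate u) ≠ pos b := fun h => u3 (by rw [← mu, inj h, ← ha])
    have x1 : pos u < pos a ∧ pos a < pos (d.mate u) ↔ pos u < pos b ∧ pos b < pos (d.mate u) := by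
      constructor
      · rintro ⟨y1, y2⟩
        have := d.planar.inside pos_injective y1 y2
        rwa [hab] at this
      · rintro ⟨y1, y2⟩
        have := d.planar.inside pos_injective y1 y2
        rwa [← ha] at this
    -- An edge passing over only one of `p` and `b` would end between `q` and `b`. If it passes over
    -- `p` it crosses the line too early; if it passes over `b` it would enclose an `a` on the left
    -- or cover a decorated edge.
    have x2 : pos u < i ∧ i < pos (d.mate u) ↔ pos u < pos b ∧ pos b < pos (d.mate u) := by
      constructor
      · rintro ⟨y1, y2⟩
        refine ⟨by omega, ?_⟩
        by_contra y3
        have m := (min' (d.mate u) (by omega) (by omega)).1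
        rw [mu, le_col_iff hi] at m
        omega
      · rintro ⟨y1, y2⟩
        refine ⟨?_, by omega⟩
        by_contra y3
        have m := (min' u (by omega) (by omega)).1
        rw [le_col_iff hi] at m
        rcases b3 with c | c
        · have := x1.2 ⟨y1, y2⟩
          have := (le_col_iff hi a).2 ⟨by omega, by omega⟩
          omega
        · exact e_b c u ⟨y1, y2⟩
    exact ⟨x2.trans x1.symm, x2⟩
  refine ⟨a, b, ⟨hpq, hab, h0, by omega, a2, a1, ?_, ?_, ?_, ?_⟩, b2, b3.symm⟩
  · rw [pp, pq]
    exact order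
  · intro u u1 u2 u3 u4
    rw [pp]
    exact (vis u u1 u2 u3 u4).1
  · intro u u1 u2 u3 u4
    rw [pp]
    exact (vis u u1 u2 u3 u4).2
  · intro v hv va vb h
    rw [pq] at h
    have m := min' v h.1
    have e := d.exposed v hv b
    rw [← ha] at e
    have : pos v ≠ pos b := fun h => vb (inj h)
    omega

/-- The cost of an edge, counted at one of its ends. -/
def edgeCost (d : LDiagram n) (v : Node n) : ℕ :=
  if d.deco v = 0 then (col v - col (d.mate v)) + (col (d.mate v) - col v)
  else col v + col (d.mate v)

/-- The total horizontal extent of the edges, decorated edges being led past the left wall. -/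
def cost (d : LDiagram n) : ℕ := ∑ v, d.edgeCost v

/-- If `{a, b}` is undecorated, its part between the columns `i` and `i + 1` and the short arc both
disappear. If it is decorated, `{p, a}` goes past the wall at cost `i + col a`, and `{q, b}` costs
only `col b - (i + 1)`. In either case the two edges lose an extent of 2. -/
theorem cost_reroute_lt {d : LDiagram n} (hd : d.IsTypeII) {p q a b : Node n}
    (h : CanReroute d p q a b) {i : ℕ} (hp : col p = i) (hq : col q = i + 1) (hb : i + 1 ≤ col b)
    (ha : d.deco a ≠ 0 ∨ col a ≤ i) : (d.reroute hd p q a b h).cost < d.cost := by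
  obtain ⟨h1, h2, h3, h4, h5, h6⟩ := h.distinct
  have m1 := h.mate_p
  have m2 := h.mate_q
  have m3 := h.mate_a
  have m4 := h.mate_b
  have d1 := h.deco_p
  have d2 : d.deco q = 0 := by rw [← h.mate_p, d.deco_mate, h.deco_p]
  have d3 : d.deco b = d.deco a := by rw [← h.mate_a, d.deco_mate]
  set e := d.reroute hd p q a b h with he
  have e1 : e.mate p = a := by simp [he, reroute, rerouteMate]
  have e2 : e.mate q = b := by simp [he, reroute, rerouteMate, h1.symm, h4]
  have e3 : e.mate a = p := by simp [he, reroute, rerouteMate, h2.symm]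
  have e4 : e.mate b = q := by simp [he, reroute, rerouteMate, h3.symm, h5.symm, h6.symm]
  have f1 : e.deco p = d.deco a := by simp [he, reroute, rerouteDeco]
  have f2 : e.deco q = 0 := by simp [he, reroute, rerouteDeco, h1.symm, h4]
  have f3 : e.deco a = d.deco a := by simp [he, reroute, rerouteDeco]
  have f4 : e.deco b = 0 := by simp [he, reroute, rerouteDeco, h3.symm, h6.symm]
  have key := sum_add_of_eq_off_four (f := e.edgeCost) (g := d.edgeCost) h1 h2 h3 h4 h5 h6
    (fun v k1 k2 k3 k4 => by
      simp [edgeCost, he, reroute, rerouteMate, rerouteDeco, k1, k2, k3, k4])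
  unfold cost
  simp only [edgeCost, e1, e2, e3, e4, f1, f2, f3, f4, m1, m2, m3, m4, d1, d2, d3, hp, hq,
    if_true] at key
  split_ifs at key <;> simp only [edgeCost] at * <;> omega

/-- A north arc contains one that joins neighbours. -/
theorem exists_simple_of_north (d : LDiagram n) (j k : Fin n) (hjk : j < k)
    (h : d.mate (Sum.inl j) = Sum.inl k) : ∃ (i : ℕ) (hi : i + 1 < n), (j : ℕ) ≤ i ∧ i + 1 ≤ k ∧
      d.mate (Sum.inl ⟨i, by omega⟩) = Sum.inl ⟨i + 1, hi⟩ := by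
  induction hN : (k : ℕ) - j using Nat.strong_induction_on generalizing j k with
  | _ N ih =>
    have hjk' : (j : ℕ) < k := hjk
    by_cases hk : (k : ℕ) = j + 1
    · refine ⟨j, by omega, le_rfl, by omega, ?_⟩
      rw [h]
      congr 1
      exact Fin.ext hk
    · obtain ⟨u, hu⟩ : ∃ u : Fin n, (u : ℕ) = j + 1 := ⟨⟨j + 1, by omega⟩, rfl⟩
      have hin := d.planar.inside pos_injective (u := Sum.inl j) (w := Sum.inl u)
        (by simp only [pos_inl]; omega) (by rw [h]; simp only [pos_inl]; omega)
      -- If the arc does not join neighbours, the arc starting at the next node is nested strictly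
      -- inside it, and the descent continues there.
      rw [h] at hin
      have hne := d.no_free (Sum.inl u)
      rcases hm : d.mate (Sum.inl u) with w | w
      · rw [hm] at hin hne
        simp only [pos_inl] at hin
        have hwu : (w : ℕ) ≠ u := fun e => hne (by rw [Fin.ext e])
        obtain ⟨i, hi, h1, h2, h3⟩ := ih ((w : ℕ) - u) (by omega) u w
          (show (u : ℕ) < w by omega) hm rfl
        exact ⟨i, hi, by omega, by omega, h3⟩
      · rw [hm] at hin
        simp only [pos_inl, pos_inr] at hin
        omega

/-- A diagram that is not the identity has an undecorated north arc joining neighbours, or a decorated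
arc joining the first two nodes. -/
theorem exists_simple (d : LDiagram n) (j k : Fin n) (h : d.mate (Sum.inl j) = Sum.inl k) :
    ∃ (i : ℕ) (hi : i + 1 < n), d.mate (Sum.inl ⟨i, by omega⟩) = Sum.inl ⟨i + 1, hi⟩ ∧
      (d.deco (Sum.inl ⟨i, by omega⟩) = 0 ∨ i = 0) := by
  have hex : ∃ i : ℕ, ∃ hi : i + 1 < n, d.mate (Sum.inl ⟨i, by omega⟩) = Sum.inl ⟨i + 1, hi⟩ := by
    rcases lt_trichotomy j k with hjk | rfl | hjk
    · obtain ⟨i, hi, -, -, h1⟩ := d.exists_simple_of_north j k hjk h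
      exact ⟨i, hi, h1⟩
    · exact absurd h (d.no_free _)
    · obtain ⟨i, hi, -, -, h1⟩ := d.exists_simple_of_north k j hjk (by rw [← h, d.mate_mate])
      exact ⟨i, hi, h1⟩
  classical
  obtain ⟨hi, h1⟩ := Nat.find_spec hex
  have hmin := fun {m} (hm : m < Nat.find hex) => Nat.find_min hex hm
  generalize Nat.find hex = i at hi h1 hmin
  refine ⟨i, hi, h1, ?_⟩
  by_contra hcon
  push Not at hcon
  obtain ⟨h2, h3⟩ := hcon
  -- The edge at the node just before a decorated short arc must not cover that arc, so it is a
  -- north arc going left. It contains a short arc, against the minimality of `i`.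
  obtain ⟨u, hu⟩ : ∃ u : Fin n, (u : ℕ) + 1 = i := ⟨⟨i - 1, by omega⟩, by simp; omega⟩
  have e := d.exposed _ h2 (Sum.inl u)
  have hne := d.no_free (Sum.inl u)
  rcases hm : d.mate (Sum.inl u) with w | w
  · rw [hm] at e hne
    simp only [pos_inl] at e
    have hwu : (w : ℕ) ≠ u := fun e => hne (by rw [Fin.ext e])
    have hwi : (w : ℕ) ≠ i := fun e => by
      have : w = ⟨i, by omega⟩ := Fin.ext e
      have hm' : d.mate (Sum.inl w) = Sum.inl u := by rw [← hm, d.mate_mate]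
      rw [this, h1] at hm'
      have := congrArg Fin.val (Sum.inl_injective hm')
      simp at this
      omega
    obtain ⟨i', hi', -, h5, h6⟩ := d.exists_simple_of_north w u (show (w : ℕ) < u by omega)
      (by rw [← hm, d.mate_mate])
    exact hmin (by omega) ⟨hi', h6⟩
  · rw [hm] at e
    simp only [pos_inl, pos_inr] at e
    omega

end LDiagram

end LoopFree

namespace LoopFree

open Polynomial LDiagram

/-! ### Toggling the decorations next to the left wall. -/

namespace LDiagram

variable {n : ℕ}

/-- The number of decorations on the edge at `v` that are added by toggling the edges at the nodes
`N` and `S`. -/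
def toggleCount (d : LDiagram n) (N S v : Node n) : ℕ :=
  (if v = N ∨ v = d.mate N then 1 else 0) + (if v = S ∨ v = d.mate S then 1 else 0)

theorem toggleCount_mate (d : LDiagram n) (N S v : Node n) :
    d.toggleCount N S (d.mate v) = d.toggleCount N S v := by
  have := d.mate_mate v
  have := d.mate_mate N
  have := d.mate_mate S
  unfold toggleCount
  grind

/-- The edges at the nodes `1` and `1'` are exposed. -/
theorem exposed_of_toggleCount (d : LDiagram n) {N S : Node n} (hN : pos N = 0)
    (hS : pos S = 2 * n - 1) {v : Node n} (hv : d.toggleCount N S v ≠ 0) (u : Node n) :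
    ¬ (pos u < pos v ∧ pos v < pos (d.mate u)) := by
  rintro ⟨h1, h2⟩
  have h3 := d.planar.inside pos_injective h1 h2
  have h4 := pos_lt (d.mate u)
  have h5 : v = N ∨ v = d.mate N ∨ v = S ∨ v = d.mate S := by
    unfold toggleCount at hv
    grind
  rcases h5 with rfl | rfl | rfl | rfl
  · omega
  · rw [d.mate_mate] at h3
    omega
  · omega
  · rw [d.mate_mate] at h3
    omega

/-- Add a decoration to the edge at the node `1` and to the edge at `1'`, and cancel. -/
def toggle (d : LDiagram n) (hd : d.IsTypeII) (N S : Node n) (hN : pos N = 0)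
    (hS : pos S = 2 * n - 1) : LDiagram n where
  mate := d.mate
  deco v := (d.deco v + d.toggleCount N S v) % 2
  loops := 0
  mate_mate := d.mate_mate
  deco_mate v := by rw [d.deco_mate, d.toggleCount_mate]
  deco_free v hv := absurd hv (d.no_free v)
  no_free := d.no_free
  planar := d.planar
  exposed v hv := by
    by_cases h0 : d.deco v = 0
    · refine d.exposed_of_toggleCount hN hS fun h => hv ?_
      change (d.deco v + d.toggleCount N S v) % 2 = 0
      rw [h0, h]
    · exact d.exposed v h0
  undecorated h := by
    refine ⟨fun v => ?_, by simp⟩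
    have h0 := (d.undecorated h).1 v
    have h1 := eq_one_of_no_north h hd.loops
    -- Here the diagram is the identity, whose leftmost edge contains both `N` and `S` and is
    -- toggled twice.
    have hS' : S = N.swap := by
      have := pos_lt N
      rcases N with i | i
      · refine pos_injective ?_
        simp only [Sum.swap_inl, pos_inl, pos_inr] at *
        omega
      · simp only [pos_inr] at *
        omega
    have h2 : d.mate N = S := by rw [h1, hS']; rfl
    have h3 : d.mate S = N := by rw [← h2, d.mate_mate]
    simp only [h0, toggleCount, h2, h3]
    grind

variable {d : LDiagram n} {N S : Node n} {hN : pos N = 0} {hS : pos S = 2 * n - 1}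

theorem toggle_isTypeII (hd : d.IsTypeII) : (d.toggle hd N S hN hS).IsTypeII where
  loops := rfl
  deco_le v := Nat.lt_succ_iff.1 (Nat.mod_lt _ (by norm_num))
  even := by
    have h1 := d.toArcs.two_mul_numDeco
    have h2 := (d.toggle hd N S hN hS).toArcs.two_mul_numDeco
    have h3 : ∑ v, (d.deco v + d.toggleCount N S v) = ∑ v, (d.toggle hd N S hN hS).deco v +
        2 * ∑ v, (d.deco v + d.toggleCount N S v) / 2 := by
      rw [Finset.mul_sum, ← Finset.sum_add_distrib]
      refine Finset.sum_congr rfl fun v _ => ?_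
      exact (Nat.mod_add_div _ 2).symm
    have hc : ∀ N : Node n, ∑ v, (if v = N ∨ v = d.mate N then 1 else 0) = 2 := by
      intro N
      have : ∀ v, (if v = N ∨ v = d.mate N then 1 else 0) =
          (if v = N then 1 else 0) + (if v = d.mate N then 1 else 0) := by
        intro v
        have := d.no_free N
        grind
      simp only [this, Finset.sum_add_distrib, Finset.sum_ite_eq', Finset.mem_univ, if_true]
    have h4 : ∑ v, d.toggleCount N S v = 4 := by
      simp only [toggleCount, Finset.sum_add_distrib, hc]
    -- Two decorations are added, four when counted at both ends, and cancellation removes a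
    -- multiple of four; so `numDeco` keeps its parity.
    obtain ⟨c, hc⟩ := d.toArcs.even_sum (fun v => (d.deco v + d.toggleCount N S v) / 2)
      (fun v => by rw [d.deco_mate, d.toggleCount_mate]) (fun v hv => absurd hv (d.no_free v))
    rw [Finset.sum_add_distrib] at h3
    have h5 := hd.even
    rw [Nat.even_iff] at h5 ⊢
    omega

/-- The edges at `1` and `1'` have an end in column 0, where the decorated and the undecorated cost
coincide. -/
theorem cost_toggle (hd : d.IsTypeII) : (d.toggle hd N S hN hS).cost = d.cost := by
  refine Finset.sum_congr rfl fun v _ => ?_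
  have h1 := hd.deco_le v
  have cN : col N = 0 := by
    rcases N with i | i <;> simp only [pos_inl, pos_inr] at hN <;>
      simp only [col, Sum.elim_inl, Sum.elim_inr] <;> omega
  have cS : col S = 0 := by
    rcases S with i | i <;> simp only [pos_inl, pos_inr] at hS <;>
      simp only [col, Sum.elim_inl, Sum.elim_inr] <;> omega
  have e1 : (d.toggle hd N S hN hS).deco v = (d.deco v + d.toggleCount N S v) % 2 := rfl
  have e2 : (d.toggle hd N S hN hS).mate v = d.mate v := rfl
  unfold edgeCost
  rw [e1, e2]
  by_cases h2 : v = N ∨ v = d.mate N ∨ v = S ∨ v = d.mate S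
  · have h3 : col v = 0 ∨ col (d.mate v) = 0 := by
      rcases h2 with rfl | rfl | rfl | rfl
      · exact Or.inl cN
      · rw [d.mate_mate]
        exact Or.inr cN
      · exact Or.inl cS
      · rw [d.mate_mate]
        exact Or.inr cS
    split_ifs <;> omega
  · have h3 : d.toggleCount N S v = 0 := by
      unfold toggleCount
      grind
    rw [h3, add_zero, Nat.mod_eq_of_lt (by omega)]

end LDiagram

/-! ### Factorizations and membership in the generated subalgebra. -/

namespace PHat

variable {n : ℕ}

/-- A factorization of a diagram without loops. -/
theorem of_eq_cupCap_mul {d e : LDiagram n} {i m : ℕ} (hi : i + 1 < n) (hm : m ≠ 0 → i = 0)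
    {p q a b : Node n} (hp : p = Sum.inl ⟨i, by omega⟩) (hq : q = Sum.inl ⟨i + 1, hi⟩)
    (hd : d.loops = 0) (he : e.loops = 0) (e1 : e.mate p = a) (e2 : e.mate q = b) (haq : a ≠ q)
    (d1 : d.mate p = q) (d2 : d.mate a = b)
    (hmate : ∀ v, v ≠ p → v ≠ q → v ≠ a → v ≠ b → d.mate v = e.mate v)
    (k1 : d.deco p % 2 = m % 2) (k2 : d.deco a % 2 = (m + e.deco p + e.deco q) % 2)
    (hdeco : ∀ v, v ≠ p → v ≠ q → v ≠ a → v ≠ b → d.deco v % 2 = e.deco v % 2) :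
    PHat.of d = PHat.of (cupCap i hi m hm) * PHat.of e := by
  subst hp hq
  have hne : e.mate (Sum.inl ⟨i, by omega⟩) ≠ Sum.inl ⟨i + 1, hi⟩ := by
    rw [e1]
    exact haq
  have key := cupCap_mul i hi m hm e hne
  rw [← of_mul]
  symm
  apply of_congr
  · rw [key]
    have m1 := d.mate_mate (Sum.inl ⟨i, by omega⟩)
    have m2 := d.mate_mate a
    have n1 := d.deco_mate (Sum.inl ⟨i, by omega⟩)
    have n2 := d.deco_mate a
    refine ⟨?_, fun v => ?_, ?_⟩
    · funext v
      have := hmate v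
      simp only [capJoin]
      grind
    · have := hdeco v
      simp only [capJoin]
      grind
    · simp [capJoin, hd, he]
  · simp [hd]

end PHat

namespace LDiagram

variable {n : ℕ}

/-- Factoring out `d_{i+1}` if there is an undecorated arc joining the nodes `i + 1` and `i + 2`. -/
theorem of_eq_simple_mul {d : LDiagram n} (hd : d.IsTypeII) {i : ℕ} (hi : i + 1 < n) {p q a b : Node n}
    (hp : p = Sum.inl ⟨i, by omega⟩) (hq : q = Sum.inl ⟨i + 1, hi⟩) (h : CanReroute d p q a b) :
    PHat.of d = PHat.of (simple i hi) * PHat.of (d.reroute hd p q a b h) := by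
  obtain ⟨h1, h2, h3, h4, h5, h6⟩ := h.distinct
  refine PHat.of_eq_cupCap_mul (a := a) (b := b) hi _ hp hq hd.loops rfl ?_ ?_ h4.symm h.mate_p
    h.mate_a ?_ ?_ ?_ ?_
  · simp [reroute, rerouteMate]
  · simp [reroute, rerouteMate, h1.symm, h4]
  · intro v k1 k2 k3 k4
    simp [reroute, rerouteMate, k1, k2, k3, k4]
  · rw [h.deco_p]
  · simp [reroute, rerouteDeco, h1.symm, h4]
  · intro v k1 k2 k3 k4
    simp [reroute, rerouteDeco, k1, k2, k3, k4]

/-- Toggling turns a factorization with factor `d_1` into one with factor `d_{1bar}`. -/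
theorem of_eq_simpleBar_mul_toggle {d e : LDiagram n} (hd : d.IsTypeII) (heII : e.IsTypeII)
    (hi : 0 + 1 < n) {N S q a b : Node n} (hN : pos N = 0) (hS : pos S = 2 * n - 1)
    (hp : N = Sum.inl ⟨0, by omega⟩) (hq : q = Sum.inl ⟨0 + 1, hi⟩) (h0 : d.deco N ≠ 0)
    (h2 : N ≠ a) (h4 : q ≠ a) (m1 : d.mate N = q) (m2 : d.mate a = b)
    (e1 : e.mate N = a) (e2 : e.mate q = b)
    (e5 : ∀ v, v ≠ N → v ≠ q → v ≠ a → v ≠ b → e.mate v = d.mate v)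
    (g1 : e.deco N = (d.deco a + d.toggleCount N S a) % 2) (g2 : e.deco q = 0)
    (g3 : ∀ v, v ≠ N → v ≠ q → v ≠ a → v ≠ b →
      e.deco v = (d.deco v + d.toggleCount N S v) % 2) :
    PHat.of d = PHat.of (simpleBar hi) * PHat.of (e.toggle heII N S hN hS) := by
  have m3 : d.mate q = N := by rw [← m1, d.mate_mate]
  have m4 : d.mate b = a := by rw [← m2, d.mate_mate]
  have hNS : N ≠ S := fun e => by
    rw [e, hS] at hN
    omega
  have hqS : q ≠ S := fun e => by
    rw [← e, hq] at hS
    simp at hS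
    omega
  have hab : a ≠ b := fun e => d.no_free a (by rw [m2, e])
  have hNq : N ≠ q := fun e => d.no_free N (by rw [m1, e])
  have hdN := hd.deco_le N
  have e3 : e.mate a = N := by rw [← e1, e.mate_mate]
  have e4 : e.mate b = q := by rw [← e2, e.mate_mate]
  refine PHat.of_eq_cupCap_mul (a := a) (b := b) hi (by simp) hp hq hd.loops rfl e1 e2 h4.symm m1 m2
    (fun v k1 k2 k3 k4 => (e5 v k1 k2 k3 k4).symm) ?_ ?_ ?_
  · omega
  · simp only [toggle]
    rw [g1, g2]
    -- The toggle at `N` meets `{N, q}` in `d` but `{N, a}` in `e`, where it cancels the decoration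
    -- brought in by the cap of `d_{1bar}`. The toggle at `S` lies on `{a, b}` in `d` exactly if it
    -- lies on `{N, a}` or `{q, b}` in `e`.
    have t1 : d.toggleCount N S a = if a = S ∨ b = S then 1 else 0 := by
      have := d.mate_mate S
      unfold toggleCount
      grind
    have t2 : e.toggleCount N S N = 1 + if a = S then 1 else 0 := by
      have := e.mate_mate S
      unfold toggleCount
      grind
    have t3 : e.toggleCount N S q = if b = S then 1 else 0 := by
      have := e.mate_mate S
      unfold toggleCount
      grind
    rw [t1, t2, t3]
    by_cases i1 : a = S <;> by_cases i2 : b = S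
    · exact absurd (i1.trans i2.symm) hab
    all_goals
      simp only [i1, i2, if_true, if_false, or_true, true_or, or_self]
      omega
  · intro v k1 k2 k3 k4
    simp only [toggle]
    rw [g3 v k1 k2 k3 k4]
    have t1 : d.toggleCount N S v = e.toggleCount N S v := by
      have := d.mate_mate S
      have := e.mate_mate S
      have := d.mate_mate v
      have := e.mate_mate v
      have := e5 v k1 k2 k3 k4
      unfold toggleCount
      grind
    rw [t1]
    omega

/-- Factoring out `d_{1bar}` if there is a decorated arc joining the nodes `1` and `2`. -/
theorem of_eq_simpleBar_mul {d : LDiagram n} (hd : d.IsTypeII) (hi : 0 + 1 < n) {N S q a b : Node n}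
    (hN : pos N = 0) (hS : pos S = 2 * n - 1)
    (hp : N = Sum.inl ⟨0, by omega⟩) (hq : q = Sum.inl ⟨0 + 1, hi⟩) (h0 : d.deco N ≠ 0)
    (h : CanReroute (d.toggle hd N S hN hS) N q a b) :
    PHat.of d = PHat.of (simpleBar hi) *
      PHat.of (((d.toggle hd N S hN hS).reroute (toggle_isTypeII hd) N q a b h).toggle
        (reroute_isTypeII _ h) N S hN hS) := by
  obtain ⟨h1, h2, h3, h4, h5, h6⟩ := h.distinct
  refine of_eq_simpleBar_mul_toggle hd (reroute_isTypeII _ h) hi hN hS hp hq h0 h2 h4 h.mate_p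
    h.mate_a ?_ ?_ ?_ ?_ ?_ ?_
  · simp [reroute, rerouteMate]
  · simp [reroute, rerouteMate, h1.symm, h4]
  · intro v k1 k2 k3 k4
    simp [reroute, rerouteMate, k1, k2, k3, k4, toggle]
  · simp [reroute, rerouteDeco, toggle]
  · simp [reroute, rerouteDeco, h1.symm, h4]
  · intro v k1 k2 k3 k4
    simp [reroute, rerouteDeco, k1, k2, k3, k4, toggle]

/-- Strong induction on the cost; each factorization leaves a type II diagram of smaller cost behind
a generator. -/
theorem of_mem_DTL (d : LDiagram n) (hd : d.IsTypeII) : PHat.of d ∈ DTL n := by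
  induction hN : d.cost using Nat.strong_induction_on generalizing d with
  | _ c ih =>
    by_cases hnorth : ∀ i j, d.mate (Sum.inl i) ≠ Sum.inl j
    · rw [eq_one_of_no_north hnorth hd.loops, PHat.of_one]
      exact one_mem _
    · push Not at hnorth
      obtain ⟨j, k, hjk⟩ := hnorth
      obtain ⟨i, hi, h1, h2⟩ := d.exists_simple j k hjk
      by_cases h0 : d.deco (Sum.inl ⟨i, by omega⟩) = 0
      · obtain ⟨a, b, h, hb, ha⟩ := d.exists_canReroute hi rfl rfl h1 h0
        rw [of_eq_simple_mul hd hi rfl rfl h]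
        refine mul_mem (Algebra.subset_adjoin (Or.inl ⟨i, hi, rfl⟩))
          (ih _ ?_ _ (reroute_isTypeII hd h) rfl)
        rw [← hN]
        exact cost_reroute_lt hd h rfl rfl hb ha
      · obtain rfl : i = 0 := by tauto
        have hN0 : pos (Sum.inl ⟨0, by omega⟩ : Node n) = 0 := rfl
        have hS0 : pos (Sum.inr ⟨0, by omega⟩ : Node n) = 2 * n - 1 := by simp
        -- The edge at `1'` is not the arc `{1, 2}`, so this arc is toggled once and loses its only
        -- decoration.
        have hz : (d.toggle hd _ _ hN0 hS0).deco (Sum.inl ⟨0, by omega⟩) = 0 := by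
          have t : d.toggleCount (Sum.inl ⟨0, by omega⟩) (Sum.inr ⟨0, by omega⟩)
              (Sum.inl ⟨0, by omega⟩) = 1 := by
            have h3 : d.mate (Sum.inr ⟨0, by omega⟩) ≠ Sum.inl ⟨0, by omega⟩ := fun e => by
              rw [← e, d.mate_mate] at h1
              simp at h1
            simp [toggleCount, h3.symm]
          have := hd.deco_le (Sum.inl ⟨0, by omega⟩)
          simp only [toggle, t]
          omega
        obtain ⟨a, b, h, hb, ha⟩ := (d.toggle hd _ _ hN0 hS0).exists_canReroute hi rfl rfl h1 hz
        rw [of_eq_simpleBar_mul hd hi hN0 hS0 rfl rfl h0 h]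
        refine mul_mem (Algebra.subset_adjoin (Or.inr ⟨hi, rfl⟩))
          (ih _ ?_ _ (toggle_isTypeII _) rfl)
        -- Both toggles preserve the cost; the decrease is due to the rerouting between them.
        rw [← hN, cost_toggle, ← cost_toggle (hN := hN0) (hS := hS0) hd]
        exact cost_reroute_lt _ h rfl rfl hb ha

end LDiagram

end LoopFree

namespace LoopFree

open Polynomial LDiagram

/-! ### Halves of a diagram. -/

namespace LDiagram

variable {n : ℕ}

/-- The upper half of a diagram. -/
def upperHalf (d : LDiagram n) : Arcs (Fin n) where
  mate i := Sum.elim id (fun _ => i) (d.mate (Sum.inl i))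
  deco i := Sum.elim (fun _ => d.deco (Sum.inl i)) (fun _ => 0) (d.mate (Sum.inl i))
  loops := 0
  mate_mate i := by
    rcases h : d.mate (Sum.inl i) with j | j
    · have : d.mate (Sum.inl j) = Sum.inl i := by rw [← h, d.mate_mate]
      simp [this]
    · simp [h]
  deco_mate i := by
    rcases h : d.mate (Sum.inl i) with j | j
    · have : d.mate (Sum.inl j) = Sum.inl i := by rw [← h, d.mate_mate]
      have h2 := d.deco_mate (Sum.inl i)
      rw [h] at h2
      simp [this, h2]
    · simp [h]
  deco_free i := by
    rcases h : d.mate (Sum.inl i) with j | j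
    · intro hj
      simp only [Sum.elim_inl, id] at hj
      exact absurd (hj ▸ h) (d.no_free _)
    · simp

theorem upperHalf_eq (d : TypeII n) : d.1.upperHalf = d.upper := rfl

theorem upperHalf_flip_eq (d : TypeII n) : d.1.flip.upperHalf = d.lower := rfl

/-- A node of the north face is the end of a north arc or of a propagating edge. -/
theorem upperHalf_cases (d : LDiagram n) (i : Fin n) :
    (∃ j, d.mate (Sum.inl i) = Sum.inl j ∧ d.upperHalf.mate i = j ∧ j ≠ i ∧
      d.upperHalf.deco i = d.deco (Sum.inl i)) ∨
    (∃ j, d.mate (Sum.inl i) = Sum.inr j ∧ d.upperHalf.mate i = i ∧ d.upperHalf.deco i = 0) := by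
  rcases h : d.mate (Sum.inl i) with j | j
  · refine Or.inl ⟨j, rfl, by simp [upperHalf, h], fun e => d.no_free (Sum.inl i) (by rw [h, e]), ?_⟩
    simp [upperHalf, h]
  · exact Or.inr ⟨j, rfl, by simp [upperHalf, h], by simp [upperHalf, h]⟩

theorem flip_mate_inl (d : LDiagram n) (i : Fin n) :
    d.flip.mate (Sum.inl i) = (d.mate (Sum.inr i)).swap := rfl

/-- A node of the south face is the end of a south arc or of a propagating edge. -/
theorem lowerHalf_cases (d : LDiagram n) (i : Fin n) :
    (∃ j, d.mate (Sum.inr i) = Sum.inr j ∧ d.flip.upperHalf.mate i = j ∧ j ≠ i ∧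
      d.flip.upperHalf.deco i = d.deco (Sum.inr i)) ∨
    (∃ j, d.mate (Sum.inr i) = Sum.inl j ∧ d.flip.upperHalf.mate i = i ∧
      d.flip.upperHalf.deco i = 0) := by
  rcases d.flip.upperHalf_cases i with ⟨j, h1, h2, h3, h4⟩ | ⟨j, h1, h2, h3⟩
  · refine Or.inl ⟨j, ?_, h2, h3, h4⟩
    rw [flip_mate_inl] at h1
    rw [← Sum.swap_swap (d.mate _), h1]
    rfl
  · refine Or.inr ⟨j, ?_, h2, h3⟩
    rw [flip_mate_inl] at h1
    rw [← Sum.swap_swap (d.mate _), h1]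
    rfl

theorem propagating_lt {d : LDiagram n} {i i' j j' : Fin n} (h : d.mate (Sum.inl i) = Sum.inr j)
    (h' : d.mate (Sum.inl i') = Sum.inr j') (hii : i < i') : j < j' := by
  have h2 := d.planar (Sum.inl i) (Sum.inl i')
  rw [h, h'] at h2
  simp only [pos_inl, pos_inr] at h2
  have h3 : (j : ℕ) ≠ j' := fun e => by
    rw [← Fin.ext e, ← h] at h'
    have := congrArg d.mate h'
    rw [d.mate_mate, d.mate_mate] at this
    exact (ne_of_gt hii) (Sum.inl_injective this)
  have : (i : ℕ) < i' := hii
  change (j : ℕ) < j'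
  omega

theorem propagating_lt' {d : LDiagram n} {i i' j j' : Fin n} (h : d.mate (Sum.inl i) = Sum.inr j)
    (h' : d.mate (Sum.inl i') = Sum.inr j') (hjj : j < j') : i < i' := by
  rcases lt_trichotomy i i' with h1 | h1 | h1
  · exact h1
  · rw [h1, h'] at h
    exact absurd (Sum.inr_injective h) (ne_of_gt hjj)
  · exact absurd (propagating_lt h' h h1) (not_lt.2 hjj.le)

/-- To the right of a propagating edge there are no decorations. -/
theorem deco_propagating {d : LDiagram n} {i i' j : Fin n} (h : d.mate (Sum.inl i) = Sum.inr j)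
    (hii : i < i') : d.deco (Sum.inl i') = 0 := by
  by_contra h0
  have h1 := d.exposed _ h0 (Sum.inl i)
  rw [h] at h1
  simp only [pos_inl, pos_inr] at h1
  have : (i : ℕ) < i' := hii
  omega

/-- The propagating edges themselves are a bijection between the free nodes of the two halves. -/
theorem numProp_flip (d : LDiagram n) : numProp d.flip.upperHalf = numProp d.upperHalf := by
  unfold numProp
  refine Finset.card_nbij' (fun j => Sum.elim id id (d.mate (Sum.inr j)))
    (fun i => Sum.elim id id (d.mate (Sum.inl i))) ?_ ?_ ?_ ?_
  · intro j hj
    simp only [Finset.coe_filter, Finset.mem_univ, true_and, Set.mem_ofPred_eq] at hj ⊢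
    rcases d.lowerHalf_cases j with ⟨k, h1, h2, h3, h4⟩ | ⟨k, h1, h2, h3⟩
    · exact absurd (h2.symm.trans hj) h3
    · have h5 : d.mate (Sum.inl k) = Sum.inr j := by rw [← h1, d.mate_mate]
      rw [h1]
      simp [upperHalf, h5]
  · intro j hj
    simp only [Finset.coe_filter, Finset.mem_univ, true_and, Set.mem_ofPred_eq] at hj ⊢
    rcases d.upperHalf_cases j with ⟨k, h1, h2, h3, h4⟩ | ⟨k, h1, h2, h3⟩
    · exact absurd (h2.symm.trans hj) h3
    · have h5 : d.mate (Sum.inr k) = Sum.inl j := by rw [← h1, d.mate_mate]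
      rw [h1]
      simp [upperHalf, flip_mate_inl, h5]
  · intro j hj
    simp only [Finset.coe_filter, Finset.mem_univ, true_and, Set.mem_ofPred_eq] at hj ⊢
    rcases d.lowerHalf_cases j with ⟨k, h1, h2, h3, h4⟩ | ⟨k, h1, h2, h3⟩
    · exact absurd (h2.symm.trans hj) h3
    · have h5 : d.mate (Sum.inl k) = Sum.inr j := by rw [← h1, d.mate_mate]
      simp [h1, h5]
  · intro j hj
    simp only [Finset.coe_filter, Finset.mem_univ, true_and, Set.mem_ofPred_eq] at hj ⊢
    rcases d.upperHalf_cases j with ⟨k, h1, h2, h3, h4⟩ | ⟨k, h1, h2, h3⟩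
    · exact absurd (h2.symm.trans hj) h3
    · have h5 : d.mate (Sum.inr k) = Sum.inl j := by rw [← h1, d.mate_mate]
      simp [h1, h5]

theorem numDeco_eq_add {d : LDiagram n} (h : ∀ i, d.upperHalf.mate i ≠ i) :
    d.toArcs.numDeco = d.upperHalf.numDeco + d.flip.upperHalf.numDeco := by
  have h1 : ∀ i, d.deco (Sum.inl i) = d.upperHalf.deco i := by
    intro i
    rcases d.upperHalf_cases i with ⟨j, h1, h2, h3, h4⟩ | ⟨j, h1, h2, h3⟩
    · exact h4.symm
    · exact absurd h2 (h i)
  have h2 : ∀ i, d.deco (Sum.inr i) = d.flip.upperHalf.deco i := by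
    intro i
    rcases d.lowerHalf_cases i with ⟨j, h1, h2, h3, h4⟩ | ⟨j, h1, h2, h3⟩
    · exact h4.symm
    · have h5 : d.mate (Sum.inl j) = Sum.inr i := by rw [← h1, d.mate_mate]
      exact absurd (by simp [upperHalf, h5]) (h j)
  have a1 := d.toArcs.two_mul_numDeco
  have a2 := d.upperHalf.two_mul_numDeco
  have a3 := d.flip.upperHalf.two_mul_numDeco
  rw [Fintype.sum_sum_type] at a1
  simp only [h1, h2] at a1
  omega

/-- The leftmost propagating edge hides all others from the left wall, so it alone can carry
decorations that the halves do not record. -/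
theorem numDeco_eq_add_deco {d : LDiagram n} {m : Fin n} (hm : d.upperHalf.mate m = m)
    (hmin : ∀ i, d.upperHalf.mate i = i → m ≤ i) :
    d.toArcs.numDeco =
      d.upperHalf.numDeco + d.flip.upperHalf.numDeco + d.deco (Sum.inl m) := by
  obtain ⟨m', hm'⟩ : ∃ m', d.mate (Sum.inl m) = Sum.inr m' := by
    rcases d.upperHalf_cases m with ⟨j, h1, h2, h3, h4⟩ | ⟨j, h1, h2, h3⟩
    · exact absurd (h2.symm.trans hm) h3
    · exact ⟨j, h1⟩
  have hm'' : d.mate (Sum.inr m') = Sum.inl m := by rw [← hm', d.mate_mate]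
  have hdm : d.deco (Sum.inr m') = d.deco (Sum.inl m) := by rw [← hm', d.deco_mate]
  have h1 : ∀ i, d.deco (Sum.inl i) =
      d.upperHalf.deco i + if i = m then d.deco (Sum.inl m) else 0 := by
    intro i
    rcases d.upperHalf_cases i with ⟨j, h1, h2, h3, h4⟩ | ⟨j, h1, h2, h3⟩
    · rw [h4, if_neg, add_zero]
      rintro rfl
      exact h3 (h2.symm.trans hm)
    · rw [h3, zero_add]
      split_ifs with h
      · rw [h]
      · exact deco_propagating hm' (lt_of_le_of_ne (hmin i h2) (Ne.symm h))
  have h2 : ∀ i, d.deco (Sum.inr i) =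
      d.flip.upperHalf.deco i + if i = m' then d.deco (Sum.inl m) else 0 := by
    intro i
    rcases d.lowerHalf_cases i with ⟨j, h1, h2, h3, h4⟩ | ⟨j, h1, h2, h3⟩
    · rw [h4, if_neg, add_zero]
      rintro rfl
      rw [hm''] at h1
      simp at h1
    · rw [h3, zero_add]
      have h5 : d.mate (Sum.inl j) = Sum.inr i := by rw [← h1, d.mate_mate]
      split_ifs with h
      · rw [h, hdm]
      · rw [← h5, d.deco_mate]
        refine deco_propagating hm' (lt_of_le_of_ne (hmin j (by simp [upperHalf, h5])) ?_)
        rintro rfl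
        rw [hm'] at h5
        exact h (Sum.inr_injective h5).symm
  have a1 := d.toArcs.two_mul_numDeco
  have a2 := d.upperHalf.two_mul_numDeco
  have a3 := d.flip.upperHalf.two_mul_numDeco
  rw [Fintype.sum_sum_type, Finset.sum_congr rfl fun i _ => h1 i,
    Finset.sum_congr rfl fun i _ => h2 i] at a1
  simp only [Finset.sum_add_distrib, Finset.sum_ite_eq', Finset.mem_univ, if_true] at a1
  omega

/-- A loop-free diagram with at most one decoration on every edge and an even number of decorations is
determined by its two halves. -/
theorem IsTypeII.ext_halves {d d' : LDiagram n} (hd : d.IsTypeII) (hd' : d'.IsTypeII)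
    (hu : d.upperHalf = d'.upperHalf) (hl : d.flip.upperHalf = d'.flip.upperHalf) : d = d' := by
  -- At the first disagreement, the end `j` that `d` reaches from `i` is skipped by `d'`, where it
  -- must belong to an earlier propagating edge; but there the two diagrams already agree.
  have step : ∀ d d' : LDiagram n, d.upperHalf = d'.upperHalf →
      d.flip.upperHalf = d'.flip.upperHalf → ∀ i j j' : Fin n, d.mate (Sum.inl i) = Sum.inr j →
      d'.mate (Sum.inl i) = Sum.inr j' →
      (∀ k < i, ∀ l l', d.mate (Sum.inl k) = Sum.inr l → d'.mate (Sum.inl k) = Sum.inr l' → l = l') →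
      ¬ j < j' := by
    intro d d' hu hl i j j' h h' ih hjj
    have hj : d.mate (Sum.inr j) = Sum.inl i := by rw [← h, d.mate_mate]
    have hfree : d'.flip.upperHalf.mate j = j := by
      rw [← hl]
      simp [upperHalf, flip_mate_inl, hj]
    rcases d'.lowerHalf_cases j with ⟨k, h1, h2, h3, h4⟩ | ⟨k, h1, h2, h3⟩
    · exact h3 (h2.symm.trans hfree)
    · have h5 : d'.mate (Sum.inl k) = Sum.inr j := by rw [← h1, d'.mate_mate]
      have hki : k < i := propagating_lt' h5 h' hjj
      have hfree' : d.upperHalf.mate k = k := by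
        rw [hu]
        simp [upperHalf, h5]
      rcases d.upperHalf_cases k with ⟨l, g1, g2, g3, g4⟩ | ⟨l, g1, g2, g3⟩
      · exact g3 (g2.symm.trans hfree')
      · have := ih k hki l j g1 h5
        rw [this, ← h] at g1
        have := congrArg d.mate g1
        rw [d.mate_mate, d.mate_mate] at this
        exact (ne_of_lt hki) (Sum.inl_injective this)
  have prop : ∀ N : ℕ, ∀ i : Fin n, (i : ℕ) = N → ∀ j j', d.mate (Sum.inl i) = Sum.inr j →
      d'.mate (Sum.inl i) = Sum.inr j' → j = j' := by
    intro N
    induction N using Nat.strong_induction_on with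
    | _ N ih =>
      rintro i rfl j j' h h'
      rcases lt_trichotomy j j' with h1 | h1 | h1
      · exact absurd h1 (step d d' hu hl i j j' h h' fun k hk l l' g g' =>
          ih k hk k rfl l l' g g')
      · exact h1
      · exact absurd h1 (step d' d hu.symm hl.symm i j' j h' h fun k hk l l' g g' =>
          (ih k hk k rfl l' l g' g).symm)
  have hmate : ∀ v, d.mate v = d'.mate v := by
    have hN : ∀ i, d.mate (Sum.inl i) = d'.mate (Sum.inl i) := by
      intro i
      have e : d.upperHalf.mate i = d'.upperHalf.mate i := by rw [hu]
      rcases d.upperHalf_cases i with ⟨j, h1, h2, h3, h4⟩ | ⟨j, h1, h2, h3⟩ <;>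
        rcases d'.upperHalf_cases i with ⟨j', g1, g2, g3, g4⟩ | ⟨j', g1, g2, g3⟩
      · rw [h1, g1, ← h2, ← g2, e]
      · exact absurd (by rw [← h2, e, g2]) h3
      · exact absurd (by rw [← g2, ← e, h2]) g3
      · rw [h1, g1, prop i i rfl j j' h1 g1]
    rintro (i | i)
    · exact hN i
    · have e : d.flip.upperHalf.mate i = d'.flip.upperHalf.mate i := by rw [hl]
      rcases d.lowerHalf_cases i with ⟨j, h1, h2, h3, h4⟩ | ⟨j, h1, h2, h3⟩
      · rcases d'.lowerHalf_cases i with ⟨j', g1, g2, g3, g4⟩ | ⟨j', g1, g2, g3⟩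
        · rw [h1, g1, ← h2, ← g2, e]
        · exact absurd (by rw [← h2, e, g2]) h3
      · have h5 : d.mate (Sum.inl j) = Sum.inr i := by rw [← h1, d.mate_mate]
        rw [h1, ← d'.mate_mate (Sum.inl j), ← hN, h5]
  have hdN : ∀ i, d.deco (Sum.inl i) = d'.deco (Sum.inl i) := by
    intro i
    have e : d.upperHalf.deco i = d'.upperHalf.deco i := by rw [hu]
    rcases d.upperHalf_cases i with ⟨j, h1, h2, h3, h4⟩ | ⟨j, h1, h2, h3⟩
    · rcases d'.upperHalf_cases i with ⟨j', g1, g2, g3, g4⟩ | ⟨j', g1, g2, g3⟩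
      · rw [← h4, ← g4, e]
      · rw [← hmate, h1] at g1
        simp at g1
    · by_cases hmin : ∀ k, d.upperHalf.mate k = k → i ≤ k
      · have a1 := numDeco_eq_add_deco h2 hmin
        have a2 := numDeco_eq_add_deco (d := d') (m := i) (by rw [← hu]; exact h2)
          (by rw [← hu]; exact hmin)
        rw [← hu, ← hl] at a2
        have b1 := hd.even
        have b2 := hd'.even
        have c1 := hd.deco_le (Sum.inl i)
        have c2 := hd'.deco_le (Sum.inl i)
        rw [Nat.even_iff] at b1 b2
        omega
      · push Not at hmin
        obtain ⟨k, hk, hki⟩ := hmin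
        rcases d.upperHalf_cases k with ⟨l, g1, g2, g3, g4⟩ | ⟨l, g1, g2, g3⟩
        · exact absurd (g2.symm.trans hk) g3
        · rw [deco_propagating g1 hki]
          rw [hmate] at g1
          rw [deco_propagating g1 hki]
  refine ext_data (funext hmate) (fun v => ?_) (hd.loops.trans hd'.loops.symm)
  rcases v with i | i
  · exact hdN i
  · rcases d.lowerHalf_cases i with ⟨j, h1, h2, h3, h4⟩ | ⟨j, h1, h2, h3⟩
    · rcases d'.lowerHalf_cases i with ⟨j', g1, g2, g3, g4⟩ | ⟨j', g1, g2, g3⟩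
      · rw [← h4, ← g4, hl]
      · rw [← hmate, h1] at g1
        simp at g1
    · rw [← d.deco_mate, ← d'.deco_mate, ← hmate, h1]
      exact hdN j

end LDiagram

/-- The conditions satisfied by the half-diagrams. -/
structure Arcs.IsHalf {n : ℕ} (h : Arcs (Fin n)) : Prop where
  loops : h.loops = 0
  deco_le : ∀ i, h.deco i ≤ 1
  planar : h.NonCrossing Fin.val
  exposed : h.Exposed Fin.val
  free_out : ∀ f, h.mate f = f → ∀ u, ¬ (u < f ∧ f < h.mate u)
  left : ∀ i, h.deco i ≠ 0 → ∀ f, h.mate f = f → i < f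

/-- An arc over a free node would cross the propagating edge there, and a decorated arc to the right
of it would be cut off from the left wall. -/
theorem LDiagram.upperHalf_isHalf {n : ℕ} (d : LDiagram n) (hd : ∀ v, d.deco v ≤ 1) :
    d.upperHalf.IsHalf where
  loops := rfl
  deco_le i := by
    have := hd (Sum.inl i)
    rcases d.upperHalf_cases i with ⟨j, h1, h2, h3, h4⟩ | ⟨j, h1, h2, h3⟩ <;> omega
  planar u v h := by
    rcases d.upperHalf_cases u with ⟨j, h1, h2, h3, h4⟩ | ⟨j, h1, h2, h3⟩
    · rcases d.upperHalf_cases v with ⟨k, g1, g2, g3, g4⟩ | ⟨k, g1, g2, g3⟩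
      · have := d.planar (Sum.inl u) (Sum.inl v)
        rw [h1, g1] at this
        rw [h2, g2] at h
        exact this h
      · rw [g2] at h
        omega
    · rw [h2] at h
      omega
  exposed v hv u h := by
    rcases d.upperHalf_cases u with ⟨j, h1, h2, h3, h4⟩ | ⟨j, h1, h2, h3⟩
    · rcases d.upperHalf_cases v with ⟨k, g1, g2, g3, g4⟩ | ⟨k, g1, g2, g3⟩
      · have := d.exposed (Sum.inl v) (by rwa [← g4]) (Sum.inl u)
        rw [h1] at this
        rw [h2] at h
        exact this h
      · exact hv g3
    · rw [h2] at h
      omega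
  free_out f hf u h := by
    rcases d.upperHalf_cases u with ⟨j, h1, h2, h3, h4⟩ | ⟨j, h1, h2, h3⟩
    · rcases d.upperHalf_cases f with ⟨k, g1, g2, g3, g4⟩ | ⟨k, g1, g2, g3⟩
      · exact g3 (g2.symm.trans hf)
      · have := d.planar (Sum.inl u) (Sum.inl f)
        rw [h1, g1] at this
        rw [h2] at h
        have a1 : (u : ℕ) < f := h.1
        have a2 : (f : ℕ) < j := h.2
        simp only [pos_inl, pos_inr] at this
        omega
    · rw [h2] at h
      exact lt_asymm h.1 h.2
  left i hi f hf := by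
    rcases d.upperHalf_cases f with ⟨k, g1, g2, g3, g4⟩ | ⟨k, g1, g2, g3⟩
    · exact absurd (g2.symm.trans hf) g3
    · rcases d.upperHalf_cases i with ⟨j, h1, h2, h3, h4⟩ | ⟨j, h1, h2, h3⟩
      · have := d.exposed (Sum.inl i) (by rwa [← h4]) (Sum.inl f)
        rw [g1] at this
        simp only [pos_inl, pos_inr] at this
        have hne : (i : ℕ) ≠ f := fun e => by
          rw [Fin.ext e] at hi
          exact hi g3
        change (i : ℕ) < f
        omega
      · exact absurd h3 hi

end LoopFree

/-! ### Joining two half-diagrams. -/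

namespace LoopFree

open Polynomial LDiagram

/-- The order preserving bijection between two sets of the same size. -/
theorem exists_monotone_matching {n : ℕ} (A B : Finset (Fin n)) (h : A.card = B.card) :
    ∃ φ ψ : Fin n → Fin n, (∀ i ∈ A, φ i ∈ B ∧ ψ (φ i) = i) ∧ (∀ j ∈ B, ψ j ∈ A ∧ φ (ψ j) = j) ∧
      ∀ i ∈ A, ∀ i' ∈ A, i < i' → φ i < φ i' := by
  let e : A ≃o B := (A.orderIsoOfFin rfl).symm.trans (B.orderIsoOfFin h.symm)
  refine ⟨fun i => if hi : i ∈ A then e ⟨i, hi⟩ else i,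
    fun j => if hj : j ∈ B then e.symm ⟨j, hj⟩ else j, fun i hi => ?_, fun j hj => ?_,
    fun i hi i' hi' hlt => ?_⟩
  · simp [hi]
  · simp [hj]
  · simp only [hi, hi', dif_pos]
    exact e.lt_iff_lt.2 hlt

/-- The data for joining the half-diagrams `S` and `T` along a bijection of the free nodes. -/
structure Matching {n : ℕ} (S T : Arcs (Fin n)) (φ ψ : Fin n → Fin n) : Prop where
  left : ∀ i, S.mate i = i → T.mate (φ i) = φ i ∧ ψ (φ i) = i
  right : ∀ j, T.mate j = j → S.mate (ψ j) = ψ j ∧ φ (ψ j) = j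
  mono : ∀ i, S.mate i = i → ∀ i', S.mate i' = i' → i < i' → φ i < φ i'

namespace Matching

variable {n : ℕ} {S T : Arcs (Fin n)} {φ ψ : Fin n → Fin n}

theorem symm (h : Matching S T φ ψ) : Matching T S ψ φ where
  left := h.right
  right := h.left
  mono j hj j' hj' hlt := by
    by_contra hcon
    have h1 := h.right j hj
    have h2 := h.right j' hj'
    rcases (not_lt.1 hcon).lt_or_eq with h3 | h3
    · have := h.mono _ h2.1 _ h1.1 h3
      rw [h1.2, h2.2] at this
      exact lt_asymm this hlt
    · rw [← h1.2, ← h2.2, h3] at hlt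
      exact lt_irrefl _ hlt

end Matching

open Classical in
/-- The decoration of a node of one face when two halves are joined, the leftmost propagating edge
getting `c` decorations. -/
noncomputable def joinDeco {n : ℕ} (S : Arcs (Fin n)) (c : ℕ) (i : Fin n) : ℕ :=
  if S.mate i = i then (if ∀ f, S.mate f = f → i ≤ f then c else 0) else S.deco i

/-- The other end of an edge when two halves are joined. -/
def joinMate {n : ℕ} (S T : Arcs (Fin n)) (φ ψ : Fin n → Fin n) : Node n → Node n :=
  Sum.elim (fun i => if S.mate i = i then Sum.inr (φ i) else Sum.inl (S.mate i))
    (fun j => if T.mate j = j then Sum.inl (ψ j) else Sum.inr (T.mate j))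

theorem joinDeco_ne_zero {n : ℕ} {S : Arcs (Fin n)} {c : ℕ} {i : Fin n} (h : joinDeco S c i ≠ 0) :
    (S.mate i = i ∧ c ≠ 0 ∧ ∀ f, S.mate f = f → i ≤ f) ∨ (S.mate i ≠ i ∧ S.deco i ≠ 0) := by
  unfold joinDeco at h
  split_ifs at h with h1 h2
  · exact Or.inl ⟨h1, h, h2⟩
  · exact absurd rfl h
  · exact Or.inr ⟨h1, h⟩

/-- A monotone matching sends the leftmost free node to the leftmost one, so the decoration `c` is
assigned consistently at both ends of one edge. -/
theorem joinDeco_min_iff {n : ℕ} {S T : Arcs (Fin n)} {φ ψ : Fin n → Fin n} (h : Matching S T φ ψ)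
    {i : Fin n} (hi : S.mate i = i) :
    (∀ f, S.mate f = f → i ≤ f) ↔ ∀ f, T.mate f = f → φ i ≤ f := by
  constructor
  · intro h1 f hf
    have h2 := h.right f hf
    rcases (h1 _ h2.1).lt_or_eq with h3 | h3
    · have := h.mono i hi _ h2.1 h3
      rw [h2.2] at this
      exact this.le
    · rw [h3, h2.2]
  · intro h1 f hf
    by_contra hcon
    have := h.mono f hf i hi (not_le.1 hcon)
    exact absurd (h1 _ (h.left f hf).1) (not_le.2 this)

theorem joinDeco_matching {n : ℕ} {S T : Arcs (Fin n)} {φ ψ : Fin n → Fin n}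
    (h : Matching S T φ ψ) (c : ℕ) {i : Fin n} (hi : S.mate i = i) :
    joinDeco T c (φ i) = joinDeco S c i := by
  unfold joinDeco
  rw [if_pos hi, if_pos (h.left i hi).1]
  simp only [joinDeco_min_iff h hi]

theorem joinDeco_mate {n : ℕ} (S : Arcs (Fin n)) (c : ℕ) {i : Fin n} (hi : S.mate i ≠ i) :
    joinDeco S c (S.mate i) = joinDeco S c i := by
  unfold joinDeco
  rw [if_neg hi, S.mate_mate, if_neg (Ne.symm hi), S.deco_mate]

theorem join_planar {n : ℕ} {S T : Arcs (Fin n)} {φ ψ : Fin n → Fin n} (hS : S.IsHalf)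
    (hT : T.IsHalf) (h : Matching S T φ ψ) (u v : Node n) :
    ¬ (pos u < pos v ∧ pos v < pos (joinMate S T φ ψ u) ∧
      pos (joinMate S T φ ψ u) < pos (joinMate S T φ ψ v)) := by
  have lt_iff : ∀ a b : Fin n, a < b ↔ (a : ℕ) < b := fun _ _ => Iff.rfl
  rintro ⟨h1, h2, h3⟩
  rcases u with u | u
  · by_cases hu : S.mate u = u
    · rcases v with v | v
      · by_cases hv : S.mate v = v
        · have := h.mono u hu v hv
          simp only [joinMate, Sum.elim_inl, hu, hv, if_true, pos_inl, pos_inr, lt_iff] at *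
          omega
        · simp only [joinMate, Sum.elim_inl, hu, hv, if_true, if_false, pos_inl, pos_inr] at *
          omega
      · by_cases hv : T.mate v = v
        · simp only [joinMate, Sum.elim_inl, Sum.elim_inr, hu, hv, if_true, pos_inl, pos_inr] at *
          omega
        · have := hT.free_out (φ u) (h.left u hu).1 (T.mate v)
          rw [T.mate_mate] at this
          simp only [joinMate, Sum.elim_inl, Sum.elim_inr, hu, hv, if_true, if_false, pos_inl,
            pos_inr, lt_iff] at *
          omega
    · rcases v with v | v
      · by_cases hv : S.mate v = v
        · have := hS.free_out v hv u
          simp only [joinMate, Sum.elim_inl, hu, hv, if_true, if_false, pos_inl, pos_inr,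
            lt_iff] at *
          omega
        · have := hS.planar u v
          simp only [joinMate, Sum.elim_inl, hu, hv, if_false, pos_inl] at *
          omega
      · simp only [joinMate, Sum.elim_inl, hu, if_false, pos_inl, pos_inr] at *
        omega
  · rcases v with v | v
    · simp only [pos_inl, pos_inr] at h1
      omega
    · by_cases hu : T.mate u = u
      · simp only [joinMate, Sum.elim_inr, hu, if_true, pos_inl, pos_inr] at *
        omega
      · by_cases hv : T.mate v = v
        · simp only [joinMate, Sum.elim_inr, hu, hv, if_true, if_false, pos_inl, pos_inr] at *
          omega
        · have := hT.planar (T.mate v) (T.mate u)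
          rw [T.mate_mate, T.mate_mate] at this
          simp only [joinMate, Sum.elim_inr, hu, hv, if_false, pos_inr] at *
          omega

theorem join_exposed {n : ℕ} {S T : Arcs (Fin n)} {φ ψ : Fin n → Fin n} (hS : S.IsHalf)
    (hT : T.IsHalf) (h : Matching S T φ ψ) (c : ℕ) (v : Node n)
    (hv : Sum.elim (joinDeco S c) (joinDeco T c) v ≠ 0) (u : Node n) :
    ¬ (pos u < pos v ∧ pos v < pos (joinMate S T φ ψ u)) := by
  have lt_iff : ∀ a b : Fin n, a < b ↔ (a : ℕ) < b := fun _ _ => Iff.rfl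
  have le_iff : ∀ a b : Fin n, a ≤ b ↔ (a : ℕ) ≤ b := fun _ _ => Iff.rfl
  rintro ⟨h1, h2⟩
  rcases v with v | v
  · rcases u with u | u
    · by_cases hu : S.mate u = u
      · rcases joinDeco_ne_zero hv with ⟨a1, a2, a3⟩ | ⟨a1, a2⟩
        · have := a3 u hu
          simp only [pos_inl, le_iff] at *
          omega
        · have := hS.left v a2 u hu
          simp only [pos_inl, lt_iff] at *
          omega
      · rcases joinDeco_ne_zero hv with ⟨a1, a2, a3⟩ | ⟨a1, a2⟩
        · have := hS.free_out v a1 u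
          simp only [joinMate, Sum.elim_inl, hu, if_false, pos_inl, lt_iff] at *
          omega
        · have := hS.exposed v a2 u
          simp only [joinMate, Sum.elim_inl, hu, if_false, pos_inl] at *
          omega
    · simp only [pos_inl, pos_inr] at h1
      omega
  · rcases u with u | u
    · by_cases hu : S.mate u = u
      · have hφ := (h.left u hu).1
        rcases joinDeco_ne_zero hv with ⟨a1, a2, a3⟩ | ⟨a1, a2⟩
        · have := a3 _ hφ
          simp only [joinMate, Sum.elim_inl, hu, if_true, pos_inl, pos_inr, le_iff] at *
          omega
        · have := hT.left v a2 _ hφ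
          simp only [joinMate, Sum.elim_inl, hu, if_true, pos_inl, pos_inr, lt_iff] at *
          omega
      · simp only [joinMate, Sum.elim_inl, hu, if_false, pos_inl, pos_inr] at *
        omega
    · by_cases hu : T.mate u = u
      · simp only [joinMate, Sum.elim_inr, hu, if_true, pos_inl, pos_inr] at *
        omega
      · rcases joinDeco_ne_zero hv with ⟨a1, a2, a3⟩ | ⟨a1, a2⟩
        · have := hT.free_out v a1 (T.mate u)
          rw [T.mate_mate] at this
          simp only [joinMate, Sum.elim_inr, hu, if_false, pos_inr, lt_iff] at *
          omega
        · have := hT.exposed v a2 (T.mate u)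
          rw [T.mate_mate] at this
          simp only [joinMate, Sum.elim_inr, hu, if_false, pos_inr] at *
          omega

/-- Join two half-diagrams, the leftmost propagating edge getting `c` decorations. -/
noncomputable def join {n : ℕ} {S T : Arcs (Fin n)} {φ ψ : Fin n → Fin n} (hS : S.IsHalf)
    (hT : T.IsHalf) (h : Matching S T φ ψ) (c : ℕ) (hc : (∀ i, S.mate i = i) → c = 0) :
    LDiagram n where
  mate := joinMate S T φ ψ
  deco := Sum.elim (joinDeco S c) (joinDeco T c)
  loops := 0
  mate_mate := by
    rintro (i | i)
    · by_cases hi : S.mate i = i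
      · simp [joinMate, hi, h.left i hi]
      · simp [joinMate, hi, S.mate_mate, Ne.symm hi]
    · by_cases hi : T.mate i = i
      · simp [joinMate, hi, h.right i hi]
      · simp [joinMate, hi, T.mate_mate, Ne.symm hi]
  deco_mate := by
    rintro (i | i)
    · by_cases hi : S.mate i = i
      · simp [joinMate, hi, joinDeco_matching h c hi]
      · simp [joinMate, hi, joinDeco_mate]
    · by_cases hi : T.mate i = i
      · simp [joinMate, hi, joinDeco_matching h.symm c hi]
      · simp [joinMate, hi, joinDeco_mate]
  deco_free := by
    rintro (i | i) hv
    · by_cases hi : S.mate i = i <;> simp [joinMate, hi] at hv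
    · by_cases hi : T.mate i = i <;> simp [joinMate, hi] at hv
  no_free := by
    rintro (i | i) hv
    · by_cases hi : S.mate i = i <;> simp [joinMate, hi] at hv
    · by_cases hi : T.mate i = i <;> simp [joinMate, hi] at hv
  planar := join_planar hS hT h
  exposed := join_exposed hS hT h c
  undecorated hN := by
    have hSf : ∀ i, S.mate i = i := by
      intro i
      by_contra hi
      exact hN i (S.mate i) (by simp [joinMate, hi])
    have hTf : ∀ j, T.mate j = j := by
      have inj : Function.Injective φ := by
        intro a b hab
        rw [← (h.left a (hSf a)).2, hab, (h.left b (hSf b)).2]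
      intro j
      obtain ⟨i, rfl⟩ := Finite.injective_iff_surjective.1 inj j
      exact (h.left i (hSf i)).1
    have hc0 := hc hSf
    subst hc0
    refine ⟨?_, by simp⟩
    rintro (i | i)
    · simp [joinDeco, hSf i]
    · simp [joinDeco, hTf i]

theorem join_upperHalf {n : ℕ} {S T : Arcs (Fin n)} {φ ψ : Fin n → Fin n} (hS : S.IsHalf)
    (hT : T.IsHalf) (h : Matching S T φ ψ) (c : ℕ) (hc : (∀ i, S.mate i = i) → c = 0) :
    (join hS hT h c hc).upperHalf = S := by
  refine Arcs.ext ?_ ?_ hS.loops.symm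
  · funext i
    by_cases hi : S.mate i = i <;> simp [upperHalf, join, joinMate, hi]
  · funext i
    by_cases hi : S.mate i = i
    · simp [upperHalf, join, joinMate, hi, S.deco_free i hi]
    · simp [upperHalf, join, joinMate, joinDeco, hi]

theorem join_lowerHalf {n : ℕ} {S T : Arcs (Fin n)} {φ ψ : Fin n → Fin n} (hS : S.IsHalf)
    (hT : T.IsHalf) (h : Matching S T φ ψ) (c : ℕ) (hc : (∀ i, S.mate i = i) → c = 0) :
    (join hS hT h c hc).flip.upperHalf = T := by
  refine Arcs.ext ?_ ?_ hT.loops.symm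
  · funext i
    by_cases hi : T.mate i = i <;> simp [upperHalf, LDiagram.flip, join, joinMate, hi]
  · funext i
    by_cases hi : T.mate i = i
    · simp [upperHalf, LDiagram.flip, join, joinMate, hi, T.deco_free i hi]
    · simp [upperHalf, LDiagram.flip, join, joinMate, joinDeco, hi]

/-- Two half-diagrams with equally many free nodes and of the right parity are the halves of a diagram
of type II. -/
theorem exists_typeII {n : ℕ} {S T : Arcs (Fin n)} (hS : S.IsHalf) (hT : T.IsHalf)
    (hp : numProp S = numProp T) (h0 : numProp S = 0 → Even (S.numDeco + T.numDeco)) :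
    ∃ d : TypeII n, d.upper = S ∧ d.lower = T := by
  obtain ⟨φ, ψ, h1, h2, h3⟩ := exists_monotone_matching (Finset.univ.filter fun i => S.mate i = i)
    (Finset.univ.filter fun i => T.mate i = i) hp
  simp only [Finset.mem_filter, Finset.mem_univ, true_and] at h1 h2 h3
  have hm : Matching S T φ ψ := ⟨h1, h2, h3⟩
  have hfree : ∀ A : Arcs (Fin n), (∀ i, A.mate i = i) → A.numDeco = 0 := by
    intro A hA
    simp [Arcs.numDeco, fun i => A.deco_free i (hA i)]
  have hc : (∀ i, S.mate i = i) → (S.numDeco + T.numDeco) % 2 = 0 := by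
    intro hSf
    -- If all nodes of `S` are free, so are those of `T`, by counting; the join is then the identity
    -- and must be undecorated.
    have hTf : ∀ j, T.mate j = j := by
      have e1 : numProp S = n := by simp [numProp, hSf]
      rw [e1] at hp
      unfold numProp at hp
      have : (Finset.univ.filter fun i => T.mate i = i) = Finset.univ := by
        apply Finset.eq_univ_of_card
        rw [← hp, Fintype.card_fin]
      intro j
      have hj := Finset.mem_univ j
      rw [← this] at hj
      exact (Finset.mem_filter.1 hj).2
    rw [hfree S hSf, hfree T hTf]
  -- The leftmost propagating edge is decorated exactly when this is needed to make the total even;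
  -- if there is no such edge, `h0` supplies evenness.
  let d := join hS hT hm ((S.numDeco + T.numDeco) % 2) hc
  have hu : d.upperHalf = S := join_upperHalf hS hT hm _ hc
  have hl : d.flip.upperHalf = T := join_lowerHalf hS hT hm _ hc
  have hII : d.IsTypeII := by
    refine ⟨rfl, ?_, ?_⟩
    · have : ∀ A : Arcs (Fin n), A.IsHalf → ∀ i, joinDeco A ((S.numDeco + T.numDeco) % 2) i ≤ 1 := by
        intro A hA i
        have := hA.deco_le i
        unfold joinDeco
        split_ifs <;> omega
      rintro (i | i)
      · exact this S hS i
      · exact this T hT i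
    · by_cases hf : ∃ i, S.mate i = i
      · obtain ⟨m, hm1, hm2⟩ := (Finset.univ.filter fun i => S.mate i = i).exists_min_image id
          (by obtain ⟨i, hi⟩ := hf; exact ⟨i, by simp [hi]⟩)
        simp only [Finset.mem_filter, Finset.mem_univ, true_and, id] at hm1 hm2
        have a := numDeco_eq_add_deco (d := d) (m := m) (by rw [hu]; exact hm1)
          (by rw [hu]; exact hm2)
        have b : d.deco (Sum.inl m) = (S.numDeco + T.numDeco) % 2 := by
          change joinDeco S _ m = _
          unfold joinDeco
          rw [if_pos hm1, if_pos hm2]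
        rw [hu, hl, b] at a
        rw [Nat.even_iff]
        omega
      · push Not at hf
        have a := numDeco_eq_add (d := d) (by rw [hu]; exact hf)
        rw [a, hu, hl]
        exact h0 (by simp [numProp, hf])
  exact ⟨⟨d, hII⟩, hu, hl⟩

end LoopFree

namespace LoopFree

open Polynomial LDiagram

/-! ### Halves of a product. -/

namespace LDiagram

variable {n : ℕ}

/-- The upper half of a product depends only on the upper half of the second factor. -/
theorem mul_agree (d : LDiagram n) {e e' : LDiagram n} (h : e.upperHalf = e'.upperHalf)
    (hl : e.loops = e'.loops) : (d * e).loops = (d * e').loops ∧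
      (d * e).reduce.upperHalf = (d * e').reduce.upperHalf := by
  -- All nodes except those of the south face of the lower box: the arcs within `U` are those of `d`
  -- and the north arcs of `e`, and all seams lie in `U`.
  let U : Set (Node n ⊕ Node n) := {x | ∀ j, x ≠ Sum.inr (Sum.inr j)}
  have hU : ∀ x, x ∈ U ↔ ∀ j, x ≠ Sum.inr (Sum.inr j) := fun _ => Iff.rfl
  have h0 : Arcs.AgreeOn U (d.toArcs.sum e.toArcs) (d.toArcs.sum e'.toArcs) := by
    have hm : ∀ i, e.upperHalf.mate i = e'.upperHalf.mate i := fun i => by rw [h]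
    have hd : ∀ i, e.upperHalf.deco i = e'.upperHalf.deco i := fun i => by rw [h]
    refine ⟨?_, ?_, by simp only [Arcs.sum, hl]⟩
    · rintro ((i | i) | (i | i)) hi hv
      · rfl
      · rfl
      · simp only [Arcs.sum, Sum.map_inr] at hv ⊢
        rcases e.upperHalf_cases i with ⟨j, h1, h2, h3, h4⟩ | ⟨j, h1, h2, h3⟩ <;>
          rcases e'.upperHalf_cases i with ⟨k, g1, g2, g3, g4⟩ | ⟨k, g1, g2, g3⟩
        · rw [h1, g1, ← h2, ← g2, hm]
        · exact absurd (by rw [← h2, hm, g2]) h3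
        · exact absurd (by rw [← g2, ← hm, h2]) g3
        · rw [h1, g1, hU, hU] at hv
          simp at hv
      · exact absurd rfl (hi i)
    · rintro ((i | i) | (i | i)) hi hv
      · rfl
      · rfl
      · simp only [Arcs.sum, Sum.map_inr, Sum.elim_inr] at hv ⊢
        rcases e.upperHalf_cases i with ⟨j, h1, h2, h3, h4⟩ | ⟨j, h1, h2, h3⟩ <;>
          rcases e'.upperHalf_cases i with ⟨k, g1, g2, g3, g4⟩ | ⟨k, g1, g2, g3⟩
        · rw [← h4, ← g4, hd]
        · exact absurd (by rw [← h2, hm, g2]) h3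
        · exact absurd (by rw [← g2, ← hm, h2]) g3
        · rw [h1, hU] at hv
          simp at hv
      · exact absurd rfl (hi i)
  have key := h0.glueList ((List.finRange n).map (seam n)) (by
    intro x hx
    obtain ⟨i, -, rfl⟩ := List.mem_map.1 hx
    simp [seam, hU])
  have p := mul_isPush d e
  have p' := mul_isPush d e'
  have mate_iff : ∀ i j, (d * e).mate (Sum.inl i) = Sum.inl j ↔
      (d * e').mate (Sum.inl i) = Sum.inl j := by
    intro i j
    have k := key.mate (outer (Sum.inl i)) (by simp [hU, outer])
    change (stack d.toArcs e.toArcs).mate _ ∈ U ∨ (stack d.toArcs e'.toArcs).mate _ ∈ U →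
      (stack d.toArcs e.toArcs).mate _ = (stack d.toArcs e'.toArcs).mate _ at k
    rw [p.mate, p'.mate] at k
    constructor
    · intro hij
      refine outer_injective ?_
      rw [← k (Or.inl (by rw [hij]; simp [hU, outer])), hij]
    · intro hij
      refine outer_injective ?_
      rw [k (Or.inr (by rw [hij]; simp [hU, outer])), hij]
  refine ⟨key.loops, Arcs.ext ?_ ?_ rfl⟩
  · funext i
    rcases (d * e).reduce.upperHalf_cases i with ⟨j, h1, h2, h3, h4⟩ | ⟨j, h1, h2, h3⟩ <;>
      rcases (d * e').reduce.upperHalf_cases i with ⟨k, g1, g2, g3, g4⟩ | ⟨k, g1, g2, g3⟩ <;>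
      rw [h2, g2] <;> rw [reduce_mate] at h1 g1
    · rw [mate_iff, g1] at h1
      exact (Sum.inl_injective h1).symm
    · rw [mate_iff, g1] at h1
      simp at h1
    · rw [← mate_iff, h1] at g1
      simp at g1
  · funext i
    rcases (d * e).reduce.upperHalf_cases i with ⟨j, h1, h2, h3, h4⟩ | ⟨j, h1, h2, h3⟩ <;>
      rcases (d * e').reduce.upperHalf_cases i with ⟨k, g1, g2, g3, g4⟩ | ⟨k, g1, g2, g3⟩
    · rw [h4, g4, reduce_deco, reduce_deco]
      congr 1
      refine key.deco (outer (Sum.inl i)) (by simp [hU, outer]) ?_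
      change (stack d.toArcs e.toArcs).mate _ ∈ U
      rw [reduce_mate] at h1
      rw [p.mate, h1]
      simp [hU, outer]
    · rw [reduce_mate] at h1 g1
      rw [mate_iff, g1] at h1
      simp at h1
    · rw [reduce_mate] at h1 g1
      rw [← mate_iff, h1] at g1
      simp at g1
    · rw [h3, g3]

/-- South arcs of the second factor are south arcs of the product. -/
theorem mul_south (d e : LDiagram n) {i j : Fin n} (h : e.mate (Sum.inr i) = Sum.inr j) :
    (d * e).mate (Sum.inr i) = Sum.inr j ∧ (d * e).deco (Sum.inr i) = e.deco (Sum.inr i) := by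
  have p := mul_isPush d e
  have hk : ∀ x ∈ (List.finRange n).map (seam n), outer (Sum.inr i) ≠ x.1 ∧
      outer (Sum.inr i) ≠ x.2 ∧ (d.toArcs.sum e.toArcs).mate (outer (Sum.inr i)) ≠ x.1 ∧
      (d.toArcs.sum e.toArcs).mate (outer (Sum.inr i)) ≠ x.2 := by
    intro x hx
    obtain ⟨i, -, rfl⟩ := List.mem_map.1 hx
    simp [outer, seam, Arcs.sum, h]
  constructor
  · apply outer_injective
    rw [← p.mate, stack, Arcs.glueList_keep _ _ _ hk]
    simp [outer, Arcs.sum, h]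
  · rw [← p.deco, stack, Arcs.glueList_keep_deco _ _ _ hk]
    simp [outer, Arcs.sum]

/-- South arcs of `e` survive in the product, so multiplication from above can only turn propagating
edges into further south arcs. -/
theorem mul_lower_free (d e : LDiagram n) (i : Fin n)
    (h : (d * e).reduce.flip.upperHalf.mate i = i) : e.flip.upperHalf.mate i = i := by
  rcases e.lowerHalf_cases i with ⟨j, h1, h2, h3, h4⟩ | ⟨j, h1, h2, h3⟩
  · rcases (d * e).reduce.lowerHalf_cases i with ⟨k, g1, g2, g3, g4⟩ | ⟨k, g1, g2, g3⟩
    · exact absurd (g2.symm.trans h) g3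
    · rw [reduce_mate, (mul_south d e h1).1] at g1
      simp at g1
  · exact h2

theorem numProp_mul_le (d e : LDiagram n) :
    numProp (d * e).reduce.upperHalf ≤ numProp e.flip.upperHalf := by
  rw [← numProp_flip]
  refine Finset.card_le_card fun i hi => ?_
  simp only [Finset.mem_filter, Finset.mem_univ, true_and] at hi ⊢
  exact mul_lower_free d e i hi

theorem mul_lowerHalf (d e : LDiagram n) (he : ∀ v, e.deco v ≤ 1)
    (h : numProp (d * e).reduce.upperHalf = numProp e.flip.upperHalf) :
    (d * e).reduce.flip.upperHalf = e.flip.upperHalf := by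
  rw [← numProp_flip] at h
  -- The free nodes of the product are among those of `e`; equal numbers force equal sets, and no
  -- new south arc has appeared.
  have hset : (Finset.univ.filter fun i => (d * e).reduce.flip.upperHalf.mate i = i) =
      Finset.univ.filter fun i => e.flip.upperHalf.mate i = i := by
    refine Finset.eq_of_subset_of_card_le (fun i hi => ?_) h.ge
    simp only [Finset.mem_filter, Finset.mem_univ, true_and] at hi ⊢
    exact mul_lower_free d e i hi
  have hfree : ∀ i, e.flip.upperHalf.mate i = i → (d * e).reduce.flip.upperHalf.mate i = i := by
    intro i hi
    have : i ∈ Finset.univ.filter fun i => e.flip.upperHalf.mate i = i := by simp [hi]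
    rw [← hset] at this
    exact (Finset.mem_filter.1 this).2
  have main : ∀ i, (d * e).reduce.flip.upperHalf.mate i = e.flip.upperHalf.mate i ∧
      (d * e).reduce.flip.upperHalf.deco i = e.flip.upperHalf.deco i := by
    intro i
    rcases e.lowerHalf_cases i with ⟨j, h1, h2, h3, h4⟩ | ⟨j, h1, h2, h3⟩
    · obtain ⟨s1, s2⟩ := mul_south d e h1
      rcases (d * e).reduce.lowerHalf_cases i with ⟨k, g1, g2, g3, g4⟩ | ⟨k, g1, g2, g3⟩
      · rw [reduce_mate, s1] at g1
        rw [g2, h2, g4, h4, reduce_deco, s2]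
        have := he (Sum.inr i)
        exact ⟨(Sum.inr_injective g1).symm, Nat.mod_eq_of_lt (by omega)⟩
      · rw [reduce_mate, s1] at g1
        simp at g1
    · have := hfree i h2
      exact ⟨this.trans h2.symm, by rw [Arcs.deco_free _ i this, h3]⟩
  exact Arcs.ext (funext fun i => (main i).1) (funext fun i => (main i).2) rfl

end LDiagram

/-! ### Labels and the parametrization of type II diagrams by pairs of half-diagrams. -/

variable {n : ℕ}

theorem numProp_mod_two (h : Arcs (Fin n)) : numProp h % 2 = n % 2 := by
  -- The nodes that are not free come in pairs.
  obtain ⟨c, hc⟩ := h.even_sum (fun i => if h.mate i = i then 0 else 1)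
    (fun i => by
      have := h.mate_mate i
      grind)
    (fun i hi => by simp [hi])
  have h1 : ∑ i, ((if h.mate i = i then 0 else 1) + (if h.mate i = i then 1 else 0)) = n := by
    have : ∀ i, (if h.mate i = i then 0 else 1) + (if h.mate i = i then 1 else 0) = 1 := by
      intro i
      split_ifs <;> rfl
    simp [this]
  rw [Finset.sum_add_distrib, hc, ← Finset.card_filter] at h1
  unfold numProp
  omega

theorem M.isHalf {l : Lam n} (S : M l) : S.1.IsHalf := by
  obtain ⟨d, h | h⟩ := S.2.1
  · rw [h]
    exact d.1.upperHalf_isHalf d.2.deco_le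
  · rw [h]
    exact d.1.flip.upperHalf_isHalf d.2.flip.deco_le

theorem M.numProp_eq {l : Lam n} (S : M l) : numProp S.1 = l.1.abs := S.2.2.1

/-- Two halves with the same sign can be joined without a propagating edge to absorb an odd
decoration. -/
theorem Label.Valid.even_add {a : Label} (ha : a.Valid n) (h0 : a.abs = 0) {x y : ℕ}
    (hx : (a = Label.zeroPlus → Even x) ∧ (a = Label.zeroMinus → Odd x))
    (hy : (a = Label.zeroPlus → Even y) ∧ (a = Label.zeroMinus → Odd y)) : Even (x + y) := by
  cases a with
  | num m => exact absurd h0 (Nat.pos_iff_ne_zero.1 ha.1)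
  | zeroPlus => exact (hx.1 rfl).add (hy.1 rfl)
  | zeroMinus => exact (hx.2 rfl).add_odd (hy.2 rfl)

/-- A half-diagram determines its label: `|λ|` counts the free nodes, and for `|λ| = 0` the sign is
the parity of its decorations. -/
theorem Label.Valid.eq_of_abs_eq {a a' : Label} (hl : a.Valid n) (hl' : a'.Valid n)
    (h1 : a.abs = a'.abs) {x : ℕ}
    (hS : (a = Label.zeroPlus → Even x) ∧ (a = Label.zeroMinus → Odd x))
    (hS' : (a' = Label.zeroPlus → Even x) ∧ (a' = Label.zeroMinus → Odd x)) : a = a' := by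
  cases a with
  | num m =>
    have hm : 0 < m := hl.1
    cases a' with
    | num m' => exact congrArg Label.num h1
    | zeroPlus => exact absurd h1 hm.ne'
    | zeroMinus => exact absurd h1 hm.ne'
  | zeroPlus =>
    cases a' with
    | num m' =>
      have hm' : 0 < m' := hl'.1
      exact absurd h1.symm hm'.ne'
    | zeroPlus => rfl
    | zeroMinus => exact absurd (hS.1 rfl) (Nat.not_even_iff_odd.2 (hS'.2 rfl))
  | zeroMinus =>
    cases a' with
    | num m' =>
      have hm' : 0 < m' := hl'.1
      exact absurd h1.symm hm'.ne'
    | zeroPlus => exact absurd (hS'.1 rfl) (Nat.not_even_iff_odd.2 (hS.2 rfl))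
    | zeroMinus => rfl

theorem exists_comp {l : Lam n} (S T : M l) :
    ∃ d : TypeII n, d.upper = S.1 ∧ d.lower = T.1 := by
  refine exists_typeII S.isHalf T.isHalf (S.numProp_eq.trans T.numProp_eq.symm) fun h0 => ?_
  rw [S.numProp_eq] at h0
  exact l.2.even_add h0 S.2.2.2 T.2.2.2

/-- The diagram of type II with given halves. -/
noncomputable def comp (l : Lam n) (S T : M l) : TypeII n := (exists_comp S T).choose

theorem comp_upper (l : Lam n) (S T : M l) : (comp l S T).upper = S.1 :=
  (exists_comp S T).choose_spec.1

theorem comp_lower (l : Lam n) (S T : M l) : (comp l S T).lower = T.1 :=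
  (exists_comp S T).choose_spec.2

theorem comp_iff (l : Lam n) (S T : M l) (d : TypeII n) :
    (d.upper = S.1 ∧ d.lower = T.1) ↔ d = comp l S T := by
  constructor
  · rintro ⟨h1, h2⟩
    exact Subtype.ext (d.2.ext_halves (comp l S T).2 (h1.trans (comp_upper l S T).symm)
      (h2.trans (comp_lower l S T).symm))
  · rintro rfl
    exact ⟨comp_upper l S T, comp_lower l S T⟩

theorem numProp_lower (d : TypeII n) : numProp d.lower = numProp d.upper := d.1.numProp_flip

theorem even_numDeco_halves (d : TypeII n) (h : numProp d.upper = 0) :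
    Even (d.upper.numDeco + d.lower.numDeco) := by
  have hf : ∀ i, d.1.upperHalf.mate i ≠ i := by
    intro i hi
    unfold numProp at h
    rw [Finset.card_eq_zero, Finset.filter_eq_empty_iff] at h
    exact h (Finset.mem_univ i) hi
  have h1 := numDeco_eq_add hf
  rw [upperHalf_eq, upperHalf_flip_eq] at h1
  rw [← h1]
  exact d.2.even

/-- Every diagram of type II belongs to a unique cell. -/
theorem exists_eq_comp (d : TypeII n) :
    ∃ (l : Lam n) (S T : M l), d = comp l S T ∧ l.1.abs = numProp d.upper := by
  have hpar := numProp_mod_two d.upper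
  rcases Nat.eq_zero_or_pos (numProp d.upper) with h0 | hpos
  · have heven := even_numDeco_halves d h0
    have hl0 := (numProp_lower d).trans h0
    have hn : Even n := by
      rw [Nat.even_iff]
      omega
    by_cases hd : Even d.upper.numDeco
    · refine ⟨⟨Label.zeroPlus, hn⟩, ⟨d.upper, ⟨d, Or.inl rfl⟩, h0, fun _ => hd, ?_⟩,
        ⟨d.lower, ⟨d, Or.inr rfl⟩, hl0, fun _ => (Nat.even_add.1 heven).1 hd, ?_⟩, ?_, h0.symm⟩
      · simp
      · simp
      · exact (comp_iff _ _ _ _).1 ⟨rfl, rfl⟩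
    · refine ⟨⟨Label.zeroMinus, hn⟩, ⟨d.upper, ⟨d, Or.inl rfl⟩, h0, ?_, fun _ => ?_⟩,
        ⟨d.lower, ⟨d, Or.inr rfl⟩, hl0, ?_, fun _ => ?_⟩, ?_, h0.symm⟩
      · simp
      · exact Nat.not_even_iff_odd.1 hd
      · simp
      · exact Nat.not_even_iff_odd.1 fun h => hd ((Nat.even_add.1 heven).2 h)
      · exact (comp_iff _ _ _ _).1 ⟨rfl, rfl⟩
  · have hle : numProp d.upper ≤ n := by
      unfold numProp
      exact (Finset.card_le_univ _).trans (Fintype.card_fin n).le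
    refine ⟨⟨Label.num (numProp d.upper), hpos, hle, hpar⟩,
      ⟨d.upper, ⟨d, Or.inl rfl⟩, rfl, ?_, ?_⟩,
      ⟨d.lower, ⟨d, Or.inr rfl⟩, numProp_lower d, ?_, ?_⟩, ?_, rfl⟩
    · simp
    · simp
    · simp
    · simp
    · exact (comp_iff _ _ _ _).1 ⟨rfl, rfl⟩

theorem label_eq {l l' : Lam n} (S : M l) (S' : M l') (h : S.1 = S'.1) : l = l' := by
  have h1 : l.1.abs = l'.1.abs := by rw [← S.numProp_eq, ← S'.numProp_eq, h]
  have hS' := S'.2.2.2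
  rw [← h] at hS'
  exact Subtype.ext (l.2.eq_of_abs_eq l'.2 h1 S.2.2.2 hS')

theorem comp_injective :
    Function.Injective fun x : Σ l : Lam n, M l × M l => comp x.1 x.2.1 x.2.2 := by
  rintro ⟨l, S, T⟩ ⟨l', S', T'⟩ h
  simp only at h
  have h1 : S.1 = S'.1 := by rw [← comp_upper l S T, h, comp_upper]
  have h2 : T.1 = T'.1 := by rw [← comp_lower l S T, h, comp_lower]
  obtain rfl := label_eq S S' h1
  rw [show S = S' from Subtype.ext h1, show T = T' from Subtype.ext h2]

theorem comp_range :
    Set.range (fun x : Σ l : Lam n, M l × M l => comp x.1 x.2.1 x.2.2) = Set.univ := by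
  refine Set.eq_univ_of_forall fun d => ?_
  obtain ⟨l, S, T, h, -⟩ := exists_eq_comp d
  exact ⟨⟨l, S, T⟩, h.symm⟩

theorem comp_flip (l : Lam n) (S T : M l) : (comp l S T).flip = comp l T S := by
  refine (comp_iff l T S _).1 ⟨comp_lower l S T, ?_⟩
  rw [← comp_upper l S T]
  unfold TypeII.lower
  congr 1
  exact Subtype.ext (flip_flip _)

instance : Finite (TypeII n) := by
  let f : TypeII n → (Node n → Node n) × (Node n → Fin 2) :=
    fun d => (d.1.mate, fun v => ⟨d.1.deco v, Nat.lt_succ_iff.2 (d.2.deco_le v)⟩)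
  refine Finite.of_injective f fun d e h => Subtype.ext (ext_data ?_ (fun v => ?_) ?_)
  · exact congrArg Prod.fst h
  · exact congrArg Fin.val (congrFun (congrArg Prod.snd h) v)
  · rw [d.2.loops, e.2.loops]

instance (l : Lam n) : Finite (M l) := by
  -- A half-diagram is recovered as the upper half of its join with itself, and there are finitely
  -- many type II diagrams.
  refine Finite.of_injective (fun S : M l => comp l S S) fun S S' h => Subtype.ext ?_
  simp only at h
  rw [← comp_upper l S S, h, comp_upper]

/-! ### The basis of type II diagrams and the anti-automorphism. -/

/-- The image of a diagram of type II in the loop-free algebra. -/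
noncomputable def cell (d : TypeII n) : LFD n := LFD.mk ⟨PHat.of d.1, of_mem_DTL d.1 d.2⟩

theorem cell_mul_of_even (d e : TypeII n) (h : ∀ m ∈ (d.1 * e.1).loops, m % 2 = 0) :
    cell d * cell e = loopWeight (d.1 * e.1).loops •
      cell ⟨(d.1 * e.1).reduce, d.2.mul_reduce e.2 h⟩ := by
  unfold cell
  rw [← map_mul, ← map_smul]
  congr 1
  apply Subtype.ext
  change PHat.of d.1 * PHat.of e.1 = loopWeight (d.1 * e.1).loops • PHat.of (d.1 * e.1).reduce
  rw [← PHat.of_mul, PHat.of_eq_of_even _ h]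

theorem cell_mul_of_odd (d e : TypeII n) {m : ℕ} (hm : m ∈ (d.1 * e.1).loops) (h : m % 2 = 1) :
    cell d * cell e = 0 := by
  unfold cell
  rw [← map_mul]
  have hmem : PHat.of (d.1 * e.1) ∈ DTL n := by
    rw [PHat.of_mul]
    exact mul_mem (of_mem_DTL d.1 d.2) (of_mem_DTL e.1 e.2)
  rw [← LFD.mk_eq_zero (d.1 * e.1) hmem hm h]
  congr 1
  exact Subtype.ext (PHat.of_mul d.1 e.1).symm

/-- Evaluating the representation at the identity diagram sends distinct type II diagrams to
distinct basis vectors. -/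
theorem cell_linearIndependent : LinearIndependent ℤ[X] (cell : TypeII n → LFD n) := by
  let L : LFD n →ₗ[ℤ[X]] ({e : LDiagram n // e.IsReduced} →₀ ℤ[X]) :=
    (LinearMap.applyₗ (Finsupp.single ⟨1, one_isTypeII.isReduced⟩ 1)).comp (LFD.rep n).toLinearMap
  refine LinearIndependent.of_comp L ?_
  have hL : L ∘ (cell : TypeII n → LFD n) =
      (fun e => Finsupp.single e (1 : ℤ[X])) ∘ fun d : TypeII n => ⟨d.1, d.2.isReduced⟩ := by
    funext d
    change LFD.rep n (LFD.mk ⟨PHat.of d.1, of_mem_DTL d.1 d.2⟩) _ = _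
    rw [LFD.rep_mk, action_single, mul_one, one_smul, d.2.isReduced.normalForm_eq]
    rfl
  rw [hL]
  refine (Finsupp.linearIndependent_single_one ℤ[X] _).comp _ fun d e h => Subtype.ext ?_
  exact congrArg (fun e : {e : LDiagram n // e.IsReduced} => e.1) h

theorem mul_mem_span_cell {x y : LFD n} (hx : x ∈ Submodule.span ℤ[X] (Set.range cell))
    (hy : y ∈ Submodule.span ℤ[X] (Set.range (cell : TypeII n → LFD n))) :
    x * y ∈ Submodule.span ℤ[X] (Set.range (cell : TypeII n → LFD n)) := by
  induction hx, hy using Submodule.span_induction₂ with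
  | mem_mem x y hx hy =>
    obtain ⟨d, rfl⟩ := hx
    obtain ⟨e, rfl⟩ := hy
    by_cases h : ∀ m ∈ (d.1 * e.1).loops, m % 2 = 0
    · rw [cell_mul_of_even d e h]
      exact Submodule.smul_mem _ _ (Submodule.subset_span ⟨_, rfl⟩)
    · push Not at h
      obtain ⟨m, hm, h⟩ := h
      rw [cell_mul_of_odd d e hm (by omega)]
      exact Submodule.zero_mem _
  | zero_left y hy => rw [zero_mul]; exact Submodule.zero_mem _
  | zero_right x hx => rw [mul_zero]; exact Submodule.zero_mem _
  | add_left x y z hx hy hz h1 h2 => rw [add_mul]; exact Submodule.add_mem _ h1 h2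
  | add_right x y z hx hy hz h1 h2 => rw [mul_add]; exact Submodule.add_mem _ h1 h2
  | smul_left r x y hx hy h => rw [smul_mul_assoc]; exact Submodule.smul_mem _ _ h
  | smul_right r x y hx hy h => rw [mul_smul_comm]; exact Submodule.smul_mem _ _ h

theorem cell_one : cell (⟨1, one_isTypeII⟩ : TypeII n) = 1 := by
  unfold cell
  rw [← map_one LFD.mk]
  congr 1
  exact Subtype.ext PHat.of_one

/-- The span contains the unit and the images of the generators and is closed under products, by
`mul_mem_span_cell`. -/
theorem span_cell : Submodule.span ℤ[X] (Set.range (cell : TypeII n → LFD n)) = ⊤ := by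
  rw [eq_top_iff]
  rintro x -
  obtain ⟨⟨y, hy⟩, rfl⟩ : ∃ y, LFD.mk y = x := RingQuot.mkAlgHom_surjective ℤ[X] _ x
  induction hy using Algebra.adjoin_induction with
  | mem y hy =>
    rcases hy with ⟨i, hi, rfl⟩ | ⟨h, rfl⟩
    · exact Submodule.subset_span ⟨⟨simple i hi, cupCap_isTypeII i hi 0 _ (by norm_num)⟩, rfl⟩
    · exact Submodule.subset_span ⟨⟨simpleBar h, cupCap_isTypeII 0 h 1 _ le_rfl⟩, rfl⟩
  | algebraMap r =>
    have : LFD.mk ⟨algebraMap ℤ[X] (PHat n) r, Subalgebra.algebraMap_mem _ r⟩ =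
        r • cell (⟨1, one_isTypeII⟩ : TypeII n) := by
      rw [cell_one, ← Algebra.algebraMap_eq_smul_one, ← AlgHom.commutes LFD.mk]
      rfl
    rw [this]
    exact Submodule.smul_mem _ _ (Submodule.subset_span ⟨_, rfl⟩)
  | add y z hy hz h1 h2 =>
    have := Submodule.add_mem _ h1 h2
    rw [← map_add] at this
    exact this
  | mul y z hy hz h1 h2 =>
    have := mul_mem_span_cell h1 h2
    rw [← map_mul] at this
    exact this

/-- The basis of the loop-free algebra given by the diagrams of type II. -/
noncomputable def cellBasis (n : ℕ) : Module.Basis (TypeII n) ℤ[X] (LFD n) :=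
  Module.Basis.mk cell_linearIndependent span_cell.ge

/-- The linear map induced by top-bottom inversion. -/
noncomputable def starMap (n : ℕ) : LFD n →ₗ[ℤ[X]] LFD n :=
  (cellBasis n).constr ℤ[X] fun d => cell d.flip

theorem starMap_cell (d : TypeII n) : starMap n (cell d) = cell d.flip := by
  have : cellBasis n d = cell d := Module.Basis.mk_apply _ _ d
  rw [← this]
  exact (cellBasis n).constr_basis ℤ[X] _ d

theorem cell_induction {p : LFD n → Prop} (h1 : ∀ d, p (cell d)) (h2 : ∀ x y, p x → p y → p (x + y))
    (h3 : ∀ (r : ℤ[X]) x, p x → p (r • x)) (x : LFD n) : p x := by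
  have hx : x ∈ Submodule.span ℤ[X] (Set.range (cell : TypeII n → LFD n)) := by
    rw [span_cell]
    trivial
  induction hx using Submodule.span_induction with
  | mem x hx =>
    obtain ⟨d, rfl⟩ := hx
    exact h1 d
  | zero =>
    have := h3 0 _ (h1 ⟨1, one_isTypeII⟩)
    rwa [zero_smul] at this
  | add x y _ _ hx hy => exact h2 x y hx hy
  | smul r x _ hx => exact h3 r x hx

theorem starMap_starMap (x : LFD n) : starMap n (starMap n x) = x := by
  induction x using cell_induction with
  | h1 d =>
    rw [starMap_cell, starMap_cell]
    congr 1
    exact Subtype.ext (flip_flip _)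
  | h2 x y hx hy => rw [map_add, map_add, hx, hy]
  | h3 r x hx => rw [map_smul, map_smul, hx]

/-- On basis elements this is `flip_mul`; inversion commutes with reduction and keeps the loops, so
vanishing and powers of `δ` agree on both sides. -/
theorem starMap_mul (x y : LFD n) : starMap n (x * y) = starMap n y * starMap n x := by
  induction x using cell_induction with
  | h1 d =>
    induction y using cell_induction with
    | h1 e =>
      rw [starMap_cell, starMap_cell]
      have hf : e.flip.1 * d.flip.1 = (d.1 * e.1).flip := (flip_mul d.1 e.1).symm
      by_cases h : ∀ m ∈ (d.1 * e.1).loops, m % 2 = 0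
      · have h' : ∀ m ∈ (e.flip.1 * d.flip.1).loops, m % 2 = 0 := by
          rw [hf]
          exact h
        rw [cell_mul_of_even d e h, cell_mul_of_even e.flip d.flip h', map_smul]
        refine congrArg₂ (· • ·) ?_ ((starMap_cell _).trans (congrArg cell ?_))
        · rw [hf]
          rfl
        · apply Subtype.ext
          change (d.1 * e.1).reduce.flip = (e.flip.1 * d.flip.1).reduce
          rw [hf, flip_reduce]
      · push Not at h
        obtain ⟨m, hm, h⟩ := h
        have hm' : m ∈ (e.flip.1 * d.flip.1).loops := by
          rw [hf]
          exact hm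
        rw [cell_mul_of_odd d e hm (by omega), cell_mul_of_odd e.flip d.flip hm' (by omega),
          map_zero]
    | h2 x y hx hy => rw [mul_add, map_add, map_add, add_mul, hx, hy]
    | h3 r x hx => rw [mul_smul_comm, map_smul, map_smul, smul_mul_assoc, hx]
  | h2 x y hx hy => rw [add_mul, map_add, map_add, mul_add, hx, hy]
  | h3 r x hx => rw [smul_mul_assoc, map_smul, map_smul, mul_smul_comm, hx]

/-! ### The left action on cells. -/

/-- The span of the basis elements belonging to smaller labels. -/
noncomputable def lowerSpan (l : Lam n) : Submodule ℤ[X] (LFD n) :=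
  Submodule.span ℤ[X] {x | ∃ m, m < l ∧ ∃ S'' T'', x = cell (comp m S'' T'')}

open Classical in
/-- The coefficients of the left action of a diagram on a cell. -/
noncomputable def cellCoeff (d : TypeII n) (l : Lam n) (S' S : M l) : ℤ[X] :=
  if (∀ m ∈ (d.1 * (comp l S S).1).loops, m % 2 = 0) ∧
    S'.1 = (d.1 * (comp l S S).1).reduce.upperHalf
  then loopWeight (d.1 * (comp l S S).1).loops else 0

/-- The coefficients are computed with `comp l S S` as a representative; by `mul_agree` any other
lower half gives the same loops and the same upper half, so they do not depend on `T`. The product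
is zero, or lies below `l`, or is a multiple of a single element of the cell. -/
theorem cell_mul_cell_comp (d : TypeII n) (l : Lam n) (S T : M l) :
    cell d * cell (comp l S T) - ∑ᶠ S', cellCoeff d l S' S • cell (comp l S' T) ∈ lowerSpan l := by
  obtain ⟨a1, a2⟩ := d.1.mul_agree (e := (comp l S S).1) (e' := (comp l S T).1)
    ((comp_upper l S S).trans (comp_upper l S T).symm)
    ((comp l S S).2.loops.trans (comp l S T).2.loops.symm)
  have hp : numProp (comp l S T).lower = l.1.abs := by rw [comp_lower, T.numProp_eq]
  have hle := numProp_mul_le d.1 (comp l S T).1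
  rw [upperHalf_flip_eq, hp] at hle
  by_cases h : ∀ m ∈ (d.1 * (comp l S T).1).loops, m % 2 = 0
  · rw [cell_mul_of_even d _ h]
    set f : TypeII n := ⟨(d.1 * (comp l S T).1).reduce, d.2.mul_reduce (comp l S T).2 h⟩ with hf
    have hfu : f.upper = (d.1 * (comp l S T).1).reduce.upperHalf := rfl
    by_cases hlt : numProp (d.1 * (comp l S T).1).reduce.upperHalf = l.1.abs
    · have hlow : f.lower = T.1 := by
        rw [← comp_lower l S T]
        exact mul_lowerHalf d.1 _ (comp l S T).2.deco_le (hlt.trans hp.symm)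
      -- Without propagating edges the two halves of `f` have equal parity, and the lower one is
      -- `T`; so the new upper half stays in the same one of `0⁺` and `0⁻`.
      have hpar : l.1.abs = 0 → (Even f.upper.numDeco ↔ Even T.1.numDeco) := by
        intro h0
        have := even_numDeco_halves f (by rw [hfu, hlt, h0])
        rw [hlow, Nat.even_add] at this
        exact this
      let S' : M l := ⟨f.upper, ⟨f, Or.inl rfl⟩, hlt, fun h0 => by
          rw [hpar (by rw [h0]; rfl)]
          exact T.2.2.2.1 h0, fun h0 => by
          rw [← Nat.not_even_iff_odd, hpar (by rw [h0]; rfl), Nat.not_even_iff_odd]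
          exact T.2.2.2.2 h0⟩
      have hfc : f = comp l S' T := (comp_iff l S' T f).1 ⟨rfl, hlow⟩
      rw [finsum_eq_single _ S', hfc, cellCoeff, if_pos, a1, sub_self]
      · exact Submodule.zero_mem _
      · rw [a1, a2]
        exact ⟨h, rfl⟩
      · intro S'' hne
        rw [cellCoeff, if_neg, zero_smul]
        rintro ⟨-, h2⟩
        rw [a2] at h2
        exact hne (Subtype.ext h2)
    · have hz : ∀ S', cellCoeff d l S' S = 0 := by
        intro S'
        rw [cellCoeff, if_neg]
        rintro ⟨-, h2⟩
        rw [a2] at h2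
        exact hlt (by rw [← h2, S'.numProp_eq])
      simp only [hz, zero_smul, finsum_zero, sub_zero]
      -- The number of propagating edges cannot increase, so having changed it is smaller, and the
      -- diagram belongs to a lower label.
      obtain ⟨m, S'', T'', h1, h2⟩ := exists_eq_comp f
      refine Submodule.smul_mem _ _ (Submodule.subset_span ⟨m, ?_, S'', T'', by rw [← h1]⟩)
      change m.1.abs < l.1.abs
      rw [h2, hfu]
      omega
  · have hz : ∀ S', cellCoeff d l S' S = 0 := by
      intro S'
      rw [cellCoeff, if_neg]
      rintro ⟨h1, -⟩
      rw [a1] at h1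
      exact h h1
    simp only [hz, zero_smul, finsum_zero, sub_zero]
    push Not at h
    obtain ⟨m, hm, h⟩ := h
    rw [cell_mul_of_odd d _ hm (by omega)]
    exact Submodule.zero_mem _

/-- The condition is linear in `a`, the coefficients adding up; finiteness of `M l` makes the formal
sums additive. -/
theorem exists_coeff (a : LFD n) (l : Lam n) : ∃ r : M l → M l → ℤ[X], ∀ S T,
    a * cell (comp l S T) - ∑ᶠ S', r S' S • cell (comp l S' T) ∈ lowerSpan l := by
  induction a using cell_induction with
  | h1 d => exact ⟨cellCoeff d l, cell_mul_cell_comp d l⟩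
  | h2 x y hx hy =>
    obtain ⟨r, hr⟩ := hx
    obtain ⟨s, hs⟩ := hy
    refine ⟨fun S' S => r S' S + s S' S, fun S T => ?_⟩
    simp only [add_smul, add_mul]
    rw [finsum_add_distrib (Set.toFinite _) (Set.toFinite _), add_sub_add_comm]
    exact Submodule.add_mem _ (hr S T) (hs S T)
  | h3 c x hx =>
    obtain ⟨r, hr⟩ := hx
    refine ⟨fun S' S => c * r S' S, fun S T => ?_⟩
    simp only [mul_smul, smul_mul_assoc]
    rw [← smul_finsum', ← smul_sub]
    · exact Submodule.smul_mem _ _ (hr S T)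
    · exact Set.toFinite _

theorem isCellDatum (n : ℕ) :
    IsCellDatum ℤ[X] (fun (l : Lam n) S T => cell (comp l S T)) (starMap n) where
  finite l := inferInstance
  injective := cell_linearIndependent.injective.comp comp_injective
  linearIndependent := (cell_linearIndependent.comp _ comp_injective).linearIndepOn_id
  span := by
    have : (Set.range fun x : Σ l : Lam n, M l × M l => cell (comp x.1 x.2.1 x.2.2)) =
        Set.range cell := by
      rw [show (fun x : Σ l : Lam n, M l × M l => cell (comp x.1 x.2.1 x.2.2)) =
        cell ∘ fun x => comp x.1 x.2.1 x.2.2 from rfl, Set.range_comp, comp_range, Set.image_univ]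
    rw [this, span_cell]
  star_star := starMap_starMap
  star_mul := starMap_mul
  star_C l S T := by rw [starMap_cell, comp_flip]
  mul_C a l := exists_coeff a l

end LoopFree

theorem mainTheorem1 (n : ℕ) (hn : 4 ≤ n) :
    ∃ (hmem : ∀ d : LoopFree.TypeII n, LoopFree.PHat.of d.1 ∈ LoopFree.DTL n)
      (comp : ∀ l : LoopFree.Lam n, LoopFree.M l → LoopFree.M l → LoopFree.TypeII n)
      (star : LoopFree.LFD n →ₗ[Polynomial ℤ] LoopFree.LFD n),
      (∀ l S T d, (d.upper = S.1 ∧ d.lower = T.1) ↔ d = comp l S T) ∧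
      (∀ d, star (LoopFree.LFD.mk ⟨LoopFree.PHat.of d.1, hmem d⟩) =
        LoopFree.LFD.mk ⟨LoopFree.PHat.of d.flip.1, hmem d.flip⟩) ∧
      LoopFree.IsCellDatum (Polynomial ℤ)
        (fun l S T => LoopFree.LFD.mk ⟨LoopFree.PHat.of (comp l S T).1, hmem (comp l S T)⟩)
        star :=
  ⟨fun d => LoopFree.LDiagram.of_mem_DTL d.1 d.2, LoopFree.comp, LoopFree.starMap n,
    LoopFree.comp_iff, LoopFree.starMap_cell, LoopFree.isCellDatum n⟩
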